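/- **Setting.** Let $(X_t,\xi_t)_{t\ge1}$ be iid couples with values in $\mathcal X\times\mathbb R$, where $\mathcal X$ is a measurable space, with $\xi_1$ independent of $X_1$, and let $$Y_t=\mu(X_t)+\sigma(X_t)\,\xi_t,\qquad t\ge 1,$$ with $\mu:\mathcal X\to\mathbb R$ and $\sigma:\mathcal X\to(0,\infty)$ measurable. Assume that $\sup_{x\in\mathcal X}1/\sigma(x)<\infty$, that $\mathbb E\,\xi_1^2=1$, and that $\xi_1$ has a symmetric continuous density $f$ with respect to Lebesgue measure, positive on an interval and zero outside it, with $\sup_x f(x)<\infty$ and $\sup_x|x|f(x)<\infty$. Let $\mathcal D_0$ be a finite holdout sample with values in $\mathcal X\times\mathbb R$, independent of $(X_t,\xi_t)_{t\ge1}$, and let $\mathcal F_t=\sigma(\mathcal D_0,(X_k,Y_k)_{1\le k\le t})$. Let $\hat\mu_t,\hat\sigma_t$ be real-valued $\mathcal F_{t-1}$-measurable estimators, i.e. random functions on $\mathcal X$ that are jointly measurable in (outcome, $x$) with respect to $\mathcal F_{t-1}$ and the $\sigma$-field of $\mathcal X$. Let $S:\mathcal X\to\{0,1\}$ be a measurable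 selection rule with $\mathbb P(S(X_1)=1)\in(0,1]$. Let $\Phi$ be the standard normal distribution function, $\bar\Phi=1-\Phi$, $\bar F(x)=\mathbb P(\xi_1>x)$, and fix $\alpha\in(0,1)$. Put $$\mathcal C_t(x,q)=\Big[\hat\mu_t(x)\pm\hat\sigma_t(x)\,\Phi^{-1}\Big(\frac{q+1}{2}\Big)\Big]\ \text{ for } 0<q<1,$$ $\mathcal C_t(x,q)=\{\hat\mu_t(x)\}$ for $q\le0$ and $\mathcal C_t(x,q)=\mathbb R$ for $q\ge1$ (with $[a\pm b]=[a-b,a+b]$). **OnlineSCI.** Let $\gamma_j=c\,j^{-\beta}$ with $c>0$ and $\beta\in(0,1)$, and let $q_1\in[0,1]$. For $t\ge1$ put $J(t)=1+\sum_{i=1}^{t-1}S(X_i)$ and $$q_{t+1}=q_t+\gamma_{J(t)}\big(\mathbf 1\{Y_t\notin\mathcal C_t(X_t,q_t)\}\mathbf 1\{q_t\ge0\}+\mathbf 1\{q_t<0\}-\alpha\big)\,S(X_t).$$ The instantaneous error rate is $\mathrm{IER}_t=\mathbb P\big(Y_t\notin\mathcal C_t(X_t,q_t)\mid S(X_t)=1,\mathcal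 F_{t-1}\big)$, and the target threshold is $q^0_\alpha=1-2\bar\Phi(\bar F^{-1}(\alpha/2))$. Let $$\rho(t)=\begin{cases}(\log t)^{1/2}\,t^{-\beta/3}&\text{if }\beta\in(1/2,3/4),\\ (\log t)^{1/2}\,t^{1/2-\beta}+t^{\beta-1}&\text{if }\beta\in[3/4,1).\end{cases}$$ **Result.** Let $\nu_0,\tau_0>0$ and $\nu,\tau\in(0,1/2]$. There exist $T_0\ge1$ and $C_0>0$, which may depend on everything but $t$, such that for all $t\ge T_0$: * *In-probability rate.* If $\beta\in(1/2,1)$ and, for some $C_1>0$ and all $s$ large enough, $$\mathbb P\Big(\mathbb E\big[|\hat\mu_s(X_s)-\mu(X_s)|+|\hat\sigma_s(X_s)-\sigma(X_s)|\,\big|\,\mathcal F_{s-1}\big]\ge C_1(\log s)^{\nu_0}s^{-\nu}\Big)\le\frac{3}{\pi^2s^3},$$ then $$\mathbb P\Big(|\mathrm{IER}_t-\alpha|+|q_t-q^0_\alpha|\le C_0\big(\rho(t)+(\log t)^{\nu_0}t^{-\nu}\big)\Big)\ge1-\frac1t.$$ * *In-expectation rate.* If $\beta>1-\tau$ and, for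 some $C_1>0$ and all $s$ large enough, $$\mathbb E\big[(\hat\mu_s(X_s)-\mu(X_s))^2\big]+\mathbb E\big[(\hat\sigma_s(X_s)-\sigma(X_s))^2\big]\le C_1(\log s)^{2\tau_0}s^{-2\tau},$$ then $$\Big(\mathbb E\big[|\mathrm{IER}_t-\alpha|\,\mathbf 1\{q_t\in[0,1]\}\big]\Big)^2+\mathbb E\big[(q_t-q^0_\alpha)^2\big]\le C_0(\log t)^{\tau_0}\,t^{1-\tau-\beta}.$$ -/

import Mathlib

open MeasureTheory ProbabilityTheory Filter

namespace OnlineSCI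

noncomputable section

/-! ### Quantiles, the prediction interval and the error function -/

/-- Upper tail `x ↦ ν (x, ∞)` of a distribution `ν` on the real line. -/
def upperTail (ν : Measure ℝ) (x : ℝ) : ℝ := ν.real (Set.Ioi x)

/-- Inverse of the upper tail (generalized inverse, for levels in `(0, 1)`). -/
def upperTailInv (ν : Measure ℝ) (u : ℝ) : ℝ := sInf {x : ℝ | upperTail ν x ≤ u}

/-- Standard normal distribution. -/
def stdNormal : Measure ℝ := gaussianReal 0 1

/-- Standard normal quantile function `Φ⁻¹`, for levels in `(0, 1)`. -/
def normalQuantile (p : ℝ) : ℝ := sInf {x : ℝ | p ≤ cdf stdNormal x}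

/-- The prediction set attached to the threshold `q` (scores are scaled to `[0, 1]`), around the
point prediction `m` with scale `s`: the interval `[m ± s Φ⁻¹((q + 1) / 2)]` for `0 < q < 1`, the
point prediction for `q ≤ 0` and the whole line for `q ≥ 1`. -/
def predInterval (m s q : ℝ) : Set ℝ :=
  if q ≤ 0 then {m}
  else if 1 ≤ q then Set.univ
  else Set.Icc (m - s * normalQuantile ((q + 1) / 2)) (m + s * normalQuantile ((q + 1) / 2))

open Classical in
/-- Coverage error `1{y ∉ C}`. -/
def covErr (y : ℝ) (C : Set ℝ) : ℝ := if y ∈ C then 0 else 1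

/-- Reaction function: the error when `q ≥ 0`, and `1` when `q < 0`. -/
def react (y : ℝ) (C : Set ℝ) (q : ℝ) : ℝ := if 0 ≤ q then covErr y C else 1

/-! ### The OnlineSCI recursion (along one realization of the data)

Time starts at `1`; the values at time `0` are not used. -/

/-- The pair `(q_t, J(t))`: threshold, and one plus the number of selections before time `t`. -/
def sciState {𝒳 : Type*} (α : ℝ) (γ : ℕ → ℝ) (q₁ : ℝ) (S : ℕ → 𝒳 → ℝ → Bool)
    (C : ℕ → 𝒳 → ℝ → Set ℝ) (x : ℕ → 𝒳) (y : ℕ → ℝ) : ℕ → ℝ × ℕ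
  | 0 => (q₁, 1)
  | 1 => (q₁, 1)
  | t + 2 =>
    let q := (sciState α γ q₁ S C x y (t + 1)).1
    let J := (sciState α γ q₁ S C x y (t + 1)).2
    let s := (S (t + 1) (x (t + 1)) q).toNat
    (q + γ J * (react (y (t + 1)) (C (t + 1) (x (t + 1)) q) q - α) * (s : ℝ), J + s)

/-- The OnlineSCI threshold sequence `q_t`. -/
def sciThreshold {𝒳 : Type*} (α : ℝ) (γ : ℕ → ℝ) (q₁ : ℝ) (S : ℕ → 𝒳 → ℝ → Bool)
    (C : ℕ → 𝒳 → ℝ → Set ℝ) (x : ℕ → 𝒳) (y : ℕ → ℝ) (t : ℕ) : ℝ :=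
  (sciState α γ q₁ S C x y t).1

/-! ### Probabilistic setting -/

/-- The information `ℱ_t` generated by the holdout sample `D₀` and by `(X_k, Y_k)`, `1 ≤ k ≤ t`. -/
abbrev past {Ω 𝒳 : Type*} [MeasurableSpace 𝒳] {n : ℕ} (D₀ : Fin n → Ω → 𝒳 × ℝ) (X : ℕ → Ω → 𝒳) (Y : ℕ → Ω → ℝ) (t : ℕ) :
    MeasurableSpace Ω :=
  (⨆ i : Fin n, MeasurableSpace.comap (D₀ i) inferInstance) ⊔
    ⨆ k ∈ Set.Icc 1 t, MeasurableSpace.comap (fun ω => (X k ω, Y k ω)) inferInstance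

/-- `μ̂_t` is a function of the covariate and of the past: `(ω, x) ↦ μ̂_t(ω, x)` is
`ℱ_{t-1} ⊗ 𝒳`-measurable for each `t ≥ 1`. -/
def IsPastMeasurable {Ω 𝒳 : Type*} [MeasurableSpace 𝒳] (ℱ : ℕ → MeasurableSpace Ω)
    (est : ℕ → Ω → 𝒳 → ℝ) : Prop :=
  ∀ t, 1 ≤ t →
    @Measurable (Ω × 𝒳) ℝ (@Prod.instMeasurableSpace Ω 𝒳 (ℱ (t - 1)) inferInstance) inferInstance
      (fun p => est t p.1 p.2)

section Setting

variable {Ω 𝒳 : Type*} [MeasurableSpace Ω] [MeasurableSpace 𝒳]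

/-- `E[err | s = 1, ℱ] = E[err 1{s = 1} | ℱ] / P(s = 1 | ℱ)`, with value `0` where the denominator
vanishes. -/
def instErrorRate (P : Measure Ω) (ℱ : MeasurableSpace Ω) (s : Ω → Bool) (err : Ω → ℝ) (ω : Ω) :
    ℝ :=
  (P[fun ω' => err ω' * ((s ω').toNat : ℝ) | ℱ]) ω / (P[fun ω' => ((s ω').toNat : ℝ) | ℱ]) ω

/-- The online iid regression model `Y_t = μ(X_t) + σ(X_t) ξ_t`, `t ≥ 1`: the couples `(X_t, ξ_t)`
are iid and independent of the holdout sample, and the noise is independent of the covariate. -/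
structure IsIIDRegression (P : Measure Ω) {n : ℕ} (D₀ : Fin n → Ω → 𝒳 × ℝ) (X : ℕ → Ω → 𝒳)
    (ξ Y : ℕ → Ω → ℝ) (μ σ : 𝒳 → ℝ) : Prop where
  measurable_holdout : ∀ i, Measurable (D₀ i)
  measurable_X : ∀ t, 1 ≤ t → Measurable (X t)
  measurable_noise : ∀ t, 1 ≤ t → Measurable (ξ t)
  measurable_mean : Measurable μ
  measurable_scale : Measurable σ
  scale_pos : ∀ x, 0 < σ x
  model : ∀ t, 1 ≤ t → ∀ ω, Y t ω = μ (X t ω) + σ (X t ω) * ξ t ω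
  indep : iIndepFun (fun (t : ℕ) ω => (X (t + 1) ω, ξ (t + 1) ω)) P
  identDistrib : ∀ t : ℕ,
    IdentDistrib (fun ω => (X (t + 1) ω, ξ (t + 1) ω)) (fun ω => (X 1 ω, ξ 1 ω)) P P
  indep_holdout :
    IndepFun (fun ω i => D₀ i ω) (fun ω (t : ℕ) => (X (t + 1) ω, ξ (t + 1) ω)) P
  indep_noise : IndepFun (X 1) (ξ 1) P

/-- Assumptions on the noise distribution, with Lebesgue density `f`, and on the scale `σ`. -/
structure IsRegularNoise (P : Measure Ω) (ξ₁ : Ω → ℝ) (f : ℝ → ℝ) (σ : 𝒳 → ℝ) : Prop where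
  density_nonneg : ∀ x, 0 ≤ f x
  density : P.map ξ₁ = volume.withDensity (fun x => ENNReal.ofReal (f x))
  symmetric : ∀ x, f (-x) = f x
  continuous : Continuous f
  /-- the density is positive on an interval and zero outside it -/
  support_interval : {x | 0 < f x}.OrdConnected
  bounded : BddAbove (Set.range f)
  bounded_mul : BddAbove (Set.range fun x => |x| * f x)
  bounded_inv_scale : BddAbove (Set.range fun x => 1 / σ x)
  second_moment : ∫ ω, ξ₁ ω ^ 2 ∂P = 1

/-- For `t` large enough,
`P(E[|μ̂_t(X_t) - μ(X_t)| + |σ̂_t(X_t) - σ(X_t)| | ℱ_{t-1}] ≥ C₁ (log t)^ν₀ t^(-ν)) ≤ 3 / (π² t³)`;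
the conditional expectation is the `[0, ∞]`-valued one. -/
def RateInProbability (P : Measure Ω) (ℱ : ℕ → MeasurableSpace Ω) (X : ℕ → Ω → 𝒳) (μ σ : 𝒳 → ℝ)
    (μhat σhat : ℕ → Ω → 𝒳 → ℝ) (ν₀ ν : ℝ) : Prop :=
  ∃ C₁ : ℝ, 0 < C₁ ∧ ∀ᶠ t : ℕ in atTop,
    P {ω | ENNReal.ofReal (C₁ * Real.log t ^ ν₀ * (t : ℝ) ^ (-ν)) ≤
        condLExp (ℱ (t - 1)) P (fun ω' => ENNReal.ofReal
          (|μhat t ω' (X t ω') - μ (X t ω')| + |σhat t ω' (X t ω') - σ (X t ω')|)) ω}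
      ≤ ENNReal.ofReal (3 / (Real.pi ^ 2 * (t : ℝ) ^ 3))

/-- For `t` large enough,
`E[(μ̂_t(X_t) - μ(X_t))²] + E[(σ̂_t(X_t) - σ(X_t))²] ≤ C₁ (log t)^(2 τ₀) t^(-2 τ)`. -/
def RateInMean (P : Measure Ω) (X : ℕ → Ω → 𝒳) (μ σ : 𝒳 → ℝ)
    (μhat σhat : ℕ → Ω → 𝒳 → ℝ) (τ₀ τ : ℝ) : Prop :=
  ∃ C₁ : ℝ, 0 < C₁ ∧ ∀ᶠ t : ℕ in atTop,
    ∫⁻ ω, ENNReal.ofReal ((μhat t ω (X t ω) - μ (X t ω)) ^ 2) ∂P +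
        ∫⁻ ω, ENNReal.ofReal ((σhat t ω (X t ω) - σ (X t ω)) ^ 2) ∂P
      ≤ ENNReal.ofReal (C₁ * Real.log t ^ (2 * τ₀) * (t : ℝ) ^ (-(2 * τ)))

end Setting

/-! ### Target threshold and rate -/

/-- `q⁰_α = 1 - 2 Φ̄(F̄⁻¹(α / 2))`, where `F̄` is the upper tail of the noise distribution. -/
def targetThreshold (noise : Measure ℝ) (α : ℝ) : ℝ :=
  1 - 2 * upperTail stdNormal (upperTailInv noise (α / 2))

/-- The rate `ρ(t)`, for `1 / 2 < β < 1`. -/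
def rho (β : ℝ) (t : ℕ) : ℝ :=
  if β < 3 / 4 then Real.log t ^ (1 / 2 : ℝ) * (t : ℝ) ^ (-β / 3)
  else Real.log t ^ (1 / 2 : ℝ) * (t : ℝ) ^ (1 / 2 - β) + (t : ℝ) ^ (β - 1)

end

end OnlineSCI

/-!
Given the past, the increment of `q` at time `t` has mean `r * (π(q_t) - α)` up to an estimation
bias, where `r` is the selection probability and `π(q)` the error rate at threshold `q` of the
intervals built from the true `μ` and `σ`. Since `π` decreases with slopes bounded away from `0` and
`∞`, and the step sizes are of order `t ^ (-β)` with high probability, `D_t = q_t - q⁰_α` is a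
Robbins–Monro recursion with a contracting mean field. Bounding its squared error recursively gives
the rate in mean; unrolling it over the last half of the time axis and applying a sub-Gaussian bound
to the accumulated martingale noise gives the rate in probability. The bias is Lipschitz in the
estimation errors because `f` and `x ↦ |x| * f x` are bounded. As `r * (IER_t - α)` is the
conditional mean of the increment, the error rate inherits the rates of `D_t` and of the bias.
-/

namespace OnlineSCI

/-! ### Distribution functions and quantiles -/

section Cdf

variable {ν : Measure ℝ} {f : ℝ → ℝ}

lemma cdf_sub_cdf [IsProbabilityMeasure ν] {a b : ℝ} (hab : a ≤ b) :
    cdf ν b - cdf ν a = ν.real (Set.Ioc a b) := by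
  rw [cdf_eq_real, cdf_eq_real, ← Set.Iic_union_Ioc_eq_Iic hab,
    measureReal_union (Set.Iic_disjoint_Ioc le_rfl) measurableSet_Ioc]
  ring

lemma upperTail_eq_one_sub_cdf [IsProbabilityMeasure ν] (x : ℝ) :
    upperTail ν x = 1 - cdf ν x := by
  rw [cdf_eq_real, upperTail, ← Set.compl_Iic, probReal_compl_eq_one_sub measurableSet_Iic]

lemma hasDerivAt_cdf [IsProbabilityMeasure ν]
    (hν : ν = volume.withDensity fun x => ENNReal.ofReal (f x)) (hf0 : ∀ x, 0 ≤ f x)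
    (hf : Continuous f) (x : ℝ) :
    HasDerivAt (cdf ν) (f x) x := by
  have increment {a b : ℝ} (hab : a ≤ b) : cdf ν b - cdf ν a = ∫ t in a..b, f t := by
    rw [cdf_sub_cdf hab, intervalIntegral.integral_of_le hab,
      integral_eq_lintegral_of_nonneg_ae (.of_forall hf0) hf.aestronglyMeasurable,
      ← withDensity_apply _ measurableSet_Ioc, ← hν, measureReal_def]
  have cdf_eq : ⇑(cdf ν) = fun y => cdf ν 0 + ∫ t in (0 : ℝ)..y, f t := by
    funext y
    rcases le_total 0 y with hy | hy
    · rw [← increment hy]; ring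
    · rw [intervalIntegral.integral_symm, ← increment hy]; ring
  rw [cdf_eq]
  exact (hf.integral_hasStrictDerivAt 0 x).hasDerivAt.const_add _

lemma continuous_cdf (hF : ∀ x, HasDerivAt (cdf ν) (f x) x) : Continuous (cdf ν) :=
  continuous_iff_continuousAt.2 fun x => (hF x).continuousAt

lemma density_nonneg (hF : ∀ x, HasDerivAt (cdf ν) (f x) x) (x : ℝ) : 0 ≤ f x :=
  (hF x).deriv ▸ (monotone_cdf ν).deriv_nonneg

lemma abs_cdf_sub_cdf_le (hF : ∀ x, HasDerivAt (cdf ν) (f x) x) {s : Set ℝ} (hs : Convex ℝ s)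
    {M : ℝ} (hM : ∀ x ∈ s, f x ≤ M) {a b : ℝ} (ha : a ∈ s) (hb : b ∈ s) :
    |cdf ν b - cdf ν a| ≤ M * |b - a| :=
  hs.norm_image_sub_le_of_norm_hasDerivWithin_le (fun x _ => (hF x).hasDerivWithinAt)
    (fun x hx => by rw [Real.norm_of_nonneg (density_nonneg hF x)]; exact hM x hx) ha hb

lemma abs_cdf_sub_cdf_le_one (a b : ℝ) : |cdf ν b - cdf ν a| ≤ 1 :=
  abs_sub_le_of_nonneg_of_le (cdf_nonneg ν b) (cdf_le_one ν b) (cdf_nonneg ν a) (cdf_le_one ν a)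

lemma cdf_neg_of_even (hF : ∀ x, HasDerivAt (cdf ν) (f x) x) (hf : Function.Even f) (x : ℝ) :
    cdf ν (-x) = 1 - cdf ν x := by
  have hderiv (y : ℝ) : HasDerivAt (fun y => cdf ν y + cdf ν (-y)) 0 y := by
    have h := (hF y).add ((hF (-y)).comp y (hasDerivAt_neg y))
    rwa [hf y, mul_neg_one, add_neg_cancel] at h
  have hlim : Tendsto (fun y => cdf ν y + cdf ν (-y)) atTop (nhds (1 + 0)) :=
    (tendsto_cdf_atTop ν).add ((tendsto_cdf_atBot ν).comp tendsto_neg_atTop_atBot)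
  have hconst (y : ℝ) : cdf ν y + cdf ν (-y) = cdf ν x + cdf ν (-x) :=
    is_const_of_deriv_eq_zero (fun z => (hderiv z).differentiableAt) (fun z => (hderiv z).deriv) y x
  have := tendsto_nhds_unique (tendsto_const_nhds.congr fun y => (hconst y).symm) hlim
  linarith

lemma cdf_zero_of_even (hF : ∀ x, HasDerivAt (cdf ν) (f x) x) (hf : Function.Even f) :
    cdf ν 0 = 1 / 2 := by
  have := cdf_neg_of_even hF hf 0
  rw [neg_zero] at this
  linarith

/-- Generalized inverse of the distribution function of `ν`, for levels in `(0, 1)`; both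
`normalQuantile` and `upperTailInv` are instances of it. -/
noncomputable def quantile (ν : Measure ℝ) (p : ℝ) : ℝ := sInf {x : ℝ | p ≤ cdf ν x}

lemma upperTailInv_eq_quantile [IsProbabilityMeasure ν] (u : ℝ) :
    upperTailInv ν u = quantile ν (1 - u) := by
  simp only [upperTailInv, quantile, upperTail_eq_one_sub_cdf, sub_le_comm]

lemma quantile_le_iff {p : ℝ} (hp : p ∈ Set.Ioo (0 : ℝ) 1) {x : ℝ} :
    quantile ν p ≤ x ↔ p ≤ cdf ν x := by
  have hne : {x : ℝ | p ≤ cdf ν x}.Nonempty :=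
    ((tendsto_cdf_atTop ν).eventually_const_le hp.2).exists
  have hbdd : BddBelow {x : ℝ | p ≤ cdf ν x} := by
    obtain ⟨y, hy⟩ := ((tendsto_cdf_atBot ν).eventually_lt_const hp.1).exists
    exact ⟨y, fun x hx => ((monotone_cdf ν).reflect_lt (hy.trans_le hx)).le⟩
  have hmem : p ≤ cdf ν (quantile ν p) := by
    have hright : Tendsto (cdf ν) (nhdsWithin (quantile ν p) (Set.Ioi (quantile ν p)))
        (nhds (cdf ν (quantile ν p))) :=
      ((cdf ν).right_continuous _).mono_left (nhdsWithin_mono _ Set.Ioi_subset_Ici_self)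
    refine ge_of_tendsto hright ?_
    filter_upwards [self_mem_nhdsWithin] with y hy
    obtain ⟨z, hz, hzy⟩ := exists_lt_of_csInf_lt hne hy
    exact hz.trans (monotone_cdf ν hzy.le)
  exact ⟨fun h => hmem.trans (monotone_cdf ν h), fun h => csInf_le hbdd h⟩

lemma cdf_quantile (hF : Continuous (cdf ν)) {p : ℝ} (hp : p ∈ Set.Ioo (0 : ℝ) 1) :
    cdf ν (quantile ν p) = p := by
  have hleft : Tendsto (cdf ν) (nhdsWithin (quantile ν p) (Set.Iio (quantile ν p)))
      (nhds (cdf ν (quantile ν p))) := hF.continuousWithinAt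
  refine le_antisymm (le_of_tendsto hleft ?_)
    ((quantile_le_iff hp).1 le_rfl)
  filter_upwards [self_mem_nhdsWithin] with y (hy : y < quantile ν p)
  exact (not_le.1 fun h => hy.not_ge ((quantile_le_iff hp).2 h)).le

lemma quantile_pos_of_even (hF : ∀ x, HasDerivAt (cdf ν) (f x) x) (hf : Function.Even f) {p : ℝ}
    (hp : p ∈ Set.Ioo (1 / 2 : ℝ) 1) : 0 < quantile ν p := by
  rw [← not_le, quantile_le_iff ⟨one_half_pos.trans hp.1, hp.2⟩, cdf_zero_of_even hF hf]
  exact hp.1.not_ge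

lemma density_quantile_pos (hF : ∀ x, HasDerivAt (cdf ν) (f x) x) (hf : Function.Even f)
    (hord : {x | 0 < f x}.OrdConnected) {p : ℝ} (hp : p ∈ Set.Ioo (1 / 2 : ℝ) 1) :
    0 < f (quantile ν p) := by
  set z := quantile ν p
  have hz : 0 < z := quantile_pos_of_even hF hf hp
  obtain ⟨y, hzy, hy⟩ : ∃ y, z < y ∧ 0 < f y := by
    by_contra! h
    have hanti : AntitoneOn (cdf ν) (Set.Ici z) :=
      antitoneOn_of_deriv_nonpos (convex_Ici z) (continuous_cdf hF).continuousOn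
        (fun x _ => (hF x).differentiableAt.differentiableWithinAt)
        fun x hx => (hF x).deriv.symm ▸ h x (by simpa using hx)
    have hone : 1 ≤ cdf ν z := le_of_tendsto (tendsto_cdf_atTop ν) <| by
      filter_upwards [eventually_ge_atTop z] with x hx
      exact hanti Set.self_mem_Ici hx hx
    rw [cdf_quantile (continuous_cdf hF) ⟨one_half_pos.trans hp.1, hp.2⟩] at hone
    exact hp.2.not_ge hone
  exact hord.out (hf y ▸ hy : 0 < f (-y)) hy ⟨by linarith, hzy.le⟩

end Cdf

/-! ### The standard normal distribution -/

instance : IsProbabilityMeasure stdNormal := by unfold stdNormal; infer_instance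

lemma hasDerivAt_cdf_stdNormal (x : ℝ) : HasDerivAt (cdf stdNormal) (gaussianPDFReal 0 1 x) x :=
  hasDerivAt_cdf (gaussianReal_of_var_ne_zero 0 one_ne_zero) (gaussianPDFReal_nonneg 0 1)
    (by unfold gaussianPDFReal; fun_prop) x

lemma strictMono_cdf_stdNormal : StrictMono (cdf stdNormal) :=
  strictMono_of_deriv_pos fun x =>
    (hasDerivAt_cdf_stdNormal x).deriv ▸ gaussianPDFReal_pos 0 1 x one_ne_zero

lemma even_gaussianPDFReal : Function.Even (gaussianPDFReal 0 1) := fun x => by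
  simp [gaussianPDFReal]

lemma cdf_stdNormal_mem_Ioo (x : ℝ) : cdf stdNormal x ∈ Set.Ioo (0 : ℝ) 1 :=
  ⟨(cdf_nonneg _ _).trans_lt (strictMono_cdf_stdNormal (sub_one_lt x)),
    (strictMono_cdf_stdNormal (lt_add_one x)).trans_le (cdf_le_one _ _)⟩

lemma cdf_normalQuantile {p : ℝ} (hp : p ∈ Set.Ioo (0 : ℝ) 1) :
    cdf stdNormal (normalQuantile p) = p :=
  cdf_quantile (continuous_cdf hasDerivAt_cdf_stdNormal) hp

lemma normalQuantile_cdf (x : ℝ) : normalQuantile (cdf stdNormal x) = x :=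
  strictMono_cdf_stdNormal.injective (cdf_normalQuantile (cdf_stdNormal_mem_Ioo x))

lemma strictMonoOn_normalQuantile : StrictMonoOn normalQuantile (Set.Ioo 0 1) :=
  fun p hp p' hp' h => by
    rwa [← strictMono_cdf_stdNormal.lt_iff_lt, cdf_normalQuantile hp, cdf_normalQuantile hp']

lemma half_add_one_mem_Ioo {q : ℝ} (hq : q ∈ Set.Ioo (0 : ℝ) 1) :
    (q + 1) / 2 ∈ Set.Ioo (1 / 2 : ℝ) 1 :=
  ⟨by linarith [hq.1], by linarith [hq.2]⟩

lemma normalQuantile_pos {p : ℝ} (hp : p ∈ Set.Ioo (1 / 2 : ℝ) 1) : 0 < normalQuantile p :=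
  quantile_pos_of_even hasDerivAt_cdf_stdNormal even_gaussianPDFReal hp

lemma continuousAt_normalQuantile {p : ℝ} (hp : p ∈ Set.Ioo (0 : ℝ) 1) :
    ContinuousAt normalQuantile p := by
  have himage : normalQuantile '' Set.Ioo 0 1 = Set.univ := Set.eq_univ_of_forall fun x =>
    ⟨cdf stdNormal x, cdf_stdNormal_mem_Ioo x, normalQuantile_cdf x⟩
  exact strictMonoOn_normalQuantile.continuousAt_of_image_mem_nhds (Ioo_mem_nhds hp.1 hp.2)
    (himage ▸ univ_mem)

lemma measurable_indicator_normalQuantile :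
    Measurable ((Set.Ioo 0 1).indicator normalQuantile) := by
  classical
  rw [← Set.piecewise_eq_indicator]
  exact ContinuousOn.measurable_piecewise
    (fun p hp => (continuousAt_normalQuantile hp).continuousWithinAt) continuousOn_const
    measurableSet_Ioo

lemma hasDerivAt_normalQuantile {p : ℝ} (hp : p ∈ Set.Ioo (0 : ℝ) 1) :
    HasDerivAt normalQuantile (gaussianPDFReal 0 1 (normalQuantile p))⁻¹ p :=
  (hasDerivAt_cdf_stdNormal _).of_local_left_inverse (continuousAt_normalQuantile hp)
    (gaussianPDFReal_pos 0 1 _ one_ne_zero).ne'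
    (eventually_of_mem (Ioo_mem_nhds hp.1 hp.2) fun _ => cdf_normalQuantile)

/-! ### Slopes of antitone functions -/

lemma exists_local_slope_bounds {G : ℝ → ℝ} {G' x₀ : ℝ} (hderiv : HasDerivAt G G' x₀)
    (hneg : G' < 0) : ∃ δ > 0, ∀ x, |x - x₀| ≤ δ →
      -G' / 2 * (x - x₀) ^ 2 ≤ (x - x₀) * (G x₀ - G x) ∧
        |G x - G x₀| ≤ 2 * -G' * |x - x₀| := by
  obtain ⟨δ, hδ, happrox⟩ := Metric.eventually_nhds_iff_ball.1
    (hderiv.isLittleO.def (c := -G' / 2) (by linarith))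
  refine ⟨δ / 2, half_pos hδ, fun x hx => ?_⟩
  have h : |G x - G x₀ - (x - x₀) * G'| ≤ -G' / 2 * |x - x₀| :=
    happrox x (by rw [Metric.mem_ball, Real.dist_eq]; linarith)
  constructor
  · have hprod : (x - x₀) * (G x - G x₀ - (x - x₀) * G') ≤ -G' / 2 * (x - x₀) ^ 2 :=
      calc _ ≤ |x - x₀| * |G x - G x₀ - (x - x₀) * G'| := by rw [← abs_mul]; exact le_abs_self _
        _ ≤ |x - x₀| * (-G' / 2 * |x - x₀|) := by gcongr
        _ = -G' / 2 * (x - x₀) ^ 2 := by rw [← sq_abs (x - x₀)]; ring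
    linarith
  · calc |G x - G x₀| = |(G x - G x₀ - (x - x₀) * G') + (x - x₀) * G'| := by ring_nf
      _ ≤ -G' / 2 * |x - x₀| + |x - x₀| * -G' := by
        grw [abs_add_le, h, abs_mul, abs_of_neg hneg]
      _ ≤ 2 * -G' * |x - x₀| := by nlinarith [abs_nonneg (x - x₀)]

theorem exists_slope_bounds {G : ℝ → ℝ} (hG : Antitone G) {G' x₀ : ℝ}
    (hderiv : HasDerivAt G G' x₀) (hneg : G' < 0) {B : ℝ} (hB : 0 < B) :
    ∃ κ K, 0 < κ ∧ 0 < K ∧ ∀ x, |x - x₀| ≤ B →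
      κ * (x - x₀) ^ 2 ≤ (x - x₀) * (G x₀ - G x) ∧ |G x - G x₀| ≤ K * |x - x₀| := by
  obtain ⟨δ, hδ, hlocal⟩ := exists_local_slope_bounds hderiv hneg
  have hκ : 0 < -G' / 2 := by linarith
  set A := G (x₀ - B) - G (x₀ + B)
  have hA : 0 ≤ A := sub_nonneg.2 (hG (by linarith))
  refine ⟨-G' / 2 * min 1 (δ / B), 2 * -G' + A / δ, by positivity,
    add_pos_of_pos_of_nonneg (by linarith) (div_nonneg hA hδ.le), fun x hx => ?_⟩
  rcases le_or_gt |x - x₀| δ with hnear | hfar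
  · obtain ⟨hlower, hupper⟩ := hlocal x hnear
    exact ⟨(by gcongr; exact mul_le_of_le_one_right hκ.le (min_le_left _ _) : _ ≤ _).trans hlower,
      hupper.trans (by gcongr; linarith [div_nonneg hA hδ.le])⟩
  have hgap : |x - x₀| * (-G' / 2 * δ) ≤ (x - x₀) * (G x₀ - G x) := by
    rcases le_total x₀ x with hle | hle
    · rw [abs_of_nonneg (sub_nonneg.2 hle)] at hfar ⊢
      have h := (hlocal (x₀ + δ) (by simp [abs_of_pos hδ])).1
      have hmono : G x ≤ G (x₀ + δ) := hG (by linarith)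
      refine mul_le_mul_of_nonneg_left ?_ (by linarith)
      nlinarith
    · rw [abs_of_nonpos (sub_nonpos.2 hle)] at hfar ⊢
      have h := (hlocal (x₀ - δ) (by simp [abs_of_pos hδ])).1
      have hmono : G (x₀ - δ) ≤ G x := hG (by linarith)
      rw [← neg_mul_neg (x - x₀)]
      refine mul_le_mul_of_nonneg_left ?_ (by linarith)
      nlinarith
  have hrange := abs_le.1 hx
  constructor
  · calc -G' / 2 * min 1 (δ / B) * (x - x₀) ^ 2
        ≤ -G' / 2 * (δ / B) * (B * |x - x₀|) := by
          rw [← sq_abs, sq]; gcongr; exact min_le_right _ _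
      _ = |x - x₀| * (-G' / 2 * δ) := by field_simp
      _ ≤ _ := hgap
  · calc |G x - G x₀| ≤ A :=
          abs_sub_le_of_le_of_le (hG (by linarith)) (hG (by linarith)) (hG (by linarith))
            (hG (by linarith))
      _ ≤ A / δ * |x - x₀| := by rw [div_mul_eq_mul_div, le_div_iff₀ hδ]; gcongr
      _ ≤ (2 * -G' + A / δ) * |x - x₀| := by gcongr; linarith

/-! ### The error rate of the oracle intervals -/

/-- Error rate at threshold `q` of the prediction intervals built from the true mean and scale, when
the noise has distribution `ν`: the mean field of the stochastic approximation. -/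
noncomputable def idealError (ν : Measure ℝ) (q : ℝ) : ℝ :=
  if q ≤ 0 then 1 else if 1 ≤ q then 0 else 2 * upperTail ν (normalQuantile ((q + 1) / 2))

section IdealError

variable {ν : Measure ℝ} {f : ℝ → ℝ}

lemma idealError_of_mem_Ioo [IsProbabilityMeasure ν] {q : ℝ} (hq : q ∈ Set.Ioo (0 : ℝ) 1) :
    idealError ν q = 2 * (1 - cdf ν (normalQuantile ((q + 1) / 2))) := by
  rw [idealError, if_neg hq.1.not_ge, if_neg hq.2.not_ge, upperTail_eq_one_sub_cdf]

lemma idealError_mem_Icc [IsProbabilityMeasure ν] (hF : ∀ x, HasDerivAt (cdf ν) (f x) x)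
    (hf : Function.Even f) (q : ℝ) : idealError ν q ∈ Set.Icc (0 : ℝ) 1 := by
  rcases le_or_gt q 0 with h0 | h0
  · simp [idealError, h0]
  rcases le_or_gt 1 q with h1 | h1
  · simp [idealError, h0.not_ge, h1]
  have hhalf : 1 / 2 ≤ cdf ν (normalQuantile ((q + 1) / 2)) :=
    cdf_zero_of_even hF hf ▸ monotone_cdf ν (normalQuantile_pos (half_add_one_mem_Ioo ⟨h0, h1⟩)).le
  rw [idealError_of_mem_Ioo ⟨h0, h1⟩]
  constructor <;> linarith [cdf_le_one ν (normalQuantile ((q + 1) / 2))]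

lemma antitone_idealError [IsProbabilityMeasure ν] (hF : ∀ x, HasDerivAt (cdf ν) (f x) x)
    (hf : Function.Even f) : Antitone (idealError ν) := by
  intro q q' hqq'
  have hmem := idealError_mem_Icc hF hf
  rcases le_or_gt q 0 with h0 | h0
  · simpa [idealError, h0] using (hmem q').2
  rcases le_or_gt 1 q' with h1 | h1
  · simpa [idealError, (h0.trans_le hqq').not_ge, h1] using (hmem q).1
  have hq : q ∈ Set.Ioo (0 : ℝ) 1 := ⟨h0, hqq'.trans_lt h1⟩
  have hq' : q' ∈ Set.Ioo (0 : ℝ) 1 := ⟨h0.trans_le hqq', h1⟩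
  rw [idealError_of_mem_Ioo hq, idealError_of_mem_Ioo hq']
  have := monotone_cdf ν <| strictMonoOn_normalQuantile.monotoneOn
    (Set.Ioo_subset_Ioo_left one_half_pos.le (half_add_one_mem_Ioo hq))
    (Set.Ioo_subset_Ioo_left one_half_pos.le (half_add_one_mem_Ioo hq')) (by linarith)
  linarith

lemma hasDerivAt_idealError [IsProbabilityMeasure ν] (hF : ∀ x, HasDerivAt (cdf ν) (f x) x)
    {q : ℝ} (hq : q ∈ Set.Ioo (0 : ℝ) 1) :
    HasDerivAt (idealError ν) (-(f (normalQuantile ((q + 1) / 2)) /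
      gaussianPDFReal 0 1 (normalQuantile ((q + 1) / 2)))) q := by
  have hlevel : HasDerivAt (fun q : ℝ => (q + 1) / 2) (1 / 2) q :=
    ((hasDerivAt_id q).add_const 1).div_const 2
  have hw := (hasDerivAt_normalQuantile
    (Set.Ioo_subset_Ioo_left one_half_pos.le (half_add_one_mem_Ioo hq))).comp q hlevel
  refine ((((hF _).comp q hw).const_sub 1).const_mul 2).congr_of_eventuallyEq ?_ |>.congr_deriv ?_
  · filter_upwards [Ioo_mem_nhds hq.1 hq.2] with p hp using idealError_of_mem_Ioo hp
  · rw [Function.comp_apply]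
    ring

lemma targetThreshold_eq [IsProbabilityMeasure ν] (α : ℝ) :
    targetThreshold ν α = 2 * cdf stdNormal (quantile ν (1 - α / 2)) - 1 := by
  rw [targetThreshold, upperTail_eq_one_sub_cdf, upperTailInv_eq_quantile]
  ring

lemma one_sub_half_mem_Ioo {α : ℝ} (hα : α ∈ Set.Ioo (0 : ℝ) 1) :
    1 - α / 2 ∈ Set.Ioo (1 / 2 : ℝ) 1 :=
  ⟨by linarith [hα.2], by linarith [hα.1]⟩

lemma normalQuantile_targetThreshold [IsProbabilityMeasure ν] (α : ℝ) :
    normalQuantile ((targetThreshold ν α + 1) / 2) = quantile ν (1 - α / 2) := by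
  rw [targetThreshold_eq, sub_add_cancel, mul_div_cancel_left₀ _ two_ne_zero]
  exact normalQuantile_cdf _

lemma targetThreshold_mem_Ioo [IsProbabilityMeasure ν] (hF : ∀ x, HasDerivAt (cdf ν) (f x) x)
    (hf : Function.Even f) {α : ℝ} (hα : α ∈ Set.Ioo (0 : ℝ) 1) :
    targetThreshold ν α ∈ Set.Ioo (0 : ℝ) 1 := by
  have hhalf := strictMono_cdf_stdNormal (quantile_pos_of_even hF hf (one_sub_half_mem_Ioo hα))
  rw [cdf_zero_of_even hasDerivAt_cdf_stdNormal even_gaussianPDFReal] at hhalf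
  rw [targetThreshold_eq]
  constructor <;> linarith [(cdf_stdNormal_mem_Ioo (quantile ν (1 - α / 2))).2]

lemma idealError_targetThreshold [IsProbabilityMeasure ν]
    (hF : ∀ x, HasDerivAt (cdf ν) (f x) x) (hf : Function.Even f) {α : ℝ}
    (hα : α ∈ Set.Ioo (0 : ℝ) 1) : idealError ν (targetThreshold ν α) = α := by
  rw [idealError_of_mem_Ioo (targetThreshold_mem_Ioo hF hf hα), normalQuantile_targetThreshold,
    cdf_quantile (continuous_cdf hF)
      (Set.Ioo_subset_Ioo_left one_half_pos.le (one_sub_half_mem_Ioo hα))]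
  ring

theorem exists_slope_bounds_idealError [IsProbabilityMeasure ν]
    (hF : ∀ x, HasDerivAt (cdf ν) (f x) x) (hf : Function.Even f)
    (hord : {x | 0 < f x}.OrdConnected) {α : ℝ} (hα : α ∈ Set.Ioo (0 : ℝ) 1) {B : ℝ}
    (hB : 0 < B) :
    ∃ κ K, 0 < κ ∧ 0 < K ∧ ∀ q, |q - targetThreshold ν α| ≤ B →
      κ * (q - targetThreshold ν α) ^ 2 ≤ (q - targetThreshold ν α) * (α - idealError ν q) ∧
        |idealError ν q - α| ≤ K * |q - targetThreshold ν α| := by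
  have hderiv := hasDerivAt_idealError hF (targetThreshold_mem_Ioo hF hf hα)
  rw [normalQuantile_targetThreshold] at hderiv
  have hneg := neg_neg_of_pos <| div_pos (density_quantile_pos hF hf hord (one_sub_half_mem_Ioo hα))
    (gaussianPDFReal_pos 0 1 (quantile ν (1 - α / 2)) one_ne_zero)
  simpa only [idealError_targetThreshold hF hf hα] using
    exists_slope_bounds (antitone_idealError hF hf) hderiv hneg hB

end IdealError

/-! ### The effect of estimating the mean and the scale -/

section Perturbation

variable {ν : Measure ℝ} {f : ℝ → ℝ}

lemma abs_cdf_one_add_mul_sub_cdf_le (hF : ∀ x, HasDerivAt (cdf ν) (f x) x) {M : ℝ}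
    (hM : ∀ x, |x| * f x ≤ M) {w : ℝ} (hw : 0 < w) (ε : ℝ) :
    |cdf ν ((1 + ε) * w) - cdf ν w| ≤ (2 * M + 2) * |ε| := by
  have hM0 : 0 ≤ M := le_trans (by simp) (hM 0)
  rcases le_or_gt (1 / 2) |ε| with hε | hε
  · calc _ ≤ (1 : ℝ) := abs_cdf_sub_cdf_le_one _ _
      _ ≤ (2 * M + 2) * |ε| := by nlinarith
  have hdensity : ∀ x ∈ Set.Ici (w / 2), f x ≤ 2 * M / w := fun x (hx : w / 2 ≤ x) => by
    have h := (mul_le_mul_of_nonneg_right (hx.trans (le_abs_self x)) (density_nonneg hF x)).trans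
      (hM x)
    rw [le_div_iff₀ hw]
    linarith
  have hε' := abs_le.1 hε.le
  calc |cdf ν ((1 + ε) * w) - cdf ν w| ≤ 2 * M / w * |(1 + ε) * w - w| :=
        abs_cdf_sub_cdf_le hF (convex_Ici _) hdensity (Set.mem_Ici.2 (by linarith))
          (Set.mem_Ici.2 (by nlinarith))
    _ = 2 * M * |ε| := by
        rw [show (1 + ε) * w - w = ε * w by ring, abs_mul, abs_of_pos hw]
        field_simp
    _ ≤ (2 * M + 2) * |ε| := by gcongr; linarith

lemma abs_cdf_add_sub_cdf_le (hF : ∀ x, HasDerivAt (cdf ν) (f x) x) {M M' : ℝ}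
    (hM : ∀ x, f x ≤ M) (hM' : ∀ x, |x| * f x ≤ M') {w : ℝ} (hw : 0 < w) (ε δ : ℝ) :
    |cdf ν ((1 + ε) * w + δ) - cdf ν w| ≤ M * |δ| + (2 * M' + 2) * |ε| := by
  have hshift := abs_cdf_sub_cdf_le hF convex_univ (fun x _ => hM x)
    (Set.mem_univ ((1 + ε) * w)) (Set.mem_univ ((1 + ε) * w + δ))
  rw [add_sub_cancel_left] at hshift
  calc _ ≤ |cdf ν ((1 + ε) * w + δ) - cdf ν ((1 + ε) * w)| + |cdf ν ((1 + ε) * w) - cdf ν w| :=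
        abs_sub_le _ _ _
    _ ≤ _ := add_le_add hshift (abs_cdf_one_add_mul_sub_cdf_le hF hM' hw ε)

lemma covErr_mem_Icc (y : ℝ) (A : Set ℝ) : covErr y A ∈ Set.Icc (0 : ℝ) 1 := by
  unfold covErr; split_ifs <;> simp

lemma measurableSet_predInterval (m s q : ℝ) : MeasurableSet (predInterval m s q) := by
  unfold predInterval; split_ifs <;> measurability

lemma integral_covErr [IsProbabilityMeasure ν] {g : ℝ → ℝ} (hg : Measurable g) {A : Set ℝ}
    (hA : MeasurableSet A) : ∫ e, covErr (g e) A ∂ν = 1 - ν.real (g ⁻¹' A) := by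
  have hindicator : (fun e => covErr (g e) A) = (g ⁻¹' A)ᶜ.indicator 1 := by
    ext e; by_cases he : g e ∈ A <;> simp [covErr, he]
  rw [hindicator, integral_indicator_one (hg hA).compl, probReal_compl_eq_one_sub (hg hA)]

lemma integral_covErr_predInterval_of_nonneg [IsProbabilityMeasure ν] [NullSingletonClass ν]
    (hF : ∀ x, HasDerivAt (cdf ν) (f x) x) (hf : Function.Even f) {m₀ s₀ m s q : ℝ}
    (hs₀ : 0 < s₀) (hs : 0 ≤ s) (hq : q ∈ Set.Ioo (0 : ℝ) 1) :
    ∫ e, covErr (m₀ + s₀ * e) (predInterval m s q) ∂ν =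
      2 - cdf ν (s / s₀ * normalQuantile ((q + 1) / 2) + (m - m₀) / s₀)
        - cdf ν (s / s₀ * normalQuantile ((q + 1) / 2) - (m - m₀) / s₀) := by
  set w := normalQuantile ((q + 1) / 2) with hw
  have hw0 : 0 < w := normalQuantile_pos (half_add_one_mem_Ioo hq)
  have hpreimage : (fun e => m₀ + s₀ * e) ⁻¹' predInterval m s q =
      Set.Icc (-(s / s₀ * w - (m - m₀) / s₀)) (s / s₀ * w + (m - m₀) / s₀) := by
    ext e
    rw [predInterval, if_neg hq.1.not_ge, if_neg hq.2.not_ge, ← hw]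
    simp only [Set.mem_preimage, Set.mem_Icc]
    refine and_congr ?_ ?_ <;> field_simp <;> constructor <;> intro h <;> linarith
  have hle : -(s / s₀ * w - (m - m₀) / s₀) ≤ s / s₀ * w + (m - m₀) / s₀ := by
    have : 0 ≤ s / s₀ * w := by positivity
    linarith
  rw [integral_covErr (by fun_prop) (measurableSet_predInterval _ _ _), hpreimage,
    measureReal_congr Ioc_ae_eq_Icc.symm, ← cdf_sub_cdf hle, cdf_neg_of_even hF hf]
  ring

lemma integral_covErr_predInterval_of_neg [IsProbabilityMeasure ν] {m₀ s₀ m s q : ℝ} (hs : s < 0)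
    (hq : q ∈ Set.Ioo (0 : ℝ) 1) :
    ∫ e, covErr (m₀ + s₀ * e) (predInterval m s q) ∂ν = 1 := by
  have hw := normalQuantile_pos (half_add_one_mem_Ioo hq)
  have hempty : predInterval m s q = ∅ := by
    rw [predInterval, if_neg hq.1.not_ge, if_neg hq.2.not_ge, Set.Icc_eq_empty]
    nlinarith
  rw [hempty, integral_covErr (by fun_prop) .empty]
  simp

lemma integral_covErr_predInterval_of_notMem_Ioo [IsProbabilityMeasure ν] [NullSingletonClass ν]
    {s₀ : ℝ} (hs₀ : s₀ ≠ 0) {q : ℝ} (hq : q ∉ Set.Ioo (0 : ℝ) 1) (m₀ m s : ℝ) :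
    ∫ e, covErr (m₀ + s₀ * e) (predInterval m s q) ∂ν = idealError ν q := by
  rcases le_or_gt q 0 with h0 | h0
  · have hpreimage : (fun e => m₀ + s₀ * e) ⁻¹' {m} = {(m - m₀) / s₀} := by
      ext e
      simp only [Set.mem_preimage, Set.mem_singleton_iff, eq_div_iff hs₀]
      constructor <;> intro h <;> linarith
    rw [predInterval, if_pos h0, idealError, if_pos h0,
      integral_covErr (by fun_prop) (measurableSet_singleton m), hpreimage, measureReal_def,
      measure_singleton, ENNReal.toReal_zero, sub_zero]
  · have h1 : 1 ≤ q := not_lt.1 fun h1 => hq ⟨h0, h1⟩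
    rw [predInterval, if_neg h0.not_ge, if_pos h1, idealError, if_neg h0.not_ge, if_pos h1,
      integral_covErr (by fun_prop) .univ, Set.preimage_univ, probReal_univ, sub_self]

theorem abs_integral_covErr_sub_idealError_le [IsProbabilityMeasure ν] [NullSingletonClass ν]
    (hF : ∀ x, HasDerivAt (cdf ν) (f x) x) (hf : Function.Even f) {M M' : ℝ}
    (hM : ∀ x, f x ≤ M) (hM' : ∀ x, |x| * f x ≤ M') {s₀ : ℝ} (hs₀ : 0 < s₀) (m₀ m s q : ℝ) :
    |∫ e, covErr (m₀ + s₀ * e) (predInterval m s q) ∂ν - idealError ν q| ≤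
      (2 * M + 4 * M' + 4) * ((|m - m₀| + |s - s₀|) / s₀) := by
  have hM0 : 0 ≤ M := (density_nonneg hF 0).trans (hM 0)
  have hM0' : 0 ≤ M' := le_trans (by simp) (hM' 0)
  rcases em' (q ∈ Set.Ioo (0 : ℝ) 1) with hq | hq
  · rw [integral_covErr_predInterval_of_notMem_Ioo hs₀.ne' hq, sub_self, abs_zero]
    positivity
  rcases le_or_gt 0 s with hs | hs
  · set w := normalQuantile ((q + 1) / 2)
    have hε : s / s₀ = 1 + (s - s₀) / s₀ := by field_simp; ring
    have hperturb := abs_cdf_add_sub_cdf_le hF hM hM' (normalQuantile_pos (half_add_one_mem_Ioo hq))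
      ((s - s₀) / s₀)
    have hplus := hperturb ((m - m₀) / s₀)
    have hminus := hperturb (-((m - m₀) / s₀))
    rw [abs_neg, ← sub_eq_add_neg] at hminus
    rw [integral_covErr_predInterval_of_nonneg hF hf hs₀ hs hq, idealError_of_mem_Ioo hq, hε]
    rw [abs_div, abs_div, abs_of_pos hs₀, abs_le] at hplus hminus
    have hm := div_nonneg (abs_nonneg (m - m₀)) hs₀.le
    have hs' := div_nonneg (abs_nonneg (s - s₀)) hs₀.le
    rw [abs_le, add_div]
    constructor <;> nlinarith [hplus.1, hplus.2, hminus.1, hminus.2]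
  · rw [integral_covErr_predInterval_of_neg hs hq]
    have hone : 1 ≤ (|m - m₀| + |s - s₀|) / s₀ := by
      rw [one_le_div hs₀, abs_of_neg (by linarith : s - s₀ < 0)]
      linarith [abs_nonneg (m - m₀)]
    have hmem := idealError_mem_Icc hF hf q
    rw [abs_of_nonneg (by linarith [hmem.2])]
    nlinarith [hmem.1]

end Perturbation

/-! ### Conditioning on an independent variable -/

section Freezing

variable {Ω Ω' E : Type*} [mΩ' : MeasurableSpace Ω'] [mE : MeasurableSpace E]

section Comap

variable [mΩ : MeasurableSpace Ω] {P : Measure Ω} [IsProbabilityMeasure P] {A : Ω → Ω'} {Z : Ω → E}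

lemma lintegral_comp_prodMk_of_indepFun (hA : Measurable A) (hZ : Measurable Z)
    (h : IndepFun A Z P) {ψ : Ω' × E → ENNReal} (hψ : Measurable ψ) :
    ∫⁻ ω, ψ (A ω, Z ω) ∂P = ∫⁻ ω, ∫⁻ z, ψ (A ω, z) ∂(P.map Z) ∂P := by
  rw [← lintegral_map hψ (hA.prodMk hZ),
    (indepFun_iff_map_prod_eq_prod_map_map hA.aemeasurable hZ.aemeasurable).1 h,
    lintegral_prod _ hψ.aemeasurable, lintegral_map hψ.lintegral_prod_right' hA]

lemma ae_comp_prodMk_of_indepFun (hA : Measurable A) (hZ : Measurable Z) (h : IndepFun A Z P)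
    {p : Ω' × E → Prop} (hp : MeasurableSet {x | p x}) (hae : ∀ a, ∀ᵐ z ∂(P.map Z), p (a, z)) :
    ∀ᵐ ω ∂P, p (A ω, Z ω) := by
  refine ae_of_ae_map (hA.prodMk hZ).aemeasurable ?_
  rw [(indepFun_iff_map_prod_eq_prod_map_map hA.aemeasurable hZ.aemeasurable).1 h]
  exact (Measure.ae_prod_iff_ae_ae hp).2 (.of_forall hae)

lemma condLExp_comap_comp_prodMk_of_indepFun (hA : Measurable A) (hZ : Measurable Z)
    (h : IndepFun A Z P) {ψ : Ω' × E → ENNReal} (hψ : Measurable ψ) :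
    condLExp (mΩ'.comap A) P (fun ω => ψ (A ω, Z ω)) =ᵐ[P]
      fun ω => ∫⁻ z, ψ (A ω, z) ∂(P.map Z) := by
  refine (ae_eq_condLExp hA.comap_le P _
    (hψ.lintegral_prod_right'.comp (comap_measurable A)) ?_).symm
  rintro _ ⟨s, hs, rfl⟩
  have hfrozen := lintegral_comp_prodMk_of_indepFun hA hZ h
    (hψ.indicator (measurable_fst hs) : Measurable ((Prod.fst ⁻¹' s).indicator ψ))
  rw [← lintegral_indicator (hA hs), ← lintegral_indicator (hA hs)]
  convert hfrozen.symm using 3 with ω ω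
  · by_cases hω : A ω ∈ s <;> simp [hω]
  · rfl

end Comap

variable {m m₀ : MeasurableSpace Ω} {P : Measure Ω} {Z : Ω → E}

lemma indepFun_id_of_indep (h : Indep m (mE.comap Z) P) :
    @IndepFun Ω Ω E m₀ m mE id Z P := by
  rwa [@IndepFun_iff_Indep Ω Ω E m₀ m mE, @MeasurableSpace.comap_id Ω m]

lemma measurable_comp_of_measurable_uncurry {m' : MeasurableSpace Ω} (hm : m ≤ m')
    (hZ : Measurable[m'] Z) {β : Type*} [MeasurableSpace β] {ψ : Ω → E → β}
    (hψ : Measurable[m.prod mE] ψ.uncurry) : Measurable[m'] fun ω => ψ ω (Z ω) :=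
  @Measurable.comp Ω (Ω × E) β m' (m.prod mE) _ _ (fun ω => (ω, Z ω)) hψ
    (@Measurable.prodMk Ω m' Ω E m mE id Z (measurable_id'' hm) hZ)

variable [IsProbabilityMeasure P]

theorem condLExp_comp_of_indep (hm : m ≤ m₀) (hZ : Measurable Z) (h : Indep m (mE.comap Z) P)
    {ψ : Ω → E → ENNReal} (hψ : Measurable[m.prod mE] ψ.uncurry) :
    condLExp m P (fun ω => ψ ω (Z ω)) =ᵐ[P] fun ω => ∫⁻ z, ψ ω z ∂(P.map Z) := by
  have := @condLExp_comap_comp_prodMk_of_indepFun Ω Ω E m mE m₀ P _ id Z (measurable_id'' hm) hZ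
    (indepFun_id_of_indep h) ψ.uncurry hψ
  rwa [MeasurableSpace.comap_id] at this

theorem lintegral_comp_of_indep (hm : m ≤ m₀) (hZ : Measurable Z) (h : Indep m (mE.comap Z) P)
    {ψ : Ω → E → ENNReal} (hψ : Measurable[m.prod mE] ψ.uncurry) :
    ∫⁻ ω, ψ ω (Z ω) ∂P = ∫⁻ ω, ∫⁻ z, ψ ω z ∂(P.map Z) ∂P :=
  @lintegral_comp_prodMk_of_indepFun Ω Ω E m mE m₀ P _ id Z (measurable_id'' hm) hZ
    (indepFun_id_of_indep h) ψ.uncurry hψ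

theorem ae_comp_of_indep (hm : m ≤ m₀) (hZ : Measurable Z) (h : Indep m (mE.comap Z) P)
    {p : Ω → E → Prop} (hp : MeasurableSet[m.prod mE] {x | p x.1 x.2})
    (hae : ∀ ω, ∀ᵐ z ∂(P.map Z), p ω z) : ∀ᵐ ω ∂P, p ω (Z ω) :=
  @ae_comp_prodMk_of_indepFun Ω Ω E m mE m₀ P _ id Z (measurable_id'' hm) hZ
    (indepFun_id_of_indep h) (fun x => p x.1 x.2) hp hae

theorem condExp_comp_of_indep (hm : m ≤ m₀) (hZ : Measurable Z) (h : Indep m (mE.comap Z) P)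
    {ψ : Ω → E → ℝ} (hψ : Measurable[m.prod mE] ψ.uncurry) {C : ℝ}
    (hC : ∀ ω z, ψ ω z ∈ Set.Icc 0 C) :
    P[fun ω => ψ ω (Z ω) | m] =ᵐ[P] fun ω => ∫ z, ψ ω z ∂(P.map Z) := by
  have hfinite : ∫⁻ ω, ENNReal.ofReal (ψ ω (Z ω)) ∂P ≠ ⊤ := by
    refine ne_top_of_le_ne_top ?_ (lintegral_mono fun ω => ENNReal.ofReal_le_ofReal (hC ω _).2)
    simp
  have hreal := toReal_condLExp m (f := fun ω => ENNReal.ofReal (ψ ω (Z ω)))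
    (measurable_comp_of_measurable_uncurry hm hZ hψ).ennreal_ofReal.aemeasurable hfinite
  have hfreeze := condLExp_comp_of_indep hm hZ h (ψ := fun ω z => ENNReal.ofReal (ψ ω z))
    hψ.ennreal_ofReal
  simp only [ENNReal.toReal_ofReal (hC _ _).1] at hreal
  filter_upwards [hreal, hfreeze] with ω hrealω hfreezeω
  rw [← hrealω, hfreezeω, integral_eq_lintegral_of_nonneg_ae (.of_forall fun z => (hC ω z).1)]
  exact (hψ.comp measurable_prodMk_left).aestronglyMeasurable

end Freezing

/-! ### Sub-Gaussian bounds for bounded martingale increments -/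

section Subgaussian

variable {Ω : Type*} {m m₀ : MeasurableSpace Ω} {P : Measure Ω} [IsProbabilityMeasure P]

lemma integral_mul_eq_zero_of_condExp_eq_zero (hm : m ≤ m₀) {W Y : Ω → ℝ}
    (hW : StronglyMeasurable[m] W) (hY : Integrable Y P) (hWY : Integrable (W * Y) P)
    (hmart : P[Y | m] =ᵐ[P] 0) : ∫ ω, W ω * Y ω ∂P = 0 := by
  have hpull : P[W * Y | m] =ᵐ[P] 0 := by
    filter_upwards [condExp_mul_of_stronglyMeasurable_left hW hWY hY, hmart] with ω hω h0
    rw [hω, Pi.mul_apply, h0, Pi.zero_apply, mul_zero]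
  exact (integral_condExp hm (f := W * Y)).symm.trans (integral_eq_zero_of_ae hpull)

lemma exp_mul_add_le_cosh_mul_add_sinh_mul {y L : ℝ} (hL : 0 < L) (hy : |y| ≤ L) (θ x : ℝ) :
    Real.exp (θ * (x + y)) ≤
      Real.cosh (θ * L) * Real.exp (θ * x) + Real.sinh (θ * L) / L * (Real.exp (θ * x) * y) := by
  have hunit : |y / L| ≤ 1 := by rwa [abs_div, abs_of_pos hL, div_le_one hL]
  calc Real.exp (θ * (x + y)) = Real.exp (θ * x) * Real.exp (y / L * (θ * L)) := by
        rw [← Real.exp_add]; congr 1; field_simp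
    _ ≤ Real.exp (θ * x) * (Real.cosh (θ * L) + y / L * Real.sinh (θ * L)) := by
        gcongr; exact Real.exp_mul_le_cosh_add_mul_sinh hunit _
    _ = _ := by ring

theorem hasSubgaussianMGF_const_mul_add (hm : m ≤ m₀) {N Y : Ω → ℝ} {v v' : NNReal}
    (hN : Measurable[m] N) (hv : HasSubgaussianMGF N v P) (hY : Measurable Y) {L : ℝ} (hL : 0 < L)
    (hYL : ∀ ω, |Y ω| ≤ L) (hmart : P[Y | m] =ᵐ[P] 0) {a : ℝ} (hv' : a ^ 2 * v + L ^ 2 ≤ v') :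
    HasSubgaussianMGF (fun ω => a * N ω + Y ω) v' P := by
  have hN₀ : Measurable N := hN.mono hm le_rfl
  have hexp_integrable (θ : ℝ) : Integrable (fun ω => Real.exp (θ * a * N ω)) P :=
    hv.integrable_exp_mul (θ * a)
  have hprod_integrable (θ : ℝ) : Integrable (fun ω => Real.exp (θ * a * N ω) * Y ω) P :=
    (hexp_integrable θ).mul_bdd (c := L) hY.aestronglyMeasurable (.of_forall hYL)
  have hle (θ : ℝ) (ω : Ω) : Real.exp (θ * (a * N ω + Y ω)) ≤
      Real.cosh (θ * L) * Real.exp (θ * a * N ω) +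
        Real.sinh (θ * L) / L * (Real.exp (θ * a * N ω) * Y ω) := by
    simpa only [mul_assoc] using exp_mul_add_le_cosh_mul_add_sinh_mul hL (hYL ω) θ (a * N ω)
  have hbound_integrable (θ : ℝ) : Integrable (fun ω =>
      Real.cosh (θ * L) * Real.exp (θ * a * N ω) +
        Real.sinh (θ * L) / L * (Real.exp (θ * a * N ω) * Y ω)) P :=
    ((hexp_integrable θ).const_mul _).add ((hprod_integrable θ).const_mul _)
  have hintegrable (θ : ℝ) : Integrable (fun ω => Real.exp (θ * (a * N ω + Y ω))) P :=
    (hbound_integrable θ).mono' (by fun_prop) <| .of_forall fun ω => by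
      rw [Real.norm_eq_abs, Real.abs_exp]; exact hle θ ω
  refine ⟨hintegrable, fun θ => ?_⟩
  have hzero : ∫ ω, Real.exp (θ * a * N ω) * Y ω ∂P = 0 :=
    integral_mul_eq_zero_of_condExp_eq_zero hm
      (Real.measurable_exp.comp (hN.const_mul (θ * a))).stronglyMeasurable
      (.of_bound hY.aestronglyMeasurable L (.of_forall hYL)) (hprod_integrable θ) hmart
  calc mgf (fun ω => a * N ω + Y ω) P θ
      ≤ ∫ ω, (Real.cosh (θ * L) * Real.exp (θ * a * N ω) +
          Real.sinh (θ * L) / L * (Real.exp (θ * a * N ω) * Y ω)) ∂P :=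
        integral_mono (hintegrable θ) (hbound_integrable θ) (hle θ)
    _ = Real.cosh (θ * L) * mgf N P (θ * a) := by
        rw [integral_add ((hexp_integrable θ).const_mul _) ((hprod_integrable θ).const_mul _),
          integral_const_mul, integral_const_mul, hzero, mul_zero, add_zero, mgf]
    _ ≤ Real.exp ((θ * L) ^ 2 / 2) * Real.exp (v * (θ * a) ^ 2 / 2) := by
        gcongr
        · exact mgf_nonneg
        · exact Real.cosh_le_exp_half_sq _
        · exact hv.mgf_le _
    _ ≤ Real.exp (v' * θ ^ 2 / 2) := by
        rw [← Real.exp_add]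
        gcongr
        nlinarith [mul_le_mul_of_nonneg_right hv' (sq_nonneg θ)]

lemma measureReal_lt_abs_le_of_hasSubgaussianMGF {N : Ω → ℝ} {v : NNReal}
    (h : HasSubgaussianMGF N v P) {ε : ℝ} (hε : 0 ≤ ε) :
    P.real {ω | ε < |N ω|} ≤ 2 * Real.exp (-ε ^ 2 / (2 * v)) := by
  have hsub : {ω | ε < |N ω|} ⊆ {ω | ε ≤ N ω} ∪ {ω | ε ≤ (-N) ω} := fun ω hω =>
    (lt_abs.1 (show ε < |N ω| from hω)).imp (fun h => h.le) fun h => h.le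
  calc P.real {ω | ε < |N ω|} ≤ P.real {ω | ε ≤ N ω} + P.real {ω | ε ≤ (-N) ω} :=
        (measureReal_mono hsub).trans (measureReal_union_le _ _)
    _ ≤ _ := by linarith [h.measure_ge_le hε, h.neg.measure_ge_le hε]

end Subgaussian

/-! ### Contracting linear recursions -/

section LinearRecursion

/-- The solution, started from `0`, of the linear recursion `N (j + 1) = (1 - a j) * N j + y j`:
it accumulates the noise `y` of a contracting recursion. -/
noncomputable def linearRecursion (a y : ℕ → ℝ) : ℕ → ℝ
  | 0 => 0
  | j + 1 => (1 - a j) * linearRecursion a y j + y j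

lemma abs_mul_sub_mul_le_mul_max {s t : ℝ} (hs : 0 ≤ s) (hst : s ≤ t) (x y : ℝ) :
    |s * x - t * y| ≤ t * max |x - y| |y| :=
  calc |s * x - t * y| = |s * (x - y) - (t - s) * y| := by ring_nf
    _ ≤ |s * (x - y)| + |(t - s) * y| := abs_sub _ _
    _ = s * |x - y| + (t - s) * |y| := by
      rw [abs_mul, abs_mul, abs_of_nonneg hs, abs_of_nonneg (sub_nonneg.2 hst)]
    _ ≤ s * max |x - y| |y| + (t - s) * max |x - y| |y| :=
      add_le_add (mul_le_mul_of_nonneg_left (le_max_left _ _) hs)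
        (mul_le_mul_of_nonneg_left (le_max_right _ _) (sub_nonneg.2 hst))
    _ = t * max |x - y| |y| := by ring

theorem abs_sub_linearRecursion_le {D a s y e : ℕ → ℝ} {n : ℕ} {B ε δ : ℝ} (hδ : 0 ≤ δ)
    (hD₀ : |D 0| ≤ B) (ha : ∀ j < n, 0 ≤ a j) (has : ∀ j < n, a j ≤ s j) (hs : ∀ j < n, s j ≤ 1)
    (hN : ∀ j ≤ n, |linearRecursion a y j| ≤ ε) (he : ∀ j < n, |e j| ≤ a j * δ)
    (hD : ∀ j < n, D (j + 1) = (1 - s j) * D j + y j + e j) :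
    ∀ j ≤ n, |D j - linearRecursion a y j| ≤ (∏ i ∈ Finset.range j, (1 - a i)) * B + ε + δ := by
  have hε : 0 ≤ ε := (abs_nonneg _).trans (hN 0 n.zero_le)
  intro j
  induction j with
  | zero => intro; simp only [linearRecursion, sub_zero, Finset.prod_range_zero]; linarith
  | succ j ih =>
    intro hj
    have hjn : j < n := hj
    have hprod : 0 ≤ ∏ i ∈ Finset.range j, (1 - a i) := Finset.prod_nonneg fun i hi =>
      have hin := (Finset.mem_range.1 hi).trans hjn
      sub_nonneg.2 ((has i hin).trans (hs i hin))
    have h1a : 0 ≤ 1 - a j := sub_nonneg.2 ((has j hjn).trans (hs j hjn))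
    have hpB := mul_nonneg hprod ((abs_nonneg _).trans hD₀)
    have hmax : max |D j - linearRecursion a y j| |linearRecursion a y j| ≤
        (∏ i ∈ Finset.range j, (1 - a i)) * B + ε + δ :=
      max_le (ih hjn.le) ((hN j hjn.le).trans (by linarith))
    calc |D (j + 1) - linearRecursion a y (j + 1)|
        = |((1 - s j) * D j - (1 - a j) * linearRecursion a y j) + e j| := by
          rw [hD j hjn, linearRecursion]; ring_nf
      _ ≤ (1 - a j) * max |D j - linearRecursion a y j| |linearRecursion a y j| + a j * δ :=
          (abs_add_le _ _).trans (add_le_add (abs_mul_sub_mul_le_mul_max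
            (sub_nonneg.2 (hs j hjn)) (sub_le_sub_left (has j hjn) 1) _ _) (he j hjn))
      _ ≤ (1 - a j) * ((∏ i ∈ Finset.range j, (1 - a i)) * B + ε + δ) + a j * δ := by gcongr
      _ ≤ (∏ i ∈ Finset.range (j + 1), (1 - a i)) * B + ε + δ := by
          rw [Finset.prod_range_succ]
          linarith [mul_nonneg (ha j hjn) hε]

theorem exists_eventually_le_mul_of_recursion {e v w : ℕ → ℝ} {C : ℝ}
    (hv : ∀ᶠ k in atTop, 0 < v k) (hw₀ : ∀ᶠ k in atTop, 0 ≤ w k)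
    (hw₁ : ∀ᶠ k in atTop, 2 * w k ≤ 1)
    (hvw : ∀ᶠ k in atTop, (1 - w k) * v k ≤ v (k + 1))
    (he : ∀ᶠ k in atTop, e (k + 1) ≤ (1 - 2 * w k) * e k + C * (w k * v k)) :
    ∃ C' > 0, ∀ᶠ k in atTop, e k ≤ C' * v k := by
  obtain ⟨k₀, hk₀⟩ := eventually_atTop.1 (hv.and (hw₀.and (hw₁.and (hvw.and he))))
  set C' := max (max C 1) (e k₀ / v k₀)
  have hCC' : C ≤ C' := (le_max_left _ _).trans (le_max_left _ _)
  have hC' : 0 < C' := one_pos.trans_le ((le_max_right _ _).trans (le_max_left _ _))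
  refine ⟨C', hC', eventually_atTop.2 ⟨k₀, fun k hk => ?_⟩⟩
  induction k, hk using Nat.le_induction with
  | base => exact (div_le_iff₀ (hk₀ k₀ le_rfl).1).1 (le_max_right _ _)
  | succ k hk ih =>
    obtain ⟨hvk, hwk₀, hwk₁, hvwk, hek⟩ := hk₀ k hk
    calc e (k + 1) ≤ (1 - 2 * w k) * e k + C * (w k * v k) := hek
      _ ≤ (1 - 2 * w k) * (C' * v k) + C' * (w k * v k) := by
          gcongr
      _ = C' * ((1 - w k) * v k) := by ring
      _ ≤ C' * v (k + 1) := by gcongr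

variable {Ω : Type*} {m₀ : MeasurableSpace Ω} {P : Measure Ω}
  {𝓖 : ℕ → MeasurableSpace Ω} {Y : ℕ → Ω → ℝ} {a : ℕ → ℝ}

lemma measurable_linearRecursion (hmono : Monotone 𝓖) (hY : ∀ j, Measurable[𝓖 (j + 1)] (Y j))
    (j : ℕ) : Measurable[𝓖 j] fun ω => linearRecursion a (fun i => Y i ω) j := by
  induction j with
  | zero => exact measurable_const
  | succ j ih => exact ((ih.mono (hmono j.le_succ) le_rfl).const_mul _).add (hY j)

theorem hasSubgaussianMGF_linearRecursion [IsProbabilityMeasure P] (hmono : Monotone 𝓖)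
    (hle : ∀ j, 𝓖 j ≤ m₀) (hY : ∀ j, Measurable[𝓖 (j + 1)] (Y j)) {L : ℕ → ℝ} (hL : ∀ j, 0 < L j)
    (hYL : ∀ j ω, |Y j ω| ≤ L j) (hmart : ∀ j, P[Y j | 𝓖 j] =ᵐ[P] 0)
    (ha : ∀ j, a j ∈ Set.Icc 0 1) {v : NNReal} (hv : ∀ j, L j ^ 2 ≤ a j * v) (j : ℕ) :
    HasSubgaussianMGF (fun ω => linearRecursion a (fun i => Y i ω) j) v P := by
  induction j with
  | zero =>
    refine ⟨fun t => by simp [linearRecursion], fun t => ?_⟩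
    simp only [linearRecursion, mgf, mul_zero, Real.exp_zero, integral_const, probReal_univ,
      smul_eq_mul, mul_one]
    exact Real.one_le_exp (by positivity)
  | succ j ih =>
    refine hasSubgaussianMGF_const_mul_add (hle j) (measurable_linearRecursion hmono hY j) ih
      ((hY j).mono (hle _) le_rfl) (hL j) (hYL j) (hmart j) ?_
    have hsq : (1 - a j) ^ 2 * v ≤ (1 - a j) * v := by
      gcongr
      exact pow_le_of_le_one (sub_nonneg.2 (ha j).2) (sub_le_self _ (ha j).1) two_ne_zero
    linarith [hv j]

end LinearRecursion

/-! ### Half windows -/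

section HalfWindow

lemma tendsto_natCast_add_one : Tendsto (fun k : ℕ => (k : ℝ) + 1) atTop atTop :=
  tendsto_atTop_add_const_right _ _ tendsto_natCast_atTop_atTop

lemma eventually_mul_rpow_neg_le_one {β : ℝ} (hβ : 0 < β) (C : ℝ) :
    ∀ᶠ k : ℕ in atTop, C * ((k : ℝ) + 1) ^ (-β) ≤ 1 := by
  have h := ((tendsto_rpow_neg_atTop hβ).comp tendsto_natCast_add_one).const_mul C
  rw [mul_zero] at h
  exact h.eventually_le_const zero_lt_one

lemma eventually_one_le_log_add_one : ∀ᶠ k : ℕ in atTop, 1 ≤ Real.log ((k : ℝ) + 1) :=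
  (Real.tendsto_log_atTop.comp tendsto_natCast_add_one).eventually_ge_atTop 1

lemma eventually_exp_neg_rpow_le {p : ℝ} (hp : 0 < p) {a : ℝ} (ha : 0 < a) (s : ℝ) :
    ∀ᶠ k : ℕ in atTop, Real.exp (-a * ((k : ℝ) + 1) ^ p) ≤ ((k : ℝ) + 1) ^ (-s) := by
  have h := (isLittleO_exp_neg_mul_rpow_atTop ha (-s / p)).comp_tendsto
    ((tendsto_rpow_atTop hp).comp tendsto_natCast_add_one)
  filter_upwards [h.bound zero_lt_one] with k hk
  simp only [Function.comp_apply, Real.norm_eq_abs, Real.abs_exp, one_mul] at hk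
  rwa [← Real.rpow_mul (by positivity), mul_div_cancel₀ _ hp.ne',
    abs_of_nonneg (by positivity)] at hk

lemma rpow_add_one_le_of_le {β : ℝ} (hβ : 0 ≤ β) {j k : ℕ} (hjk : j ≤ k) :
    ((k : ℝ) + 1) ^ (-β) ≤ ((j : ℝ) + 1) ^ (-β) :=
  Real.rpow_le_rpow_of_nonpos (by positivity) (by gcongr) (neg_nonpos.2 hβ)

lemma natCast_add_one_le_two_mul {k j : ℕ} (hj : k / 2 ≤ j) : (k : ℝ) + 1 ≤ 2 * ((j : ℝ) + 1) := by
  have : k + 1 ≤ 2 * (j + 1) := by omega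
  exact_mod_cast this

lemma rpow_half_add_one_le {β : ℝ} (hβ : β ∈ Set.Icc 0 1) (k : ℕ) :
    (((k / 2 : ℕ) : ℝ) + 1) ^ (-β) ≤ 2 * ((k : ℝ) + 1) ^ (-β) :=
  calc (((k / 2 : ℕ) : ℝ) + 1) ^ (-β) ≤ (((k : ℝ) + 1) / 2) ^ (-β) :=
        Real.rpow_le_rpow_of_nonpos (by positivity)
          (by linarith [natCast_add_one_le_two_mul (le_refl (k / 2))]) (neg_nonpos.2 hβ.1)
    _ = 2 ^ β * ((k : ℝ) + 1) ^ (-β) := by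
        rw [Real.div_rpow (by positivity) zero_le_two, Real.rpow_neg zero_le_two, div_inv_eq_mul,
          mul_comm]
    _ ≤ 2 * ((k : ℝ) + 1) ^ (-β) := by
        gcongr
        exact (Real.rpow_le_rpow_of_exponent_le one_le_two hβ.2).trans_eq (Real.rpow_one _)

lemma div_pow_three_le_of_half_le {C : ℝ} (hC : 0 ≤ C) {k j : ℕ} (hj : k / 2 ≤ j) :
    C / ((j : ℝ) + 1) ^ 3 ≤ 8 * C / ((k : ℝ) + 1) ^ 3 := by
  rw [div_le_div_iff₀ (by positivity) (by positivity)]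
  calc C * ((k : ℝ) + 1) ^ 3 ≤ C * (2 * ((j : ℝ) + 1)) ^ 3 := by
        gcongr; exact natCast_add_one_le_two_mul hj
    _ = 8 * C * ((j : ℝ) + 1) ^ 3 := by ring

lemma eventually_forall_half_le {p : ℕ → Prop} (h : ∀ᶠ k in atTop, p k) :
    ∀ᶠ k in atTop, ∀ j, k / 2 ≤ j → p j := by
  obtain ⟨K, hK⟩ := eventually_atTop.1 h
  filter_upwards [eventually_ge_atTop (2 * K)] with k hk j hj
  exact hK j (by omega)

lemma prod_one_sub_le_exp {a β : ℝ} (ha : 0 ≤ a) (hβ : 0 ≤ β) {k : ℕ} (hk : 1 ≤ k)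
    (ha₁ : a * (((k / 2 : ℕ) : ℝ) + 1) ^ (-β) ≤ 1) :
    ∏ i ∈ Finset.range (k - k / 2), (1 - a * (((k / 2 + i : ℕ) : ℝ) + 1) ^ (-β)) ≤
      Real.exp (-(a / 4) * ((k : ℝ) + 1) ^ (1 - β)) := by
  have hcard : ((k : ℝ) + 1) / 4 ≤ ((k - k / 2 : ℕ) : ℝ) := by
    have : k + 1 ≤ 4 * (k - k / 2) := by omega
    have : (k : ℝ) + 1 ≤ 4 * ((k - k / 2 : ℕ) : ℝ) := by exact_mod_cast this
    linarith
  calc ∏ i ∈ Finset.range (k - k / 2), (1 - a * (((k / 2 + i : ℕ) : ℝ) + 1) ^ (-β))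
      ≤ ∏ _i ∈ Finset.range (k - k / 2), Real.exp (-(a * ((k : ℝ) + 1) ^ (-β))) := by
        refine Finset.prod_le_prod (fun i _ => sub_nonneg.2 (le_trans ?_ ha₁)) (fun i hi => ?_)
        · exact mul_le_mul_of_nonneg_left (rpow_add_one_le_of_le hβ (by omega)) ha
        · refine (Real.one_sub_le_exp_neg _).trans (Real.exp_le_exp.2 (neg_le_neg ?_))
          rw [Finset.mem_range] at hi
          exact mul_le_mul_of_nonneg_left (rpow_add_one_le_of_le hβ (by omega)) ha
    _ = Real.exp (-(((k - k / 2 : ℕ) : ℝ) * (a * ((k : ℝ) + 1) ^ (-β)))) := by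
        rw [Finset.prod_const, Finset.card_range, ← Real.exp_nat_mul, mul_neg]
    _ ≤ Real.exp (-(((k : ℝ) + 1) / 4 * (a * ((k : ℝ) + 1) ^ (-β)))) := by gcongr
    _ = Real.exp (-(a / 4) * ((k : ℝ) + 1) ^ (1 - β)) := by
        rw [sub_eq_add_neg 1, Real.rpow_add (by positivity), Real.rpow_one]; ring_nf

end HalfWindow

/-! ### Perturbed Robbins–Monro recursions -/

/-- The recursion `D (k + 1) = D k + Γ k * Z k`, in which the conditional mean `d k` of `Z k` is a
perturbation of `-g (D k)`; the mean field `g` has its slopes at the origin between `κ` and `K` on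
the range `[-B, B]` of `D`, and the random step `Γ k` is at least of order `(k + 1) ^ (-β)`. -/
structure IsRobbinsMonro {Ω : Type*} {m₀ : MeasurableSpace Ω} (P : Measure Ω)
    (𝓕 : Filtration ℕ m₀) (D Γ Z d : ℕ → Ω → ℝ) (g : ℝ → ℝ) (β B κ K lo c : ℝ) : Prop where
  measurable_state : ∀ k, Measurable[𝓕 k] (D k)
  measurable_step : ∀ k, Measurable[𝓕 k] (Γ k)
  measurable_drift : ∀ k, Measurable[𝓕 k] (d k)
  measurable_increment : ∀ k, Measurable[𝓕 (k + 1)] (Z k)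
  measurable_field : Measurable g
  recursion : ∀ k ω, D (k + 1) ω = D k ω + Γ k ω * Z k ω
  condExp_increment : ∀ k, P[Z k | 𝓕 k] =ᵐ[P] d k
  abs_state_le : ∀ k ω, |D k ω| ≤ B
  abs_increment_le : ∀ k ω, |Z k ω| ≤ 1
  abs_drift_le : ∀ k ω, |d k ω| ≤ 1
  le_step : ∀ (k : ℕ) ω, lo * ((k : ℝ) + 1) ^ (-β) ≤ Γ k ω
  step_le : ∀ k ω, Γ k ω ≤ c
  exists_slope : ∀ x, |x| ≤ B → ∃ s ∈ Set.Icc κ K, g x = s * x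
  slope_pos : 0 < κ
  lo_pos : 0 < lo
  exponent_mem : β ∈ Set.Ioo (0 : ℝ) 1

/-- The martingale part `Γ k * (Z k - d k)` of the increments of a Robbins–Monro recursion, with
the step truncated at `hi * (k + 1) ^ (-β)`. -/
noncomputable def truncatedNoise {Ω : Type*} (Γ Z d : ℕ → Ω → ℝ) (β hi : ℝ) (k : ℕ) (ω : Ω) : ℝ :=
  min (Γ k ω) (hi * ((k : ℝ) + 1) ^ (-β)) * (Z k ω - d k ω)

/-- The truncated noise accumulated over `j` steps from time `m` on by the linear recursion with
contraction rates `a * (k + 1) ^ (-β)`. -/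
noncomputable def windowNoise {Ω : Type*} (Γ Z d : ℕ → Ω → ℝ) (β hi a : ℝ) (m j : ℕ) (ω : Ω) : ℝ :=
  linearRecursion (fun i => a * (((m + i : ℕ) : ℝ) + 1) ^ (-β))
    (fun i => truncatedNoise Γ Z d β hi (m + i) ω) j

lemma one_sub_card_mul_le_measureReal {Ω ι : Type*} [MeasurableSpace Ω] {P : Measure Ω}
    [IsProbabilityMeasure P] (s : Finset ι) {bad : ι → Set Ω} {good : Set Ω} {δ : ℝ}
    (hbad : ∀ i ∈ s, P.real (bad i) ≤ δ) (hgood : ∀ ω, (∀ i ∈ s, ω ∉ bad i) → ω ∈ good) :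
    1 - s.card * δ ≤ P.real good := by
  have hcover : Set.univ ⊆ good ∪ ⋃ i ∈ s, bad i := fun ω _ => by
    by_cases h : ∀ i ∈ s, ω ∉ bad i
    · exact Or.inl (hgood ω h)
    · push Not at h
      exact Or.inr (Set.mem_iUnion₂.2 (by simpa using h))
  have hsum : P.real (⋃ i ∈ s, bad i) ≤ s.card * δ :=
    (measureReal_biUnion_finset_le _ _).trans
      ((Finset.sum_le_card_nsmul s _ δ hbad).trans_eq (nsmul_eq_mul _ _))
  have := (measureReal_mono (μ := P) hcover).trans (measureReal_union_le _ _)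
  rw [probReal_univ] at this
  linarith

lemma rpow_neg_one_le_sqrt_log_mul_rpow_neg {β x : ℝ} (hβ : β ≤ 2) (hx : 1 ≤ x)
    (hlog : 1 ≤ Real.log x) : x ^ (-(1 : ℝ)) ≤ √(Real.log x * x ^ (-β)) := by
  refine Real.le_sqrt_of_sq_le ?_
  rw [← Real.rpow_mul_natCast (by positivity)]
  refine (Real.rpow_le_rpow_of_exponent_le hx ?_).trans
    (le_mul_of_one_le_left (by positivity) hlog)
  push_cast
  linarith

namespace IsRobbinsMonro

variable {Ω : Type*} {m₀ : MeasurableSpace Ω} {P : Measure Ω} {𝓕 : Filtration ℕ m₀}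
  {D Γ Z d err : ℕ → Ω → ℝ} {g : ℝ → ℝ} {β B κ K lo c hi r : ℝ}

lemma step_nonneg (h : IsRobbinsMonro P 𝓕 D Γ Z d g β B κ K lo c) (k : ℕ) (ω : Ω) :
    0 ≤ Γ k ω :=
  (mul_nonneg h.lo_pos.le (by positivity)).trans (h.le_step k ω)

lemma gain_pos (h : IsRobbinsMonro P 𝓕 D Γ Z d g β B κ K lo c) : 0 < κ * lo :=
  mul_pos h.slope_pos h.lo_pos

lemma measurable_bias (h : IsRobbinsMonro P 𝓕 D Γ Z d g β B κ K lo c) (k : ℕ) :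
    Measurable fun ω => d k ω + g (D k ω) :=
  ((h.measurable_drift k).mono (𝓕.le k) le_rfl).add
    (h.measurable_field.comp ((h.measurable_state k).mono (𝓕.le k) le_rfl))

lemma abs_bias_le (h : IsRobbinsMonro P 𝓕 D Γ Z d g β B κ K lo c) (k : ℕ) (ω : Ω) :
    |d k ω + g (D k ω)| ≤ 1 + K * B := by
  obtain ⟨s, hs, hgs⟩ := h.exists_slope _ (h.abs_state_le k ω)
  have hs₀ : 0 ≤ s := h.slope_pos.le.trans hs.1
  rw [hgs]
  refine (abs_add_le _ _).trans (add_le_add (h.abs_drift_le k ω) ?_)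
  rw [abs_mul, abs_of_nonneg hs₀]
  exact mul_le_mul hs.2 (h.abs_state_le k ω) (abs_nonneg _) (hs₀.trans hs.2)

lemma measurable_truncatedNoise (h : IsRobbinsMonro P 𝓕 D Γ Z d g β B κ K lo c) (k : ℕ) :
    Measurable[𝓕 (k + 1)] (truncatedNoise Γ Z d β hi k) :=
  (((h.measurable_step k).mono (𝓕.mono k.le_succ) le_rfl).min measurable_const).mul
    ((h.measurable_increment k).sub ((h.measurable_drift k).mono (𝓕.mono k.le_succ) le_rfl))

lemma abs_increment_sub_drift_le (h : IsRobbinsMonro P 𝓕 D Γ Z d g β B κ K lo c) (k : ℕ) (ω : Ω) :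
    |Z k ω - d k ω| ≤ 2 :=
  (abs_sub _ _).trans (by linarith [h.abs_increment_le k ω, h.abs_drift_le k ω])

lemma abs_truncatedNoise_le (h : IsRobbinsMonro P 𝓕 D Γ Z d g β B κ K lo c) (hhi : 0 < hi)
    (k : ℕ) (ω : Ω) : |truncatedNoise Γ Z d β hi k ω| ≤ 2 * hi * ((k : ℝ) + 1) ^ (-β) := by
  have hu : 0 ≤ hi * ((k : ℝ) + 1) ^ (-β) := by positivity
  rw [truncatedNoise, abs_mul, abs_of_nonneg (le_min (h.step_nonneg k ω) hu), mul_assoc 2, mul_comm]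
  exact mul_le_mul (h.abs_increment_sub_drift_le k ω) (min_le_right _ _)
    (le_min (h.step_nonneg k ω) hu) zero_le_two

theorem abs_state_le_of_window (h : IsRobbinsMonro P 𝓕 D Γ Z d g β B κ K lo c) {m n : ℕ}
    (hhi : 0 < hi) {ε δ : ℝ} (hδ : 0 ≤ δ) (hK : hi * K * ((m : ℝ) + 1) ^ (-β) ≤ 1) {ω : Ω}
    (hΓ : ∀ j < n, Γ (m + j) ω ≤ hi * (((m + j : ℕ) : ℝ) + 1) ^ (-β))
    (hb : ∀ j < n, |d (m + j) ω + g (D (m + j) ω)| ≤ δ)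
    (hN : ∀ j ≤ n, |windowNoise Γ Z d β hi (κ * lo) m j ω| ≤ ε) :
    |D (m + n) ω| ≤ (∏ i ∈ Finset.range n, (1 - κ * lo * (((m + i : ℕ) : ℝ) + 1) ^ (-β))) * B
      + 2 * ε + hi / (κ * lo) * δ := by
  have hκ := h.slope_pos
  have hlo := h.lo_pos
  choose s hs hgs using fun j => h.exists_slope _ (h.abs_state_le (m + j) ω)
  have hs₀ (j : ℕ) : 0 ≤ s j := hκ.le.trans (hs j).1
  have hpath := abs_sub_linearRecursion_le (D := fun j => D (m + j) ω)
    (a := fun j => κ * lo * (((m + j : ℕ) : ℝ) + 1) ^ (-β)) (s := fun j => Γ (m + j) ω * s j)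
    (e := fun j => Γ (m + j) ω * (d (m + j) ω + g (D (m + j) ω))) (n := n) (ε := ε)
    (y := fun j => truncatedNoise Γ Z d β hi (m + j) ω) (δ := hi / (κ * lo) * δ) (by positivity)
    (h.abs_state_le _ ω) (fun j _ => by positivity) ?_ ?_ hN ?_ ?_ n le_rfl
  · have hle : |D (m + n) ω| - |windowNoise Γ Z d β hi (κ * lo) m n ω| ≤ _ :=
      (abs_sub_abs_le_abs_sub _ _).trans hpath
    linarith [hN n le_rfl]
  · intro j _
    calc κ * lo * (((m + j : ℕ) : ℝ) + 1) ^ (-β)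
        = lo * (((m + j : ℕ) : ℝ) + 1) ^ (-β) * κ := by ring
      _ ≤ Γ (m + j) ω * s j := mul_le_mul (h.le_step _ ω) (hs j).1 hκ.le (h.step_nonneg _ ω)
  · intro j hj
    calc Γ (m + j) ω * s j ≤ hi * (((m + j : ℕ) : ℝ) + 1) ^ (-β) * K :=
          mul_le_mul (hΓ j hj) (hs j).2 (hs₀ j) (by positivity)
      _ ≤ hi * ((m : ℝ) + 1) ^ (-β) * K := by
          have := (hs₀ j).trans (hs j).2
          have := rpow_add_one_le_of_le h.exponent_mem.1.le (m.le_add_right j)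
          gcongr
      _ ≤ 1 := by linarith
  · intro j hj
    rw [abs_mul, abs_of_nonneg (h.step_nonneg _ ω)]
    calc Γ (m + j) ω * |d (m + j) ω + g (D (m + j) ω)|
        ≤ hi * (((m + j : ℕ) : ℝ) + 1) ^ (-β) * δ :=
          mul_le_mul (hΓ j hj) (hb j hj) (abs_nonneg _) (by positivity)
      _ = κ * lo * (((m + j : ℕ) : ℝ) + 1) ^ (-β) * (hi / (κ * lo) * δ) := by field_simp
  · intro j hj
    change D (m + j + 1) ω = _
    rw [h.recursion, truncatedNoise, min_eq_left (hΓ j hj), hgs]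
    ring

lemma sq_state_succ_le (h : IsRobbinsMonro P 𝓕 D Γ Z d g β B κ K lo c) (k : ℕ) (ω : Ω) :
    D (k + 1) ω ^ 2 ≤ (1 - κ * lo * ((k : ℝ) + 1) ^ (-β)) * D k ω ^ 2 +
      (Γ k ω * (d k ω + g (D k ω)) ^ 2 / κ + Γ k ω ^ 2) +
      2 * Γ k ω * D k ω * (Z k ω - d k ω) := by
  obtain ⟨s, hs, hgs⟩ := h.exists_slope _ (h.abs_state_le k ω)
  have hκ := h.slope_pos
  have hΓ := h.step_nonneg k ω
  set b := d k ω + g (D k ω) with hb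
  have hd : d k ω = b - s * D k ω := by rw [hb, hgs]; ring
  have hyoung : 2 * (D k ω * b) ≤ κ * D k ω ^ 2 + b ^ 2 / κ := by
    have hsq : κ * D k ω ^ 2 + b ^ 2 / κ - 2 * (D k ω * b) = (κ * D k ω - b) ^ 2 / κ := by
      field_simp; ring
    linarith [div_nonneg (sq_nonneg (κ * D k ω - b)) hκ.le]
  have hZ : Γ k ω ^ 2 * Z k ω ^ 2 ≤ Γ k ω ^ 2 :=
    mul_le_of_le_one_right (sq_nonneg _) ((sq_le_one_iff_abs_le_one _).2 (h.abs_increment_le k ω))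
  have hcontract : Γ k ω * (2 * (D k ω * b) - 2 * s * D k ω ^ 2) ≤
      Γ k ω * b ^ 2 / κ - κ * lo * ((k : ℝ) + 1) ^ (-β) * D k ω ^ 2 :=
    calc Γ k ω * (2 * (D k ω * b) - 2 * s * D k ω ^ 2)
        ≤ Γ k ω * (κ * D k ω ^ 2 + b ^ 2 / κ - 2 * κ * D k ω ^ 2) := by
          have := hs.1
          gcongr
      _ = Γ k ω * b ^ 2 / κ - Γ k ω * (κ * D k ω ^ 2) := by ring
      _ ≤ Γ k ω * b ^ 2 / κ - lo * ((k : ℝ) + 1) ^ (-β) * (κ * D k ω ^ 2) := by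
          gcongr
          exact h.le_step k ω
      _ = _ := by ring
  calc D (k + 1) ω ^ 2 = D k ω ^ 2 + Γ k ω * (2 * (D k ω * b) - 2 * s * D k ω ^ 2) +
        Γ k ω ^ 2 * Z k ω ^ 2 + 2 * Γ k ω * D k ω * (Z k ω - d k ω) := by
        rw [h.recursion, hd]; ring
    _ ≤ _ := by linarith

lemma step_mul_sq_add_sq_le (h : IsRobbinsMonro P 𝓕 D Γ Z d g β B κ K lo c) (hhi : 0 ≤ hi)
    (k : ℕ) (ω : Ω) :
    Γ k ω * (d k ω + g (D k ω)) ^ 2 / κ + Γ k ω ^ 2 ≤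
      hi * ((k : ℝ) + 1) ^ (-β) / κ * (d k ω + g (D k ω)) ^ 2 + (hi * ((k : ℝ) + 1) ^ (-β)) ^ 2 +
        (c * (1 + K * B) ^ 2 / κ + c ^ 2) *
          {ω | hi * ((k : ℝ) + 1) ^ (-β) < Γ k ω}.indicator 1 ω := by
  have hκ := h.slope_pos
  have hΓ := h.step_nonneg k ω
  by_cases hω : hi * ((k : ℝ) + 1) ^ (-β) < Γ k ω
  · rw [Set.indicator_of_mem (by exact hω), Pi.one_apply, mul_one]
    have hc := h.step_le k ω
    have hc₀ : 0 ≤ c := hΓ.trans hc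
    have hb : (d k ω + g (D k ω)) ^ 2 ≤ (1 + K * B) ^ 2 := by
      rw [← sq_abs]
      exact pow_le_pow_left₀ (abs_nonneg _) (h.abs_bias_le k ω) 2
    exact (by gcongr : _ ≤ c * (1 + K * B) ^ 2 / κ + c ^ 2).trans
      (le_add_of_nonneg_left (by positivity))
  · rw [Set.indicator_of_notMem (by exact hω), mul_zero, add_zero, div_mul_eq_mul_div]
    rw [not_lt] at hω
    gcongr

lemma abs_drift_le_state_add_bias (h : IsRobbinsMonro P 𝓕 D Γ Z d g β B κ K lo c) (k : ℕ) (ω : Ω) :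
    |d k ω| ≤ K * |D k ω| + |d k ω + g (D k ω)| := by
  obtain ⟨s, hs, hgs⟩ := h.exists_slope _ (h.abs_state_le k ω)
  have hfield : |g (D k ω)| ≤ K * |D k ω| := by
    rw [hgs, abs_mul, abs_of_nonneg (h.slope_pos.le.trans hs.1)]
    gcongr
    exact hs.2
  calc |d k ω| = |d k ω + g (D k ω) - g (D k ω)| := by rw [add_sub_cancel_right]
    _ ≤ |d k ω + g (D k ω)| + |g (D k ω)| := abs_sub _ _
    _ ≤ K * |D k ω| + |d k ω + g (D k ω)| := by linarith

lemma drift_sq_le (h : IsRobbinsMonro P 𝓕 D Γ Z d g β B κ K lo c) (k : ℕ) (ω : Ω) :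
    d k ω ^ 2 ≤ 2 * (K ^ 2 * D k ω ^ 2 + (d k ω + g (D k ω)) ^ 2) :=
  calc d k ω ^ 2 = |d k ω| ^ 2 := (sq_abs _).symm
    _ ≤ (K * |D k ω| + |d k ω + g (D k ω)|) ^ 2 :=
        pow_le_pow_left₀ (abs_nonneg _) (h.abs_drift_le_state_add_bias k ω) 2
    _ ≤ 2 * ((K * |D k ω|) ^ 2 + |d k ω + g (D k ω)| ^ 2) := add_sq_le
    _ = 2 * (K ^ 2 * D k ω ^ 2 + (d k ω + g (D k ω)) ^ 2) := by rw [mul_pow, sq_abs, sq_abs]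

variable [IsProbabilityMeasure P]

lemma integrable_increment (h : IsRobbinsMonro P 𝓕 D Γ Z d g β B κ K lo c) (k : ℕ) :
    Integrable (Z k) P :=
  .of_bound ((h.measurable_increment k).mono (𝓕.le _) le_rfl).aestronglyMeasurable 1
    (.of_forall (h.abs_increment_le k))

lemma condExp_increment_sub_drift (h : IsRobbinsMonro P 𝓕 D Γ Z d g β B κ K lo c) (k : ℕ) :
    P[Z k - d k | 𝓕 k] =ᵐ[P] 0 := by
  have hd : Integrable (d k) P :=
    .of_bound ((h.measurable_drift k).mono (𝓕.le k) le_rfl).aestronglyMeasurable 1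
      (.of_forall (h.abs_drift_le k))
  have hdk : P[d k | 𝓕 k] = d k :=
    condExp_of_stronglyMeasurable (𝓕.le k) (h.measurable_drift k).stronglyMeasurable hd
  filter_upwards [condExp_sub (h.integrable_increment k) hd (𝓕 k), h.condExp_increment k]
    with ω hsub hZ
  rw [hsub, Pi.sub_apply, hZ, hdk, sub_self, Pi.zero_apply]

lemma integrable_increment_sub_drift (h : IsRobbinsMonro P 𝓕 D Γ Z d g β B κ K lo c) (k : ℕ) :
    Integrable (Z k - d k) P :=
  .of_bound (((h.measurable_increment k).mono (𝓕.le _) le_rfl).sub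
    ((h.measurable_drift k).mono (𝓕.le k) le_rfl)).aestronglyMeasurable 2
    (.of_forall (h.abs_increment_sub_drift_le k))

lemma condExp_truncatedNoise (h : IsRobbinsMonro P 𝓕 D Γ Z d g β B κ K lo c) (hhi : 0 < hi)
    (k : ℕ) : P[truncatedNoise Γ Z d β hi k | 𝓕 k] =ᵐ[P] 0 := by
  have hint : Integrable (truncatedNoise Γ Z d β hi k) P :=
    .of_bound ((h.measurable_truncatedNoise k).mono (𝓕.le _) le_rfl).aestronglyMeasurable _
      (.of_forall (h.abs_truncatedNoise_le hhi k))
  filter_upwards [h.condExp_increment_sub_drift k, condExp_mul_of_stronglyMeasurable_left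
    (f := fun ω => min (Γ k ω) (hi * ((k : ℝ) + 1) ^ (-β))) (g := Z k - d k)
    ((h.measurable_step k).min measurable_const).stronglyMeasurable hint
    (h.integrable_increment_sub_drift k)] with ω hzero hpull
  exact hpull.trans (by rw [Pi.mul_apply, hzero, Pi.zero_apply, mul_zero])

theorem measureReal_lt_abs_windowNoise_le (h : IsRobbinsMonro P 𝓕 D Γ Z d g β B κ K lo c)
    (hhi : 0 < hi) {a : ℝ} (ha : 0 < a) {k : ℕ} (hlog : 1 ≤ Real.log ((k : ℝ) + 1))
    (ha₁ : a * (((k / 2 : ℕ) : ℝ) + 1) ^ (-β) ≤ 1) (j : ℕ) :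
    P.real {ω | √(48 * hi ^ 2 / a) * √(Real.log ((k : ℝ) + 1) * ((k : ℝ) + 1) ^ (-β)) <
      |windowNoise Γ Z d β hi a (k / 2) j ω|} ≤ 2 / ((k : ℝ) + 1) ^ 3 := by
  have hβ := h.exponent_mem
  have hu (i : ℕ) := rpow_add_one_le_of_le hβ.1.le ((k / 2).le_add_right i)
  set v : NNReal := ⟨8 * hi ^ 2 / a * ((k : ℝ) + 1) ^ (-β), by positivity⟩
  have hv : (v : ℝ) = 8 * hi ^ 2 / a * ((k : ℝ) + 1) ^ (-β) := rfl
  have hsub : HasSubgaussianMGF (windowNoise Γ Z d β hi a (k / 2) j) v P := by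
    refine hasSubgaussianMGF_linearRecursion (𝓖 := fun i => 𝓕 (k / 2 + i))
      (L := fun i => 2 * hi * (((k / 2 + i : ℕ) : ℝ) + 1) ^ (-β))
      (fun i i' hii' => 𝓕.mono (by omega)) (fun i => 𝓕.le _)
      (fun i => h.measurable_truncatedNoise _) (fun i => by positivity)
      (fun i => h.abs_truncatedNoise_le hhi _) (fun i => h.condExp_truncatedNoise hhi _)
      (fun i => ⟨by positivity, (mul_le_mul_of_nonneg_left (hu i) ha.le).trans ha₁⟩) (fun i => ?_) j
    have hwindow := (hu i).trans (rpow_half_add_one_le ⟨hβ.1.le, hβ.2.le⟩ k)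
    set u := (((k / 2 + i : ℕ) : ℝ) + 1) ^ (-β)
    have : 0 ≤ u := by positivity
    calc (2 * hi * u) ^ 2 = 4 * hi ^ 2 * u * u := by ring
      _ ≤ 4 * hi ^ 2 * u * (2 * ((k : ℝ) + 1) ^ (-β)) := by gcongr
      _ = a * u * v := by rw [hv]; field_simp; ring
  refine (measureReal_lt_abs_le_of_hasSubgaussianMGF hsub (by positivity)).trans_eq ?_
  have hexponent : -(√(48 * hi ^ 2 / a) * √(Real.log ((k : ℝ) + 1) * ((k : ℝ) + 1) ^ (-β))) ^ 2 /
      (2 * v) = -((3 : ℕ) * Real.log ((k : ℝ) + 1)) := by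
    rw [mul_pow, Real.sq_sqrt (by positivity), Real.sq_sqrt (by positivity), hv]
    field_simp
    norm_num
  rw [hexponent, Real.exp_neg, Real.exp_nat_mul, Real.exp_log (by positivity), div_eq_mul_inv]

lemma one_sub_le_measureReal_window (h : IsRobbinsMonro P 𝓕 D Γ Z d g β B κ K lo c)
    (hhi : 0 < hi) {a : ℝ} (ha : 0 < a) {C : ℝ} (hC : 0 ≤ C) {v : ℕ → ℝ} {k : ℕ}
    (hlog : 1 ≤ Real.log ((k : ℝ) + 1)) (ha₁ : a * (((k / 2 : ℕ) : ℝ) + 1) ^ (-β) ≤ 1)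
    (hkC : 16 * C + 2 ≤ (k : ℝ) + 1)
    (hΓ : ∀ j, k / 2 ≤ j →
      P.real {ω | hi * ((j : ℝ) + 1) ^ (-β) < Γ j ω} ≤ C / ((j : ℝ) + 1) ^ 3)
    (hb : ∀ j, k / 2 ≤ j →
      P.real {ω | v j < |d j ω + g (D j ω)|} ≤ C / ((j : ℝ) + 1) ^ 3) :
    1 - 1 / ((k : ℝ) + 1) ≤ P.real {ω | ∀ j ∈ Finset.Icc (k / 2) k,
      Γ j ω ≤ hi * ((j : ℝ) + 1) ^ (-β) ∧ |d j ω + g (D j ω)| ≤ v j ∧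
      |windowNoise Γ Z d β hi a (k / 2) (j - k / 2) ω| ≤
        √(48 * hi ^ 2 / a) * √(Real.log ((k : ℝ) + 1) * ((k : ℝ) + 1) ^ (-β))} := by
  set T : ℝ := (k : ℝ) + 1
  have hT : 0 < T := by positivity
  have hcard : ((Finset.Icc (k / 2) k).card : ℝ) ≤ T := by
    rw [Nat.card_Icc]
    exact (Nat.cast_le.2 (Nat.sub_le _ _)).trans_eq (Nat.cast_succ k)
  calc 1 - 1 / T = 1 - T * (T / T ^ 3) := by field_simp
    _ ≤ 1 - (Finset.Icc (k / 2) k).card * ((16 * C + 2) / T ^ 3) := by gcongr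
    _ ≤ _ := one_sub_card_mul_le_measureReal _ (bad := fun j : ℕ =>
        ({ω | hi * ((j : ℝ) + 1) ^ (-β) < Γ j ω} ∪ {ω | v j < |d j ω + g (D j ω)|}) ∪
        {ω | √(48 * hi ^ 2 / a) * √(Real.log T * T ^ (-β)) <
          |windowNoise Γ Z d β hi a (k / 2) (j - k / 2) ω|}) ?_ ?_
  · intro j hj
    have hj := (Finset.mem_Icc.1 hj).1
    calc _ ≤ 8 * C / T ^ 3 + 8 * C / T ^ 3 + 2 / T ^ 3 :=
          (measureReal_union_le _ _).trans (add_le_add ((measureReal_union_le _ _).trans (add_le_add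
            ((hΓ j hj).trans (div_pow_three_le_of_half_le hC hj))
            ((hb j hj).trans (div_pow_three_le_of_half_le hC hj))))
            (h.measureReal_lt_abs_windowNoise_le hhi ha hlog ha₁ _))
      _ = (16 * C + 2) / T ^ 3 := by ring
  · intro ω hω j hj
    simpa only [Set.mem_union, Set.mem_ofPred_eq, not_or, not_lt, and_assoc] using hω j hj

theorem exists_rate_in_probability (h : IsRobbinsMonro P 𝓕 D Γ Z d g β B κ K lo c)
    (hhi : 0 < hi) {C : ℝ} (hC : 0 ≤ C) {v : ℕ → ℝ} (hv₀ : ∀ k, 0 ≤ v k) {Cv : ℝ} (hCv : 0 ≤ Cv)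
    (hv : ∀ᶠ k in atTop, ∀ j, k / 2 ≤ j → j ≤ k → v j ≤ Cv * v k)
    (hΓ : ∀ᶠ k : ℕ in atTop,
      P.real {ω | hi * ((k : ℝ) + 1) ^ (-β) < Γ k ω} ≤ C / ((k : ℝ) + 1) ^ 3)
    (hb : ∀ᶠ k : ℕ in atTop,
      P.real {ω | v k < |d k ω + g (D k ω)|} ≤ C / ((k : ℝ) + 1) ^ 3) :
    ∃ C' > 0, ∀ᶠ k : ℕ in atTop, 1 - 1 / ((k : ℝ) + 1) ≤
      P.real {ω | |D k ω| ≤ C' * (√(Real.log ((k : ℝ) + 1) * ((k : ℝ) + 1) ^ (-β)) + v k) ∧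
        |d k ω + g (D k ω)| ≤ v k} := by
  obtain ⟨ω₀⟩ : Nonempty Ω := P.nonempty_of_neZero
  have hβ := h.exponent_mem
  have ha := h.gain_pos
  have hB : 0 ≤ B := (abs_nonneg _).trans (h.abs_state_le 0 ω₀)
  set a := κ * lo
  set C₃ := √(48 * hi ^ 2 / a)
  refine ⟨B + 2 * C₃ + hi / a * Cv + 1, by positivity, ?_⟩
  filter_upwards [eventually_forall_half_le hΓ, eventually_forall_half_le hb, hv,
    eventually_forall_half_le (eventually_mul_rpow_neg_le_one hβ.1 a),
    eventually_forall_half_le (eventually_mul_rpow_neg_le_one hβ.1 (hi * K)),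
    eventually_one_le_log_add_one,
    eventually_exp_neg_rpow_le (sub_pos.2 hβ.2) (by positivity : 0 < a / 4) 1,
    eventually_ge_atTop 1, tendsto_natCast_add_one.eventually_ge_atTop (16 * C + 2)]
    with k hΓk hbk hvk ha₁ hK₁ hlog hexp hk₁ hkC
  refine (h.one_sub_le_measureReal_window hhi ha hC hlog (ha₁ _ le_rfl) hkC hΓk hbk).trans
    (measureReal_mono fun ω hω => ?_)
  have hgood (j : ℕ) (hmj : k / 2 ≤ j) (hjk : j ≤ k) := hω j (Finset.mem_Icc.2 ⟨hmj, hjk⟩)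
  refine ⟨?_, (hgood k (by omega) le_rfl).2.1⟩
  have hwindow := h.abs_state_le_of_window (m := k / 2) (n := k - k / 2) (ω := ω) hhi
    (mul_nonneg hCv (hv₀ k)) (hK₁ _ le_rfl) (fun j hj => (hgood _ (by omega) (by omega)).1)
    (fun j hj => (hgood _ (by omega) (by omega)).2.1.trans (hvk _ (by omega) (by omega)))
    (fun j hj => by
      simpa only [Nat.add_sub_cancel_left] using (hgood (k / 2 + j) (by omega) (by omega)).2.2)
  rw [show k / 2 + (k - k / 2) = k by omega] at hwindow
  have hinv := rpow_neg_one_le_sqrt_log_mul_rpow_neg (β := β) (by linarith [hβ.2])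
    (le_add_of_nonneg_left k.cast_nonneg) hlog
  have hforget := mul_le_mul_of_nonneg_right
    ((prod_one_sub_le_exp ha.le hβ.1.le hk₁ (ha₁ _ le_rfl)).trans (hexp.trans hinv)) hB
  set R := √(Real.log ((k : ℝ) + 1) * ((k : ℝ) + 1) ^ (-β))
  calc |D k ω| ≤ R * B + 2 * (C₃ * R) + hi / a * (Cv * v k) := by linarith
    _ ≤ R * B + 2 * (C₃ * R) + hi / a * (Cv * v k) +
        (hi / a * Cv * R + R + (B + 2 * C₃ + 1) * v k) := by
        have := hv₀ k
        exact le_add_of_nonneg_right (by positivity)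
    _ = (B + 2 * C₃ + hi / a * Cv + 1) * (R + v k) := by ring

lemma integrable_bias_sq (h : IsRobbinsMonro P 𝓕 D Γ Z d g β B κ K lo c) (k : ℕ) :
    Integrable (fun ω => (d k ω + g (D k ω)) ^ 2) P :=
  .of_bound ((h.measurable_bias k).pow_const 2).aestronglyMeasurable ((1 + K * B) ^ 2)
    (.of_forall fun ω => by
      rw [norm_pow]; exact pow_le_pow_left₀ (norm_nonneg _) (h.abs_bias_le k ω) 2)

lemma memLp_state (h : IsRobbinsMonro P 𝓕 D Γ Z d g β B κ K lo c) (k : ℕ) : MemLp (D k) 2 P :=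
  .of_bound ((h.measurable_state k).mono (𝓕.le k) le_rfl).aestronglyMeasurable B
    (.of_forall (h.abs_state_le k))

lemma integrable_state_sq (h : IsRobbinsMonro P 𝓕 D Γ Z d g β B κ K lo c) (k : ℕ) :
    Integrable (fun ω => D k ω ^ 2) P :=
  (h.memLp_state k).integrable_sq

lemma integrable_and_integral_step_mul_state_mul_increment
    (h : IsRobbinsMonro P 𝓕 D Γ Z d g β B κ K lo c) (k : ℕ) :
    Integrable (fun ω => 2 * Γ k ω * D k ω * (Z k ω - d k ω)) P ∧
      ∫ ω, 2 * Γ k ω * D k ω * (Z k ω - d k ω) ∂P = 0 := by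
  have hW : Measurable[𝓕 k] fun ω => 2 * Γ k ω * D k ω :=
    ((h.measurable_step k).const_mul 2).mul (h.measurable_state k)
  have hint : Integrable (fun ω => 2 * Γ k ω * D k ω * (Z k ω - d k ω)) P := by
    refine (h.integrable_increment_sub_drift k).bdd_mul (c := 2 * c * B)
      (hW.mono (𝓕.le k) le_rfl).aestronglyMeasurable (.of_forall fun ω => ?_)
    have hΓ := h.step_nonneg k ω
    rw [Real.norm_eq_abs, abs_mul, abs_of_nonneg (by positivity)]
    exact mul_le_mul (by linarith [h.step_le k ω]) (h.abs_state_le k ω) (abs_nonneg _)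
      (by linarith [h.step_le k ω])
  exact ⟨hint, integral_mul_eq_zero_of_condExp_eq_zero (𝓕.le k) hW.stronglyMeasurable
    (h.integrable_increment_sub_drift k) hint (h.condExp_increment_sub_drift k)⟩

theorem integral_sq_succ_le (h : IsRobbinsMonro P 𝓕 D Γ Z d g β B κ K lo c) (hhi : 0 ≤ hi)
    (k : ℕ) :
    ∫ ω, D (k + 1) ω ^ 2 ∂P ≤ (1 - κ * lo * ((k : ℝ) + 1) ^ (-β)) * ∫ ω, D k ω ^ 2 ∂P +
      hi * ((k : ℝ) + 1) ^ (-β) / κ * ∫ ω, (d k ω + g (D k ω)) ^ 2 ∂P +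
      (hi * ((k : ℝ) + 1) ^ (-β)) ^ 2 + (c * (1 + K * B) ^ 2 / κ + c ^ 2) *
        P.real {ω | hi * ((k : ℝ) + 1) ^ (-β) < Γ k ω} := by
  obtain ⟨hmart_int, hmart⟩ := h.integrable_and_integral_step_mul_state_mul_increment k
  have hbad : MeasurableSet {ω | hi * ((k : ℝ) + 1) ^ (-β) < Γ k ω} :=
    measurableSet_lt measurable_const ((h.measurable_step k).mono (𝓕.le k) le_rfl)
  have hstate := (h.integrable_state_sq k).const_mul (1 - κ * lo * ((k : ℝ) + 1) ^ (-β))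
  have hbias := (h.integrable_bias_sq k).const_mul (hi * ((k : ℝ) + 1) ^ (-β) / κ)
  have hconst : Integrable (fun _ : Ω => (hi * ((k : ℝ) + 1) ^ (-β)) ^ 2) P := integrable_const _
  have hindicator : Integrable (fun ω => (c * (1 + K * B) ^ 2 / κ + c ^ 2) *
      {ω | hi * ((k : ℝ) + 1) ^ (-β) < Γ k ω}.indicator (1 : Ω → ℝ) ω) P :=
    ((integrable_const 1).indicator hbad).const_mul _
  calc ∫ ω, D (k + 1) ω ^ 2 ∂P
      ≤ ∫ ω, ((((1 - κ * lo * ((k : ℝ) + 1) ^ (-β)) * D k ω ^ 2 +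
          hi * ((k : ℝ) + 1) ^ (-β) / κ * (d k ω + g (D k ω)) ^ 2) +
          (hi * ((k : ℝ) + 1) ^ (-β)) ^ 2 + (c * (1 + K * B) ^ 2 / κ + c ^ 2) *
            {ω | hi * ((k : ℝ) + 1) ^ (-β) < Γ k ω}.indicator 1 ω) +
          2 * Γ k ω * D k ω * (Z k ω - d k ω)) ∂P :=
        integral_mono (h.integrable_state_sq _)
          ((((hstate.add hbias).add hconst).add hindicator).add hmart_int) fun ω => by
          linarith [h.sq_state_succ_le k ω, h.step_mul_sq_add_sq_le hhi k ω]
    _ = _ := by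
        rw [integral_add (by exact ((hstate.add hbias).add hconst).add hindicator) hmart_int,
          hmart, add_zero, integral_add (by exact (hstate.add hbias).add hconst) hindicator,
          integral_add (by exact hstate.add hbias) hconst, integral_add hstate hbias,
          integral_const_mul, integral_const_mul, integral_const_mul, integral_const,
          probReal_univ, one_smul, integral_indicator_one hbad]

theorem exists_rate_in_mean (h : IsRobbinsMonro P 𝓕 D Γ Z d g β B κ K lo c)
    (hhi : 0 ≤ hi) {C : ℝ} (hC : 0 ≤ C) {v : ℕ → ℝ}
    (hv : ∀ a > 0, ∀ᶠ k : ℕ in atTop, (1 - a * ((k : ℝ) + 1) ^ (-β)) * v k ≤ v (k + 1))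
    (huv : ∀ᶠ k : ℕ in atTop, ((k : ℝ) + 1) ^ (-β) ≤ v k)
    (hΓ : ∀ᶠ k : ℕ in atTop,
      P.real {ω | hi * ((k : ℝ) + 1) ^ (-β) < Γ k ω} ≤ C / ((k : ℝ) + 1) ^ 3)
    (hb : ∀ᶠ k : ℕ in atTop, ∫ ω, (d k ω + g (D k ω)) ^ 2 ∂P ≤ C * v k) :
    ∃ C' > 0, ∀ᶠ k : ℕ in atTop, ∫ ω, D k ω ^ 2 ∂P ≤ C' * v k := by
  obtain ⟨ω₀⟩ : Nonempty Ω := P.nonempty_of_neZero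
  have hκ := h.slope_pos
  have hlo := h.lo_pos
  have hβ := h.exponent_mem
  have hc : 0 ≤ c := (h.step_nonneg 0 ω₀).trans (h.step_le 0 ω₀)
  set A := c * (1 + K * B) ^ 2 / κ + c ^ 2
  refine exists_eventually_le_mul_of_recursion
    (w := fun k : ℕ => κ * lo / 2 * ((k : ℝ) + 1) ^ (-β))
    (C := (hi * C / κ + hi ^ 2 + A * C) / (κ * lo / 2))
    (huv.mono fun k hk => lt_of_lt_of_le (by positivity) hk) (.of_forall fun k => by positivity)
    ?_ (hv _ (by positivity)) ?_
  · filter_upwards [eventually_mul_rpow_neg_le_one hβ.1 (κ * lo)] with k hk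
    linarith
  · filter_upwards [huv, hΓ, hb] with k huvk hΓk hbk
    have hcube : C / ((k : ℝ) + 1) ^ 3 ≤ C * (((k : ℝ) + 1) ^ (-β) * v k) := by
      have hpow : (((k : ℝ) + 1) ^ 3)⁻¹ ≤ ((k : ℝ) + 1) ^ (-β) * ((k : ℝ) + 1) ^ (-β) := by
        rw [← Real.rpow_natCast, ← Real.rpow_neg (by positivity), ← Real.rpow_add (by positivity)]
        refine Real.rpow_le_rpow_of_exponent_le (le_add_of_nonneg_left k.cast_nonneg) ?_
        push_cast
        linarith [hβ.2]
      rw [div_eq_mul_inv]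
      gcongr
      exact hpow.trans (by gcongr)
    refine (h.integral_sq_succ_le hhi k).trans ?_
    set u := ((k : ℝ) + 1) ^ (-β)
    have : 0 ≤ u := by positivity
    calc _ ≤ (1 - κ * lo * u) * ∫ ω, D k ω ^ 2 ∂P + hi * u / κ * (C * v k) + hi ^ 2 * (u * v k) +
          A * (C * (u * v k)) := by
          rw [mul_pow hi, sq u]
          gcongr
          exact hΓk.trans hcube
      _ = _ := by field_simp; ring

lemma slope_upper_pos (h : IsRobbinsMonro P 𝓕 D Γ Z d g β B κ K lo c) : 0 < K := by
  obtain ⟨ω⟩ : Nonempty Ω := P.nonempty_of_neZero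
  obtain ⟨s, hs, -⟩ := h.exists_slope _ (h.abs_state_le 0 ω)
  exact h.slope_pos.trans_le (hs.1.trans hs.2)

lemma memLp_drift (h : IsRobbinsMonro P 𝓕 D Γ Z d g β B κ K lo c) (k : ℕ) : MemLp (d k) 2 P :=
  .of_bound ((h.measurable_drift k).mono (𝓕.le k) le_rfl).aestronglyMeasurable 1
    (.of_forall (h.abs_drift_le k))

theorem exists_error_rate_in_probability (h : IsRobbinsMonro P 𝓕 D Γ Z d g β B κ K lo c)
    (hr : 0 < r) (herr : ∀ k, err k =ᵐ[P] fun ω => d k ω / r)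
    (hhi : 0 < hi) {C : ℝ} (hC : 0 ≤ C) {v : ℕ → ℝ} (hv₀ : ∀ k, 0 ≤ v k) {Cv : ℝ} (hCv : 0 ≤ Cv)
    (hv : ∀ᶠ k in atTop, ∀ j, k / 2 ≤ j → j ≤ k → v j ≤ Cv * v k)
    (hΓ : ∀ᶠ k : ℕ in atTop,
      P.real {ω | hi * ((k : ℝ) + 1) ^ (-β) < Γ k ω} ≤ C / ((k : ℝ) + 1) ^ 3)
    (hb : ∀ᶠ k : ℕ in atTop,
      P.real {ω | v k < |d k ω + g (D k ω)|} ≤ C / ((k : ℝ) + 1) ^ 3) :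
    ∃ C' > 0, ∀ᶠ k : ℕ in atTop, 1 - 1 / ((k : ℝ) + 1) ≤ P.real {ω | |err k ω| + |D k ω| ≤
      C' * (√(Real.log ((k : ℝ) + 1) * ((k : ℝ) + 1) ^ (-β)) + v k)} := by
  obtain ⟨C', hC', hev⟩ := h.exists_rate_in_probability hhi hC hv₀ hCv hv hΓ hb
  have hK := h.slope_upper_pos
  refine ⟨(K / r + 1) * C' + 1 / r, by positivity, hev.mono fun k hk => hk.trans
    (ENNReal.toReal_mono (measure_ne_top _ _) (measure_mono_ae ?_))⟩
  filter_upwards [herr k] with ω hω hmem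
  obtain ⟨hstate, hbias⟩ := hmem
  set w := √(Real.log ((k : ℝ) + 1) * ((k : ℝ) + 1) ^ (-β))
  change |err k ω| + |D k ω| ≤ ((K / r + 1) * C' + 1 / r) * (w + v k)
  calc |err k ω| + |D k ω| = |d k ω| / r + |D k ω| := by rw [hω, abs_div, abs_of_pos hr]
    _ ≤ (K * |D k ω| + v k) / r + |D k ω| := by
        gcongr; linarith [h.abs_drift_le_state_add_bias k ω]
    _ = (K / r + 1) * |D k ω| + 1 / r * v k := by ring
    _ ≤ (K / r + 1) * (C' * (w + v k)) + 1 / r * (w + v k) := by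
        gcongr; exact le_add_of_nonneg_left (Real.sqrt_nonneg _)
    _ = ((K / r + 1) * C' + 1 / r) * (w + v k) := by ring

theorem exists_error_rate_in_mean (h : IsRobbinsMonro P 𝓕 D Γ Z d g β B κ K lo c)
    (herr : ∀ k, err k =ᵐ[P] fun ω => d k ω / r)
    (hhi : 0 ≤ hi) {C : ℝ} (hC : 0 ≤ C) {v : ℕ → ℝ}
    (hv : ∀ a > 0, ∀ᶠ k : ℕ in atTop, (1 - a * ((k : ℝ) + 1) ^ (-β)) * v k ≤ v (k + 1))
    (huv : ∀ᶠ k : ℕ in atTop, ((k : ℝ) + 1) ^ (-β) ≤ v k)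
    (hΓ : ∀ᶠ k : ℕ in atTop,
      P.real {ω | hi * ((k : ℝ) + 1) ^ (-β) < Γ k ω} ≤ C / ((k : ℝ) + 1) ^ 3)
    (hb : ∀ᶠ k : ℕ in atTop, ∫ ω, (d k ω + g (D k ω)) ^ 2 ∂P ≤ C * v k) :
    ∃ C' > 0, ∀ᶠ k : ℕ in atTop, MemLp (err k) 2 P ∧ MemLp (D k) 2 P ∧
      ∫ ω, err k ω ^ 2 ∂P + ∫ ω, D k ω ^ 2 ∂P ≤ C' * v k := by
  obtain ⟨C', hC', hev⟩ := h.exists_rate_in_mean hhi hC hv huv hΓ hb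
  refine ⟨2 / r ^ 2 * (K ^ 2 * C' + C) + C', by positivity, ?_⟩
  filter_upwards [hev, hb] with k hstate hbias
  refine ⟨((h.memLp_drift k).mul_const r⁻¹).ae_eq (herr k).symm, h.memLp_state k, ?_⟩
  have hdrift : ∫ ω, d k ω ^ 2 ∂P ≤
      2 * (K ^ 2 * ∫ ω, D k ω ^ 2 ∂P + ∫ ω, (d k ω + g (D k ω)) ^ 2 ∂P) := by
    have hint := (h.integrable_state_sq k).const_mul (K ^ 2)
    rw [← integral_const_mul, ← integral_add hint (h.integrable_bias_sq k), ← integral_const_mul]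
    exact integral_mono (h.memLp_drift k).integrable_sq
      ((hint.add (h.integrable_bias_sq k)).const_mul 2) (h.drift_sq_le k)
  calc ∫ ω, err k ω ^ 2 ∂P + ∫ ω, D k ω ^ 2 ∂P
      = 1 / r ^ 2 * ∫ ω, d k ω ^ 2 ∂P + ∫ ω, D k ω ^ 2 ∂P := by
        rw [integral_congr_ae ((herr k).mono fun ω hω => congrArg (· ^ 2) hω)]
        simp_rw [div_pow, integral_div, one_div_mul_eq_div]
    _ ≤ 1 / r ^ 2 * (2 * (K ^ 2 * (C' * v k) + C * v k)) + C' * v k := by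
        gcongr
        exact hdrift.trans (by gcongr)
    _ = (2 / r ^ 2 * (K ^ 2 * C' + C) + C') * v k := by ring

end IsRobbinsMonro

/-! ### The threshold recursion -/

section Reaction

lemma react_mem_Icc (y : ℝ) (A : Set ℝ) (q : ℝ) : react y A q ∈ Set.Icc (0 : ℝ) 1 := by
  unfold react
  split_ifs
  · exact covErr_mem_Icc y A
  · simp

lemma react_predInterval_of_ne {y m : ℝ} (h : y ≠ m) (s q : ℝ) :
    react y (predInterval m s q) q = covErr y (predInterval m s q) := by
  unfold react
  split_ifs with hq
  · rfl
  · rw [predInterval, if_pos (not_le.1 hq).le, covErr, if_neg (by simpa using h)]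

lemma natCast_toNat_mem_Icc (b : Bool) : (b.toNat : ℝ) ∈ Set.Icc (0 : ℝ) 1 := by
  cases b <;> simp

variable {Ω : Type*} {m₀ : MeasurableSpace Ω} {y m s q : Ω → ℝ}

lemma measurable_covErr_predInterval (hy : Measurable y) (hm : Measurable m) (hs : Measurable s)
    (hq : Measurable q) : Measurable fun ω => covErr (y ω) (predInterval (m ω) (s ω) (q ω)) := by
  set w : ℝ → ℝ := fun p => (Set.Ioo 0 1).indicator normalQuantile ((p + 1) / 2)
  have hw : Measurable fun ω => w (q ω) :=
    measurable_indicator_normalQuantile.comp ((hq.add_const 1).div_const 2)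
  have hcovErr (ω : Ω) : covErr (y ω) (predInterval (m ω) (s ω) (q ω)) =
      if q ω ≤ 0 then (if y ω = m ω then 0 else 1) else if 1 ≤ q ω then 0 else
        if y ω ∈ Set.Icc (m ω - s ω * w (q ω)) (m ω + s ω * w (q ω)) then 0 else 1 := by
    rcases le_or_gt (q ω) 0 with h0 | h0
    · simp [covErr, predInterval, h0]
    rcases le_or_gt 1 (q ω) with h1 | h1
    · simp [covErr, predInterval, h0.not_ge, h1]
    · have hwq : w (q ω) = normalQuantile ((q ω + 1) / 2) :=
        Set.indicator_of_mem (Set.mem_Ioo.2 ⟨by linarith, by linarith⟩) _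
      simp only [covErr, predInterval, hwq, if_neg h0.not_ge, if_neg h1.not_ge]
  simp_rw [hcovErr]
  refine .ite (measurableSet_le hq measurable_const)
    (.ite (measurableSet_eq_fun hy hm) measurable_const measurable_const)
    (.ite (measurableSet_le measurable_const hq) measurable_const
      (.ite ?_ measurable_const measurable_const))
  exact (measurableSet_le (hm.sub (hs.mul hw)) hy).inter (measurableSet_le hy (hm.add (hs.mul hw)))

lemma measurable_react_predInterval (hy : Measurable y) (hm : Measurable m) (hs : Measurable s)
    (hq : Measurable q) :
    Measurable fun ω => react (y ω) (predInterval (m ω) (s ω) (q ω)) (q ω) :=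
  .ite (measurableSet_le measurable_const hq) (measurable_covErr_predInterval hy hm hs hq)
    measurable_const

end Reaction

section Recursion

variable {Ω 𝒳 : Type*}

/-- The counter `J (k + 1)`: one plus the number of selections among the times `1, …, k`. -/
def selectionCount (S : 𝒳 → Bool) (x : ℕ → 𝒳) (k : ℕ) : ℕ :=
  1 + ∑ i ∈ Finset.range k, (S (x (i + 1))).toNat

/-- The step size `γ_{J (k + 1)}` of OnlineSCI, for `γ_j = c j ^ (-β)`. -/
noncomputable def stepSize (β c : ℝ) (S : 𝒳 → Bool) (X : ℕ → Ω → 𝒳) (k : ℕ) (ω : Ω) : ℝ :=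
  c * (selectionCount S (fun i => X i ω) k : ℝ) ^ (-β)

/-- The prediction set `𝒞_t(X_t, q_t)`. -/
noncomputable def predictionSet (X : ℕ → Ω → 𝒳) (μhat σhat : ℕ → Ω → 𝒳 → ℝ) (q : ℕ → Ω → ℝ)
    (t : ℕ) (ω : Ω) : Set ℝ :=
  predInterval (μhat t ω (X t ω)) (σhat t ω (X t ω)) (q t ω)

/-- The increment of the OnlineSCI threshold at time `k + 1`, before scaling by the step size. -/
noncomputable def increment (α : ℝ) (S : 𝒳 → Bool) (X : ℕ → Ω → 𝒳) (Y : ℕ → Ω → ℝ)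
    (μhat σhat : ℕ → Ω → 𝒳 → ℝ) (q : ℕ → Ω → ℝ) (k : ℕ) (ω : Ω) : ℝ :=
  (react (Y (k + 1) ω) (predictionSet X μhat σhat q (k + 1) ω) (q (k + 1) ω) - α) *
    ((S (X (k + 1) ω)).toNat : ℝ)

/-- `q` is the OnlineSCI threshold process started from `q₁` at time `1`, for the steps
`γ_j = c j ^ (-β)` and a time-constant selection rule. -/
structure IsOnlineSCI (α β c q₁ : ℝ) (S : 𝒳 → Bool) (X : ℕ → Ω → 𝒳) (Y : ℕ → Ω → ℝ)
    (μhat σhat : ℕ → Ω → 𝒳 → ℝ) (q : ℕ → Ω → ℝ) : Prop where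
  one : ∀ ω, q 1 ω = q₁
  succ : ∀ k ω,
    q (k + 2) ω = q (k + 1) ω + stepSize β c S X k ω * increment α S X Y μhat σhat q k ω

lemma sciState_snd {α q₁ : ℝ} {γ : ℕ → ℝ} {S : 𝒳 → Bool} {A : ℕ → 𝒳 → ℝ → Set ℝ} {x : ℕ → 𝒳}
    {y : ℕ → ℝ} (k : ℕ) :
    (sciState α γ q₁ (fun _ x _ => S x) A x y (k + 1)).2 = selectionCount S x k := by
  induction k with
  | zero => rfl
  | succ k ih => rw [sciState, ih, selectionCount, selectionCount, Finset.sum_range_succ, add_assoc]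

variable {α β c q₁ : ℝ} {S : 𝒳 → Bool} {X : ℕ → Ω → 𝒳} {Y : ℕ → Ω → ℝ}
  {μhat σhat : ℕ → Ω → 𝒳 → ℝ} {q : ℕ → Ω → ℝ}

lemma isOnlineSCI_sciThreshold :
    IsOnlineSCI α β c q₁ S X Y μhat σhat fun t ω => sciThreshold α (fun j => c * (j : ℝ) ^ (-β)) q₁
      (fun _ x _ => S x) (fun k x z => predInterval (μhat k ω x) (σhat k ω x) z)
      (fun k => X k ω) (fun k => Y k ω) t where
  one _ := rfl
  succ k ω := by
    rw [stepSize, ← sciState_snd, increment, ← mul_assoc]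
    rfl

lemma one_le_selectionCount (x : ℕ → 𝒳) (k : ℕ) : 1 ≤ selectionCount S x k :=
  Nat.le_add_right 1 _

lemma selectionCount_le (x : ℕ → 𝒳) (k : ℕ) : selectionCount S x k ≤ k + 1 := by
  have hsum := Finset.sum_le_card_nsmul (Finset.range k) (fun i => (S (x (i + 1))).toNat) 1
    fun i _ => Bool.toNat_le _
  rw [Finset.card_range, smul_eq_mul, mul_one] at hsum
  rw [selectionCount, add_comm]
  exact Nat.add_le_add_right hsum 1

lemma stepSize_le (hβ : 0 ≤ β) (hc : 0 ≤ c) (k : ℕ) (ω : Ω) : stepSize β c S X k ω ≤ c :=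
  mul_le_of_le_one_right hc <| Real.rpow_le_one_of_one_le_of_nonpos
    (by exact_mod_cast one_le_selectionCount _ k) (neg_nonpos.2 hβ)

lemma le_stepSize (hβ : 0 ≤ β) (hc : 0 ≤ c) (k : ℕ) (ω : Ω) :
    c * ((k : ℝ) + 1) ^ (-β) ≤ stepSize β c S X k ω := by
  refine mul_le_mul_of_nonneg_left (Real.rpow_le_rpow_of_nonpos ?_ ?_ (neg_nonpos.2 hβ)) hc
  · exact_mod_cast one_le_selectionCount _ k
  · exact_mod_cast selectionCount_le _ k

lemma abs_increment_le_one (hα : α ∈ Set.Icc (0 : ℝ) 1) (k : ℕ) (ω : Ω) :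
    |increment α S X Y μhat σhat q k ω| ≤ 1 := by
  have hreact := react_mem_Icc (Y (k + 1) ω) (predictionSet X μhat σhat q (k + 1) ω)
    (q (k + 1) ω)
  have hsel := natCast_toNat_mem_Icc (S (X (k + 1) ω))
  rw [increment, abs_mul, abs_of_nonneg hsel.1]
  exact mul_le_one₀ (abs_le.2 ⟨by linarith [hreact.1, hα.2], by linarith [hreact.2, hα.1]⟩)
    hsel.1 hsel.2

lemma increment_nonneg_of_neg (hα : α ≤ 1) {k : ℕ} {ω : Ω} (hq : q (k + 1) ω < 0) :
    0 ≤ increment α S X Y μhat σhat q k ω := by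
  rw [increment, react, if_neg hq.not_ge]
  exact mul_nonneg (sub_nonneg.2 hα) (natCast_toNat_mem_Icc _).1

lemma increment_nonpos_of_one_le (hα : 0 ≤ α) {k : ℕ} {ω : Ω} (hq : 1 ≤ q (k + 1) ω) :
    increment α S X Y μhat σhat q k ω ≤ 0 := by
  rw [increment, react, if_pos (zero_le_one.trans hq), predictionSet, predInterval,
    if_neg (zero_lt_one.trans_le hq).not_ge, if_pos hq, covErr, if_pos (Set.mem_univ _)]
  exact mul_nonpos_of_nonpos_of_nonneg (by linarith) (natCast_toNat_mem_Icc _).1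

lemma IsOnlineSCI.abs_threshold_le (h : IsOnlineSCI α β c q₁ S X Y μhat σhat q)
    (hα : α ∈ Set.Icc (0 : ℝ) 1) (hβ : 0 ≤ β) (hc : 0 ≤ c) (k : ℕ) (ω : Ω) :
    |q (k + 1) ω| ≤ 1 + c + |q₁| := by
  induction k with
  | zero => rw [zero_add, h.one]; linarith
  | succ k ih =>
    rw [h.succ]
    have hΓ : 0 ≤ stepSize β c S X k ω := (le_stepSize hβ hc k ω).trans' (by positivity)
    have hstep : |stepSize β c S X k ω * increment α S X Y μhat σhat q k ω| ≤ c := by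
      rw [abs_mul, abs_of_nonneg hΓ]
      exact (mul_le_of_le_one_right hΓ (abs_increment_le_one hα k ω)).trans (stepSize_le hβ hc k ω)
    rw [abs_le] at hstep ih ⊢
    have habs := abs_nonneg q₁
    rcases lt_or_ge (q (k + 1) ω) 0 with hneg | hnonneg
    · have := mul_nonneg hΓ
        (increment_nonneg_of_neg (S := S) (X := X) (Y := Y) (μhat := μhat) (σhat := σhat) hα.2 hneg)
      constructor <;> linarith
    rcases lt_or_ge (q (k + 1) ω) 1 with hlt | hge
    · constructor <;> linarith
    · have := mul_nonpos_of_nonneg_of_nonpos hΓ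
        (increment_nonpos_of_one_le (S := S) (X := X) (Y := Y) (μhat := μhat) (σhat := σhat)
          hα.1 hge)
      constructor <;> linarith

end Recursion

/-! ### The iid regression model -/

section Population

variable {𝒳 : Type*}

/-- The coverage error on a selected unit `z = (x, e)` (covariate and noise), when the regression
`μ`, `σ` is estimated by `m`, `s` and the threshold is `q`. -/
noncomputable def selectedError (S : 𝒳 → Bool) (μ σ m s : 𝒳 → ℝ) (q : ℝ) (z : 𝒳 × ℝ) : ℝ :=
  covErr (μ z.1 + σ z.1 * z.2) (predInterval (m z.1) (s z.1) q) * ((S z.1).toNat : ℝ)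

lemma selectedError_mem_Icc (S : 𝒳 → Bool) (μ σ m s : 𝒳 → ℝ) (q : ℝ) (z : 𝒳 × ℝ) :
    selectedError S μ σ m s q z ∈ Set.Icc (0 : ℝ) 1 := by
  have herr := covErr_mem_Icc (μ z.1 + σ z.1 * z.2) (predInterval (m z.1) (s z.1) q)
  have hsel := natCast_toNat_mem_Icc (S z.1)
  exact ⟨mul_nonneg herr.1 hsel.1, mul_le_one₀ herr.2 hsel.1 hsel.2⟩

variable [MeasurableSpace 𝒳] {S : 𝒳 → Bool} {μ σ : 𝒳 → ℝ}

/-- The mean estimation error of the regression `μ`, `σ` by `m`, `s`, for covariates distributed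
according to `lX`. -/
noncomputable def estimationError (lX : Measure 𝒳) (μ σ m s : 𝒳 → ℝ) : ENNReal :=
  ∫⁻ x, ENNReal.ofReal (|m x - μ x| + |s x - σ x|) ∂lX

/-- The mean of `selectedError` for covariates and noise distributed according to `lX` and `ν`. -/
noncomputable def meanSelectedError (lX : Measure 𝒳) (ν : Measure ℝ) (S : 𝒳 → Bool)
    (μ σ m s : 𝒳 → ℝ) (q : ℝ) : ℝ :=
  ∫ z, selectedError S μ σ m s q z ∂(lX.prod ν)

lemma measurable_natCast_toNat (hS : Measurable S) : Measurable fun x => ((S x).toNat : ℝ) :=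
  (measurable_from_top (f := fun b : Bool => (b.toNat : ℝ))).comp hS

lemma measurable_uncurry_selectedError {Ω : Type*} [MeasurableSpace Ω] {m s : Ω → 𝒳 → ℝ}
    {q : Ω → ℝ} (hS : Measurable S) (hμ : Measurable μ) (hσ : Measurable σ)
    (hm : Measurable m.uncurry) (hs : Measurable s.uncurry) (hq : Measurable q) :
    Measurable (fun ω => selectedError S μ σ (m ω) (s ω) (q ω)).uncurry := by
  have hproj : Measurable fun p : Ω × (𝒳 × ℝ) => (p.1, p.2.1) := by fun_prop
  exact (measurable_covErr_predInterval (by fun_prop : Measurable fun p : Ω × (𝒳 × ℝ) =>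
    μ p.2.1 + σ p.2.1 * p.2.2) (hm.comp hproj) (hs.comp hproj) (hq.comp measurable_fst)).mul
    ((measurable_natCast_toNat hS).comp (measurable_fst.comp measurable_snd))

lemma integrable_selectedError {lX : Measure 𝒳} [IsProbabilityMeasure lX] {ν : Measure ℝ}
    [IsProbabilityMeasure ν] {m s : 𝒳 → ℝ} {q : ℝ}
    (hE : Measurable (selectedError S μ σ m s q)) :
    Integrable (selectedError S μ σ m s q) (lX.prod ν) :=
  .of_mem_Icc 0 1 hE.aemeasurable (.of_forall (selectedError_mem_Icc S μ σ m s q))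

lemma meanSelectedError_mem_Icc {lX : Measure 𝒳} [IsProbabilityMeasure lX] {ν : Measure ℝ}
    [IsProbabilityMeasure ν] {m s : 𝒳 → ℝ} {q : ℝ}
    (hE : Measurable (selectedError S μ σ m s q)) :
    meanSelectedError lX ν S μ σ m s q ∈ Set.Icc (0 : ℝ) 1 := by
  refine ⟨integral_nonneg fun z => (selectedError_mem_Icc S μ σ m s q z).1, ?_⟩
  exact (integral_mono (integrable_selectedError hE) (integrable_const 1)
    fun z => (selectedError_mem_Icc S μ σ m s q z).2).trans_eq (by simp)

theorem enorm_meanSelectedError_sub_le {lX : Measure 𝒳} [IsProbabilityMeasure lX] {ν : Measure ℝ}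
    [IsProbabilityMeasure ν] [NullSingletonClass ν] {f : ℝ → ℝ}
    (hF : ∀ x, HasDerivAt (cdf ν) (f x) x) (hf : Function.Even f) {M M' L : ℝ}
    (hM : ∀ x, f x ≤ M) (hM' : ∀ x, |x| * f x ≤ M') (hσ : ∀ x, 0 < σ x) (hL : ∀ x, 1 / σ x ≤ L)
    (hS : Measurable S) {m s : 𝒳 → ℝ} {q : ℝ} (hE : Measurable (selectedError S μ σ m s q)) :
    ‖meanSelectedError lX ν S μ σ m s q - (∫ x, ((S x).toNat : ℝ) ∂lX) * idealError ν q‖ₑ ≤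
      ENNReal.ofReal ((2 * M + 4 * M' + 4) * L) * estimationError lX μ σ m s := by
  have hM0 : 0 ≤ M := (density_nonneg hF 0).trans (hM 0)
  have hM0' : 0 ≤ M' := le_trans (by simp) (hM' 0)
  have hE_int := integrable_selectedError (lX := lX) (ν := ν) hE
  have hS_int : Integrable (fun x => ((S x).toNat : ℝ)) lX :=
    .of_mem_Icc 0 1 (measurable_natCast_toNat hS).aemeasurable
      (.of_forall fun x => natCast_toNat_mem_Icc (S x))
  rw [meanSelectedError, integral_prod _ hE_int, ← integral_mul_const,
    ← integral_sub hE_int.integral_prod_left (hS_int.mul_const _), estimationError,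
    ← lintegral_const_mul' _ _ ENNReal.ofReal_ne_top]
  refine (enorm_integral_le_lintegral_enorm _).trans (lintegral_mono fun x => ?_)
  have hsel := natCast_toNat_mem_Icc (S x)
  have hL0 : 0 ≤ L := (one_div_pos.2 (hσ x)).le.trans (hL x)
  simp only [selectedError]
  rw [integral_mul_const, mul_comm ((S x).toNat : ℝ), ← sub_mul, Real.enorm_eq_ofReal_abs,
    ← ENNReal.ofReal_mul (by positivity), abs_mul, abs_of_nonneg hsel.1]
  refine ENNReal.ofReal_le_ofReal ((mul_le_of_le_one_right (abs_nonneg _) hsel.2).trans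
    ((abs_integral_covErr_sub_idealError_le hF hf hM hM' (hσ x) (μ x) (m x) (s x) q).trans ?_))
  rw [mul_assoc, div_eq_mul_one_div, mul_comm (_ + _) (1 / σ x)]
  gcongr
  exact hL x

lemma measurableSet_regression_ne {Ω : Type*} [MeasurableSpace Ω] (hμ : Measurable μ)
    (hσ : Measurable σ) {m : Ω → 𝒳 → ℝ} (hm : Measurable m.uncurry) :
    MeasurableSet {p : Ω × (𝒳 × ℝ) | μ p.2.1 + σ p.2.1 * p.2.2 ≠ m p.1 p.2.1} :=
  (measurableSet_eq_fun (by fun_prop) (hm.comp (by fun_prop :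
    Measurable fun p : Ω × (𝒳 × ℝ) => (p.1, p.2.1)))).compl

lemma ae_add_mul_ne {m : 𝒳 → ℝ} {lX : Measure 𝒳} {ν : Measure ℝ} [SFinite ν]
    [NullSingletonClass ν] (hσ : ∀ x, σ x ≠ 0)
    (hset : MeasurableSet {z : 𝒳 × ℝ | μ z.1 + σ z.1 * z.2 ≠ m z.1}) :
    ∀ᵐ z ∂(lX.prod ν), μ z.1 + σ z.1 * z.2 ≠ m z.1 := by
  refine (Measure.ae_prod_iff_ae_ae hset).2 (.of_forall fun x => ?_)
  refine (Measure.ae_ne ν ((m x - μ x) / σ x)).mono fun e he heq => he ?_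
  rw [eq_div_iff (hσ x)]
  linarith

end Population

section Past

variable {Ω 𝒳 : Type*} [MeasurableSpace 𝒳] {n : ℕ} {D₀ : Fin n → Ω → 𝒳 × ℝ} {X : ℕ → Ω → 𝒳}
  {Y : ℕ → Ω → ℝ}

lemma past_mono : Monotone (past D₀ X Y) := fun _ _ hst =>
  sup_le_sup le_rfl (biSup_mono fun _ hk => ⟨hk.1, hk.2.trans hst⟩)

lemma measurable_past_pair (k : ℕ) :
    Measurable[past D₀ X Y (k + 1)] fun ω => (X (k + 1) ω, Y (k + 1) ω) := by
  rw [measurable_iff_comap_le]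
  exact le_sup_of_le_right
    (le_iSup₂_of_le (k + 1) (Set.mem_Icc.2 ⟨Nat.le_add_left 1 k, le_rfl⟩) le_rfl)

lemma measurable_past_covariate (k : ℕ) : Measurable[past D₀ X Y (k + 1)] (X (k + 1)) :=
  measurable_fst.comp (measurable_past_pair k)

lemma measurable_past_response (k : ℕ) : Measurable[past D₀ X Y (k + 1)] (Y (k + 1)) :=
  measurable_snd.comp (measurable_past_pair k)

variable {α β c q₁ : ℝ} {S : 𝒳 → Bool} {μhat σhat : ℕ → Ω → 𝒳 → ℝ} {q : ℕ → Ω → ℝ}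

lemma measurable_past_stepSize (hS : Measurable S) (k : ℕ) :
    Measurable[past D₀ X Y k] (stepSize β c S X k) := by
  have hcount : Measurable[past D₀ X Y k]
      fun ω => ((selectionCount S (fun i => X i ω) k : ℕ) : ℝ) := by
    simp only [selectionCount, Nat.cast_add, Nat.cast_sum]
    refine (Finset.measurable_fun_sum _ fun i hi => ?_).const_add _
    exact (measurable_natCast_toNat hS).comp ((measurable_past_covariate i).mono
      (past_mono (Finset.mem_range.1 hi)) le_rfl)
  exact (hcount.pow_const (-β)).const_mul c

lemma measurable_past_increment (hS : Measurable S)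
    (hμhat : IsPastMeasurable (past D₀ X Y) μhat) (hσhat : IsPastMeasurable (past D₀ X Y) σhat)
    {k : ℕ} (hq : Measurable[past D₀ X Y k] (q (k + 1))) :
    Measurable[past D₀ X Y (k + 1)] (increment α S X Y μhat σhat q k) := by
  have hle : past D₀ X Y k ≤ past D₀ X Y (k + 1) := past_mono k.le_succ
  have hX := measurable_past_covariate (D₀ := D₀) (X := X) (Y := Y) k
  exact ((measurable_react_predInterval (measurable_past_response k)
    (measurable_comp_of_measurable_uncurry hle hX (hμhat (k + 1) (by lia)))
    (measurable_comp_of_measurable_uncurry hle hX (hσhat (k + 1) (by lia)))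
    (hq.mono hle le_rfl)).sub_const α).mul ((measurable_natCast_toNat hS).comp hX)

lemma IsOnlineSCI.measurable_past_threshold (hq : IsOnlineSCI α β c q₁ S X Y μhat σhat q)
    (hS : Measurable S) (hμhat : IsPastMeasurable (past D₀ X Y) μhat)
    (hσhat : IsPastMeasurable (past D₀ X Y) σhat) (k : ℕ) :
    Measurable[past D₀ X Y k] (q (k + 1)) := by
  induction k with
  | zero =>
    rw [show q (0 + 1) = fun _ => q₁ from funext hq.one]
    exact measurable_const
  | succ k ih =>
    rw [funext (hq.succ k)]
    have hle : past D₀ X Y k ≤ past D₀ X Y (k + 1) := past_mono k.le_succ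
    exact (ih.mono hle le_rfl).add (((measurable_past_stepSize hS k).mono hle le_rfl).mul
      (measurable_past_increment hS hμhat hσhat ih))

end Past

lemma indepFun_prodMk_left {Ω A B C : Type*} [MeasurableSpace Ω] [MeasurableSpace A]
    [MeasurableSpace B] [MeasurableSpace C] {P : Measure Ω} [IsProbabilityMeasure P]
    {f : Ω → A} {g : Ω → B} {h : Ω → C} (hf : Measurable f) (hg : Measurable g)
    (hh : Measurable h) (hfgh : IndepFun f (fun ω => (g ω, h ω)) P) (hgh : IndepFun g h P) :
    IndepFun (fun ω => (f ω, g ω)) h P := by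
  have := Measure.isProbabilityMeasure_map hf.aemeasurable (μ := P)
  have := Measure.isProbabilityMeasure_map hg.aemeasurable (μ := P)
  have := Measure.isProbabilityMeasure_map hh.aemeasurable (μ := P)
  have hfg : IndepFun f g P := hfgh.comp measurable_id measurable_fst
  rw [indepFun_iff_map_prod_eq_prod_map_map (by fun_prop) (by fun_prop)] at hfgh hgh hfg ⊢
  rw [hgh] at hfgh
  rw [hfg, ← (measurePreserving_prodAssoc (P.map f) (P.map g) (P.map h)).symm.map_eq, ← hfgh,
    Measure.map_map (by fun_prop) (by fun_prop)]
  rfl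

namespace IsIIDRegression

variable {Ω 𝒳 : Type*} [m₀ : MeasurableSpace Ω] [MeasurableSpace 𝒳] {P : Measure Ω} {n : ℕ}
  {D₀ : Fin n → Ω → 𝒳 × ℝ} {X : ℕ → Ω → 𝒳} {ξ Y : ℕ → Ω → ℝ} {μ σ : 𝒳 → ℝ}

lemma measurable_pair (h : IsIIDRegression P D₀ X ξ Y μ σ) (k : ℕ) :
    Measurable fun ω => (X (k + 1) ω, ξ (k + 1) ω) :=
  (h.measurable_X _ (by lia)).prodMk (h.measurable_noise _ (by lia))

lemma measurable_regression (h : IsIIDRegression P D₀ X ξ Y μ σ) :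
    Measurable fun z : 𝒳 × ℝ => μ z.1 + σ z.1 * z.2 :=
  (h.measurable_mean.comp measurable_fst).add
    ((h.measurable_scale.comp measurable_fst).mul measurable_snd)

lemma response_eq (h : IsIIDRegression P D₀ X ξ Y μ σ) (k : ℕ) (ω : Ω) :
    Y (k + 1) ω = μ (X (k + 1) ω) + σ (X (k + 1) ω) * ξ (k + 1) ω :=
  h.model _ (by lia) ω

lemma past_le_comap (h : IsIIDRegression P D₀ X ξ Y μ σ) (k : ℕ) :
    past D₀ X Y k ≤ MeasurableSpace.comap
      (fun ω => (fun i => D₀ i ω, fun i : Finset.range k => (X (i + 1) ω, ξ (i + 1) ω)))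
      inferInstance := by
  have hdata := comap_measurable (m := inferInstance)
    fun ω => (fun i => D₀ i ω, fun i : Finset.range k => (X (i + 1) ω, ξ (i + 1) ω))
  refine sup_le (iSup_le fun i => ?_) (iSup₂_le fun j hj => ?_)
  · rw [← measurable_iff_comap_le]
    exact ((measurable_pi_apply i).comp measurable_fst).comp hdata
  · obtain ⟨j, rfl⟩ := Nat.exists_eq_add_of_le' hj.1
    have hjk : j ∈ Finset.range k := Finset.mem_range.2 hj.2
    have hpair := ((measurable_pi_apply (⟨j, hjk⟩ : Finset.range k)).comp measurable_snd).comp hdata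
    rw [← measurable_iff_comap_le]
    simp_rw [h.response_eq]
    exact (measurable_fst.prodMk h.measurable_regression).comp hpair

lemma past_le (h : IsIIDRegression P D₀ X ξ Y μ σ) (k : ℕ) : past D₀ X Y k ≤ m₀ :=
  (h.past_le_comap k).trans ((measurable_pi_lambda _ h.measurable_holdout).prodMk
    (measurable_pi_lambda _ fun i : Finset.range k => h.measurable_pair i)).comap_le

/-- The filtration `ℱ_t` generated by the holdout sample and the observations. -/
def pastFiltration (h : IsIIDRegression P D₀ X ξ Y μ σ) : Filtration ℕ m₀ :=
  ⟨past D₀ X Y, past_mono, h.past_le⟩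

theorem indep_past [IsProbabilityMeasure P] (h : IsIIDRegression P D₀ X ξ Y μ σ) (k : ℕ) :
    Indep (past D₀ X Y k)
      (MeasurableSpace.comap (fun ω => (X (k + 1) ω, ξ (k + 1) ω)) inferInstance) P := by
  have hfirst : IndepFun (fun ω (i : Finset.range k) => (X (i + 1) ω, ξ (i + 1) ω))
      (fun ω => (X (k + 1) ω, ξ (k + 1) ω)) P :=
    (h.indep.indepFun_finset (Finset.range k) {k} (by simp) h.measurable_pair).comp
      measurable_id (measurable_pi_apply (⟨k, Finset.mem_singleton_self k⟩ : ({k} : Finset ℕ)))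
  have hholdout : IndepFun (fun ω i => D₀ i ω)
      (fun ω => ((fun i : Finset.range k => (X (i + 1) ω, ξ (i + 1) ω)),
        (X (k + 1) ω, ξ (k + 1) ω))) P :=
    h.indep_holdout.comp (φ := id)
      (ψ := fun g : ℕ → 𝒳 × ℝ => ((fun i : Finset.range k => g i), g k)) measurable_id
      (by fun_prop)
  have hdata := indepFun_prodMk_left (measurable_pi_lambda _ h.measurable_holdout)
    (measurable_pi_lambda _ fun i : Finset.range k => h.measurable_pair i) (h.measurable_pair k)
    hholdout hfirst
  exact indep_of_indep_of_le_left ((IndepFun_iff_Indep _ _ _).1 hdata) (h.past_le_comap k)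

lemma map_pair [IsProbabilityMeasure P] (h : IsIIDRegression P D₀ X ξ Y μ σ) (k : ℕ) :
    P.map (fun ω => (X (k + 1) ω, ξ (k + 1) ω)) = (P.map (X 1)).prod (P.map (ξ 1)) := by
  rw [(h.identDistrib k).map_eq]
  exact (indepFun_iff_map_prod_eq_prod_map_map (h.measurable_X 1 le_rfl).aemeasurable
    (h.measurable_noise 1 le_rfl).aemeasurable).1 h.indep_noise

end IsIIDRegression

/-- Distribution `ν` with a symmetric continuous Lebesgue density `f`, positive on an interval and
zero outside it, such that `f` and `x ↦ |x| f x` are bounded. -/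
structure IsSymmetricNoise (ν : Measure ℝ) (f : ℝ → ℝ) : Prop where
  density_nonneg : ∀ x, 0 ≤ f x
  density : ν = volume.withDensity fun x => ENNReal.ofReal (f x)
  symmetric : Function.Even f
  continuous : Continuous f
  support_interval : {x | 0 < f x}.OrdConnected
  bounded : BddAbove (Set.range f)
  bounded_mul : BddAbove (Set.range fun x => |x| * f x)

lemma IsSymmetricNoise.hasDerivAt_cdf {ν : Measure ℝ} [IsProbabilityMeasure ν] {f : ℝ → ℝ}
    (h : IsSymmetricNoise ν f) (x : ℝ) : HasDerivAt (cdf ν) (f x) x :=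
  OnlineSCI.hasDerivAt_cdf h.density h.density_nonneg h.continuous x

lemma IsSymmetricNoise.nullSingletonClass {ν : Measure ℝ} {f : ℝ → ℝ} (h : IsSymmetricNoise ν f) :
    NullSingletonClass ν :=
  h.density ▸ inferInstance

/-- The conditional mean, given the past, of the increment at time `k + 1`. -/
noncomputable def drift {Ω 𝒳 : Type*} [MeasurableSpace Ω] [MeasurableSpace 𝒳] (P : Measure Ω)
    (X : ℕ → Ω → 𝒳) (ξ : ℕ → Ω → ℝ) (μ σ : 𝒳 → ℝ) (α : ℝ) (S : 𝒳 → Bool)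
    (μhat σhat : ℕ → Ω → 𝒳 → ℝ) (q : ℕ → Ω → ℝ) (k : ℕ) (ω : Ω) : ℝ :=
  meanSelectedError (P.map (X 1)) (P.map (ξ 1)) S μ σ (μhat (k + 1) ω) (σhat (k + 1) ω)
    (q (k + 1) ω) - α * P.real {ω | S (X 1 ω) = true}

namespace IsIIDRegression

variable {Ω 𝒳 : Type*} [m₀ : MeasurableSpace Ω] [MeasurableSpace 𝒳] {P : Measure Ω}
  {n : ℕ} {D₀ : Fin n → Ω → 𝒳 × ℝ} {X : ℕ → Ω → 𝒳} {ξ Y : ℕ → Ω → ℝ} {μ σ : 𝒳 → ℝ}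
  {α β c : ℝ} {S : 𝒳 → Bool} {μhat σhat : ℕ → Ω → 𝒳 → ℝ} {q : ℕ → Ω → ℝ} {k : ℕ}

lemma measurable_uncurry_selectedError (h : IsIIDRegression P D₀ X ξ Y μ σ) (hS : Measurable S)
    (hμhat : IsPastMeasurable (past D₀ X Y) μhat) (hσhat : IsPastMeasurable (past D₀ X Y) σhat)
    (hq : Measurable[past D₀ X Y k] (q (k + 1))) :
    Measurable[(past D₀ X Y k).prod inferInstance]
      (fun ω => selectedError S μ σ (μhat (k + 1) ω) (σhat (k + 1) ω) (q (k + 1) ω)).uncurry :=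
  @OnlineSCI.measurable_uncurry_selectedError 𝒳 _ S μ σ Ω (past D₀ X Y k) _ _ _ hS
    h.measurable_mean h.measurable_scale (hμhat (k + 1) (by lia)) (hσhat (k + 1) (by lia)) hq

lemma measurable_selectedError (h : IsIIDRegression P D₀ X ξ Y μ σ) (hS : Measurable S)
    (hμhat : IsPastMeasurable (past D₀ X Y) μhat) (hσhat : IsPastMeasurable (past D₀ X Y) σhat)
    (hq : Measurable[past D₀ X Y k] (q (k + 1))) (ω : Ω) :
    Measurable (selectedError S μ σ (μhat (k + 1) ω) (σhat (k + 1) ω) (q (k + 1) ω)) :=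
  (h.measurable_uncurry_selectedError hS hμhat hσhat hq).comp measurable_prodMk_left

lemma integral_toNat_map_covariate (h : IsIIDRegression P D₀ X ξ Y μ σ) (hS : Measurable S) :
    ∫ x, ((S x).toNat : ℝ) ∂(P.map (X 1)) = P.real {ω | S (X 1 ω) = true} := by
  have hX := h.measurable_X 1 le_rfl
  have hset : MeasurableSet {ω | S (X 1 ω) = true} := (hS.comp hX) (measurableSet_singleton true)
  rw [integral_map hX.aemeasurable (measurable_natCast_toNat hS).aestronglyMeasurable,
    ← integral_indicator_one hset]
  congr with ω
  cases hω : S (X 1 ω) <;> simp [hω]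

lemma integral_toNat_covariate (h : IsIIDRegression P D₀ X ξ Y μ σ) (hS : Measurable S) (k : ℕ) :
    ∫ ω, ((S (X (k + 1) ω)).toNat : ℝ) ∂P = P.real {ω | S (X 1 ω) = true} := by
  rw [← h.integral_toNat_map_covariate hS, integral_map (h.measurable_X 1 le_rfl).aemeasurable
    (measurable_natCast_toNat hS).aestronglyMeasurable]
  exact ((h.identDistrib k).comp
    ((measurable_natCast_toNat hS).comp measurable_fst)).integral_eq

variable [IsProbabilityMeasure P]

lemma ae_response_ne [NullSingletonClass (P.map (ξ 1))]
    (h : IsIIDRegression P D₀ X ξ Y μ σ) {m : Ω → 𝒳 → ℝ}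
    (hm : Measurable[(past D₀ X Y k).prod inferInstance] m.uncurry) :
    ∀ᵐ ω ∂P, Y (k + 1) ω ≠ m ω (X (k + 1) ω) := by
  have hset := @measurableSet_regression_ne 𝒳 _ μ σ Ω (past D₀ X Y k) h.measurable_mean
    h.measurable_scale m hm
  simp_rw [h.response_eq]
  refine ae_comp_of_indep (h.past_le k) (h.measurable_pair k) (h.indep_past k)
    (p := fun ω z => μ z.1 + σ z.1 * z.2 ≠ m ω z.1) hset fun ω => ?_
  rw [h.map_pair k]
  exact ae_add_mul_ne (fun x => (h.scale_pos x).ne') (hset.preimage measurable_prodMk_left)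

lemma condExp_selectedError (h : IsIIDRegression P D₀ X ξ Y μ σ) (hS : Measurable S)
    (hμhat : IsPastMeasurable (past D₀ X Y) μhat) (hσhat : IsPastMeasurable (past D₀ X Y) σhat)
    (hq : Measurable[past D₀ X Y k] (q (k + 1))) :
    P[fun ω => covErr (Y (k + 1) ω) (predictionSet X μhat σhat q (k + 1) ω) *
        ((S (X (k + 1) ω)).toNat : ℝ) | past D₀ X Y k] =ᵐ[P]
      fun ω => meanSelectedError (P.map (X 1)) (P.map (ξ 1)) S μ σ (μhat (k + 1) ω)
        (σhat (k + 1) ω) (q (k + 1) ω) := by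
  simp_rw [h.response_eq, meanSelectedError, ← h.map_pair k]
  exact condExp_comp_of_indep (h.past_le k) (h.measurable_pair k) (h.indep_past k)
    (h.measurable_uncurry_selectedError hS hμhat hσhat hq)
    fun ω => selectedError_mem_Icc S μ σ _ _ _

lemma condExp_selection (h : IsIIDRegression P D₀ X ξ Y μ σ) (hS : Measurable S) (k : ℕ) :
    P[fun ω => ((S (X (k + 1) ω)).toNat : ℝ) | past D₀ X Y k] =ᵐ[P]
      fun _ => P.real {ω | S (X 1 ω) = true} := by
  rw [← h.integral_toNat_covariate hS k]
  have hcond := condExp_indep_eq (h.measurable_pair k).comap_le (h.past_le k)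
    (((measurable_natCast_toNat hS).comp measurable_fst).comp
      (comap_measurable fun ω => (X (k + 1) ω, ξ (k + 1) ω))).stronglyMeasurable
    (h.indep_past k).symm
  exact hcond

lemma integrable_toNat_covariate (h : IsIIDRegression P D₀ X ξ Y μ σ) (hS : Measurable S)
    (k : ℕ) : Integrable (fun ω => ((S (X (k + 1) ω)).toNat : ℝ)) P :=
  .of_mem_Icc 0 1 ((measurable_natCast_toNat hS).comp (h.measurable_X _ (by lia))).aemeasurable
    (.of_forall fun _ => natCast_toNat_mem_Icc _)

lemma integrable_covErr_mul_toNat (h : IsIIDRegression P D₀ X ξ Y μ σ) (hS : Measurable S)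
    (hμhat : IsPastMeasurable (past D₀ X Y) μhat) (hσhat : IsPastMeasurable (past D₀ X Y) σhat)
    (hq : Measurable[past D₀ X Y k] (q (k + 1))) :
    Integrable (fun ω => covErr (Y (k + 1) ω) (predictionSet X μhat σhat q (k + 1) ω) *
      ((S (X (k + 1) ω)).toNat : ℝ)) P := by
  simp_rw [h.response_eq]
  exact .of_mem_Icc 0 1 (measurable_comp_of_measurable_uncurry (h.past_le k) (h.measurable_pair k)
    (h.measurable_uncurry_selectedError hS hμhat hσhat hq)).aemeasurable
    (.of_forall fun ω => selectedError_mem_Icc S μ σ (μhat (k + 1) ω) (σhat (k + 1) ω)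
      (q (k + 1) ω) (X (k + 1) ω, ξ (k + 1) ω))

lemma condExp_increment [NullSingletonClass (P.map (ξ 1))] (h : IsIIDRegression P D₀ X ξ Y μ σ)
    (hS : Measurable S) (hμhat : IsPastMeasurable (past D₀ X Y) μhat)
    (hσhat : IsPastMeasurable (past D₀ X Y) σhat) (hq : Measurable[past D₀ X Y k] (q (k + 1))) :
    P[increment α S X Y μhat σhat q k | past D₀ X Y k] =ᵐ[P]
      drift P X ξ μ σ α S μhat σhat q k := by
  have hincrement : increment α S X Y μhat σhat q k =ᵐ[P]
      (fun ω => covErr (Y (k + 1) ω) (predictionSet X μhat σhat q (k + 1) ω) *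
        ((S (X (k + 1) ω)).toNat : ℝ)) - fun ω => α * ((S (X (k + 1) ω)).toNat : ℝ) := by
    filter_upwards [h.ae_response_ne (k := k) (hμhat (k + 1) (by lia))] with ω hne
    rw [increment, predictionSet, react_predInterval_of_ne hne, Pi.sub_apply, sub_mul]
    rfl
  filter_upwards [condExp_congr_ae (m := past D₀ X Y k) hincrement,
    condExp_sub (h.integrable_covErr_mul_toNat hS hμhat hσhat hq)
      ((h.integrable_toNat_covariate hS k).const_mul α) (past D₀ X Y k),
    condExp_smul α (fun ω => ((S (X (k + 1) ω)).toNat : ℝ)) (past D₀ X Y k),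
    h.condExp_selectedError hS hμhat hσhat hq, h.condExp_selection hS k]
    with ω hcongr hsub hconst herr hsel
  rw [hcongr, hsub, Pi.sub_apply, herr, drift, ← hsel]
  exact congrArg _ hconst

lemma instErrorRate_sub (h : IsIIDRegression P D₀ X ξ Y μ σ)
    (hS : Measurable S) (hr : 0 < P.real {ω | S (X 1 ω) = true})
    (hμhat : IsPastMeasurable (past D₀ X Y) μhat)
    (hσhat : IsPastMeasurable (past D₀ X Y) σhat) (hq : Measurable[past D₀ X Y k] (q (k + 1))) :
    (fun ω => instErrorRate P (past D₀ X Y k) (fun ω => S (X (k + 1) ω))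
        (fun ω => covErr (Y (k + 1) ω) (predictionSet X μhat σhat q (k + 1) ω)) ω - α) =ᵐ[P]
      fun ω => drift P X ξ μ σ α S μhat σhat q k ω / P.real {ω | S (X 1 ω) = true} := by
  filter_upwards [h.condExp_selectedError hS hμhat hσhat hq, h.condExp_selection hS k]
    with ω herr hsel
  rw [instErrorRate, herr, hsel, drift, sub_div, mul_div_cancel_right₀ _ hr.ne']

theorem measureReal_le_sum_sub_toNat_le (h : IsIIDRegression P D₀ X ξ Y μ σ) (hS : Measurable S)
    (k : ℕ) {ε : ℝ} (hε : 0 ≤ ε) :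
    P.real {ω | ε ≤ ∑ i ∈ Finset.range k,
      (P.real {ω | S (X 1 ω) = true} - ((S (X (i + 1) ω)).toNat : ℝ))} ≤
      Real.exp (-(2 * ε ^ 2) / k) := by
  have hindep : iIndepFun (fun i ω => P.real {ω | S (X 1 ω) = true} -
      ((S (X (i + 1) ω)).toNat : ℝ)) P :=
    h.indep.comp (fun _ z => P.real {ω | S (X 1 ω) = true} - ((S z.1).toNat : ℝ))
      fun _ => ((measurable_natCast_toNat hS).comp measurable_fst).const_sub _
  have hsub (i : ℕ) : HasSubgaussianMGF (fun ω => P.real {ω | S (X 1 ω) = true} -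
      ((S (X (i + 1) ω)).toNat : ℝ)) ((‖(1 : ℝ) - 0‖₊ / 2) ^ 2) P := by
    have hmgf := (hasSubgaussianMGF_of_mem_Icc (μ := P) (a := 0) (b := 1)
      ((measurable_natCast_toNat hS).comp (h.measurable_X (i + 1) (by lia))).aemeasurable
      (.of_forall fun ω => natCast_toNat_mem_Icc (S (X (i + 1) ω)))).neg
    simp only [Function.comp_apply, h.integral_toNat_covariate hS i] at hmgf
    exact hmgf.congr (.of_forall fun ω => neg_sub _ _)
  refine (HasSubgaussianMGF.measure_sum_range_ge_le_of_iIndepFun hindep (fun i _ => hsub i)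
    hε).trans_eq ?_
  congr 1
  norm_num
  ring

theorem eventually_stepSize_tail (h : IsIIDRegression P D₀ X ξ Y μ σ) (hS : Measurable S)
    (hβ : 0 ≤ β) (hc : 0 ≤ c) (hr : 0 < P.real {ω | S (X 1 ω) = true}) :
    ∀ᶠ k : ℕ in atTop, P.real {ω | c * (P.real {ω | S (X 1 ω) = true} / 2) ^ (-β) *
      ((k : ℝ) + 1) ^ (-β) < stepSize β c S X k ω} ≤ 1 / ((k : ℝ) + 1) ^ 3 := by
  have hr1 : P.real {ω | S (X 1 ω) = true} ≤ 1 := measureReal_le_one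
  have htail := fun k ε => h.measureReal_le_sum_sub_toNat_le hS k (ε := ε)
  set r := P.real {ω | S (X 1 ω) = true}
  filter_upwards [eventually_ge_atTop 1,
    eventually_exp_neg_rpow_le one_pos (by positivity : 0 < r ^ 2 / 2) 3] with k hk hexp
  have hk₀ : (0 : ℝ) < k := by exact_mod_cast hk
  have hfew : {ω | c * (r / 2) ^ (-β) * ((k : ℝ) + 1) ^ (-β) < stepSize β c S X k ω} ⊆
      {ω | r / 2 * ((k : ℝ) + 1) ≤
        ∑ i ∈ Finset.range k, (r - ((S (X (i + 1) ω)).toNat : ℝ))} := by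
    intro ω hω
    by_contra! hmany
    rw [Set.notMem_ofPred_iff, not_le, Finset.sum_sub_distrib, Finset.sum_const, Finset.card_range,
      nsmul_eq_mul] at hmany
    have hcount : r / 2 * ((k : ℝ) + 1) ≤ selectionCount S (fun i => X i ω) k := by
      rw [selectionCount]
      push_cast
      linarith
    refine (Set.mem_ofPred.1 hω).not_ge ?_
    rw [mul_assoc, ← Real.mul_rpow (by positivity) (by positivity)]
    exact mul_le_mul_of_nonneg_left
      (Real.rpow_le_rpow_of_nonpos (by positivity) hcount (neg_nonpos.2 hβ)) hc
  calc P.real {ω | c * (r / 2) ^ (-β) * ((k : ℝ) + 1) ^ (-β) < stepSize β c S X k ω}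
      ≤ Real.exp (-(2 * (r / 2 * ((k : ℝ) + 1)) ^ 2) / k) :=
        (measureReal_mono hfew).trans (htail k _ (by positivity))
    _ ≤ Real.exp (-(r ^ 2 / 2) * ((k : ℝ) + 1) ^ (1 : ℝ)) := by
        rw [Real.exp_le_exp, Real.rpow_one, div_le_iff₀ hk₀]
        nlinarith [mul_pos (pow_pos hr 2) (by positivity : 0 < (k : ℝ) + 1)]
    _ ≤ ((k : ℝ) + 1) ^ (-3 : ℝ) := hexp
    _ = 1 / ((k : ℝ) + 1) ^ 3 := by
        rw [Real.rpow_neg (by positivity), one_div]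
        exact_mod_cast rfl

end IsIIDRegression

/-! ### The threshold as a Robbins–Monro recursion -/

/-- The mean field of the centred threshold `x = q - q⁰_α`, for a selection probability `r`: up to
the sign, the mean increment of the threshold when the regression is known. -/
noncomputable def meanField (ν : Measure ℝ) (α r x : ℝ) : ℝ :=
  r * (α - idealError ν (targetThreshold ν α + x))

lemma exists_slope_of_bounds {κ K x y : ℝ} (hlower : κ * x ^ 2 ≤ x * y) (hupper : |y| ≤ K * |x|) :
    ∃ s ∈ Set.Icc κ (max κ K), y = s * x := by
  rcases eq_or_ne x 0 with rfl | hx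
  · exact ⟨κ, ⟨le_rfl, le_max_left _ _⟩, by simpa using hupper⟩
  refine ⟨y / x, ⟨?_, le_max_of_le_right ?_⟩, (div_mul_cancel₀ y hx).symm⟩
  · refine le_of_mul_le_mul_right (hlower.trans_eq ?_) (sq_pos_of_ne_zero hx)
    field_simp
  · exact (le_abs_self _).trans (by rwa [abs_div, div_le_iff₀ (abs_pos.2 hx)])

lemma exists_slope_meanField {ν : Measure ℝ} [IsProbabilityMeasure ν] {f : ℝ → ℝ}
    (h : IsSymmetricNoise ν f) {α r B : ℝ} (hα : α ∈ Set.Ioo (0 : ℝ) 1) (hr : 0 < r) (hB : 0 < B) :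
    ∃ κ K, 0 < κ ∧ ∀ x, |x| ≤ B → ∃ s ∈ Set.Icc κ K, meanField ν α r x = s * x := by
  obtain ⟨κ, K, hκ, -, hslope⟩ := exists_slope_bounds_idealError h.hasDerivAt_cdf h.symmetric
    h.support_interval hα hB
  refine ⟨r * κ, max (r * κ) (r * K), mul_pos hr hκ, fun x hx => exists_slope_of_bounds ?_ ?_⟩
  · have hlower := (hslope (targetThreshold ν α + x) (by simpa using hx)).1
    rw [add_sub_cancel_left] at hlower
    calc r * κ * x ^ 2 = r * (κ * x ^ 2) := mul_assoc _ _ _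
      _ ≤ r * (x * (α - idealError ν (targetThreshold ν α + x))) := by gcongr
      _ = x * meanField ν α r x := mul_left_comm _ _ _
  · have hupper := (hslope (targetThreshold ν α + x) (by simpa using hx)).2
    rw [add_sub_cancel_left, abs_sub_comm] at hupper
    rw [meanField, abs_mul, abs_of_pos hr, mul_assoc]
    gcongr

lemma measurable_meanField {ν : Measure ℝ} [IsProbabilityMeasure ν] {f : ℝ → ℝ}
    (h : IsSymmetricNoise ν f) (α r : ℝ) : Measurable (meanField ν α r) :=
  (((antitone_idealError h.hasDerivAt_cdf h.symmetric).measurable.comp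
    (measurable_const_add _)).const_sub α).const_mul r

lemma measurable_meanSelectedError {Ω 𝒳 : Type*} [MeasurableSpace Ω] [MeasurableSpace 𝒳]
    {lX : Measure 𝒳} [SFinite lX] {ν : Measure ℝ} [SFinite ν] {S : 𝒳 → Bool} {μ σ : 𝒳 → ℝ}
    {m s : Ω → 𝒳 → ℝ} {q : Ω → ℝ}
    (hE : Measurable (fun ω => selectedError S μ σ (m ω) (s ω) (q ω)).uncurry) :
    Measurable fun ω => meanSelectedError lX ν S μ σ (m ω) (s ω) (q ω) :=
  hE.stronglyMeasurable.integral_prod_right'.measurable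

namespace IsIIDRegression

variable {Ω 𝒳 : Type*} [m₀ : MeasurableSpace Ω] [MeasurableSpace 𝒳] {P : Measure Ω}
  [IsProbabilityMeasure P] {n : ℕ} {D₀ : Fin n → Ω → 𝒳 × ℝ} {X : ℕ → Ω → 𝒳} {ξ Y : ℕ → Ω → ℝ}
  {μ σ : 𝒳 → ℝ} {f : ℝ → ℝ} {α β c q₁ : ℝ} {S : 𝒳 → Bool} {μhat σhat : ℕ → Ω → 𝒳 → ℝ}
  {q : ℕ → Ω → ℝ} {k : ℕ}

lemma isProbabilityMeasure_map_covariate (h : IsIIDRegression P D₀ X ξ Y μ σ) :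
    IsProbabilityMeasure (P.map (X 1)) :=
  Measure.isProbabilityMeasure_map (h.measurable_X 1 le_rfl).aemeasurable

lemma isProbabilityMeasure_map_noise (h : IsIIDRegression P D₀ X ξ Y μ σ) :
    IsProbabilityMeasure (P.map (ξ 1)) :=
  Measure.isProbabilityMeasure_map (h.measurable_noise 1 le_rfl).aemeasurable

lemma measurable_drift (h : IsIIDRegression P D₀ X ξ Y μ σ) (hS : Measurable S)
    (hμhat : IsPastMeasurable (past D₀ X Y) μhat) (hσhat : IsPastMeasurable (past D₀ X Y) σhat)
    (hq : Measurable[past D₀ X Y k] (q (k + 1))) :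
    Measurable[past D₀ X Y k] (drift P X ξ μ σ α S μhat σhat q k) :=
  (@measurable_meanSelectedError Ω 𝒳 (past D₀ X Y k) _ _ _ _ _ _ _ _ _ _ _
    (h.measurable_uncurry_selectedError hS hμhat hσhat hq)).sub_const _

lemma abs_drift_le_one (h : IsIIDRegression P D₀ X ξ Y μ σ) (hS : Measurable S)
    (hα : α ∈ Set.Icc (0 : ℝ) 1) (hμhat : IsPastMeasurable (past D₀ X Y) μhat)
    (hσhat : IsPastMeasurable (past D₀ X Y) σhat) (hq : Measurable[past D₀ X Y k] (q (k + 1)))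
    (ω : Ω) : |drift P X ξ μ σ α S μhat σhat q k ω| ≤ 1 := by
  have := h.isProbabilityMeasure_map_covariate
  have := h.isProbabilityMeasure_map_noise
  have herr := meanSelectedError_mem_Icc (lX := P.map (X 1)) (ν := P.map (ξ 1))
    (h.measurable_selectedError hS hμhat hσhat hq ω)
  have hsel₀ := mul_nonneg hα.1 (measureReal_nonneg (μ := P) (s := {ω | S (X 1 ω) = true}))
  have hsel₁ := mul_le_one₀ hα.2 measureReal_nonneg
    (measureReal_le_one (μ := P) (s := {ω | S (X 1 ω) = true}))
  exact abs_le.2 ⟨by rw [drift]; linarith [herr.1], by rw [drift]; linarith [herr.2]⟩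

theorem exists_isRobbinsMonro (h : IsIIDRegression P D₀ X ξ Y μ σ)
    (hnoise : IsSymmetricNoise (P.map (ξ 1)) f) (hq : IsOnlineSCI α β c q₁ S X Y μhat σhat q)
    (hS : Measurable S) (hr : 0 < P.real {ω | S (X 1 ω) = true})
    (hμhat : IsPastMeasurable (past D₀ X Y) μhat) (hσhat : IsPastMeasurable (past D₀ X Y) σhat)
    (hα : α ∈ Set.Ioo (0 : ℝ) 1) (hβ : β ∈ Set.Ioo (0 : ℝ) 1) (hc : 0 < c) :
    ∃ B κ K, IsRobbinsMonro P h.pastFiltration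
      (fun k ω => q (k + 1) ω - targetThreshold (P.map (ξ 1)) α) (stepSize β c S X)
      (increment α S X Y μhat σhat q) (drift P X ξ μ σ α S μhat σhat q)
      (meanField (P.map (ξ 1)) α (P.real {ω | S (X 1 ω) = true})) β B κ K c c := by
  have := h.isProbabilityMeasure_map_noise
  have := hnoise.nullSingletonClass
  have hα' := Set.Ioo_subset_Icc_self hα
  have hqm := hq.measurable_past_threshold hS hμhat hσhat
  obtain ⟨κ, K, hκ, hslope⟩ := exists_slope_meanField hnoise hα hr
    (by positivity : 0 < 1 + c + |q₁| + |targetThreshold (P.map (ξ 1)) α|)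
  exact ⟨1 + c + |q₁| + |targetThreshold (P.map (ξ 1)) α|, κ, K, {
    measurable_state := fun k => (hqm k).sub_const _
    measurable_step := measurable_past_stepSize hS
    measurable_drift := fun k => h.measurable_drift hS hμhat hσhat (hqm k)
    measurable_increment := fun k => measurable_past_increment hS hμhat hσhat (hqm k)
    measurable_field := measurable_meanField hnoise _ _
    recursion := fun k ω => by rw [hq.succ, add_sub_right_comm]
    condExp_increment := fun k => h.condExp_increment hS hμhat hσhat (hqm k)
    abs_state_le := fun k ω =>
      (abs_sub _ _).trans (add_le_add_left (hq.abs_threshold_le hα' hβ.1.le hc.le k ω) _)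
    abs_increment_le := abs_increment_le_one hα'
    abs_drift_le := fun k => h.abs_drift_le_one hS hα' hμhat hσhat (hqm k)
    le_step := le_stepSize hβ.1.le hc.le
    step_le := stepSize_le hβ.1.le hc.le
    exists_slope := hslope
    slope_pos := hκ
    lo_pos := hc
    exponent_mem := hβ }⟩

theorem exists_enorm_bias_le (h : IsIIDRegression P D₀ X ξ Y μ σ)
    (hnoise : IsSymmetricNoise (P.map (ξ 1)) f) (hσ : BddAbove (Set.range fun x => 1 / σ x))
    (hq : ∀ k, Measurable[past D₀ X Y k] (q (k + 1)))
    (hS : Measurable S) (hμhat : IsPastMeasurable (past D₀ X Y) μhat)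
    (hσhat : IsPastMeasurable (past D₀ X Y) σhat) (α : ℝ) :
    ∃ C > 0, ∀ k ω, ‖drift P X ξ μ σ α S μhat σhat q k ω +
        meanField (P.map (ξ 1)) α (P.real {ω | S (X 1 ω) = true})
          (q (k + 1) ω - targetThreshold (P.map (ξ 1)) α)‖ₑ ≤
      ENNReal.ofReal C * estimationError (P.map (X 1)) μ σ (μhat (k + 1) ω) (σhat (k + 1) ω) := by
  have := h.isProbabilityMeasure_map_covariate
  have := h.isProbabilityMeasure_map_noise
  have := hnoise.nullSingletonClass
  obtain ⟨M, hM⟩ := hnoise.bounded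
  obtain ⟨M', hM'⟩ := hnoise.bounded_mul
  obtain ⟨L, hL⟩ := hσ
  rw [mem_upperBounds, Set.forall_mem_range] at hM hM' hL
  refine ⟨max 1 ((2 * M + 4 * M' + 4) * L), by positivity, fun k ω => ?_⟩
  have hbound := enorm_meanSelectedError_sub_le (lX := P.map (X 1)) hnoise.hasDerivAt_cdf
    hnoise.symmetric hM hM' h.scale_pos hL hS (h.measurable_selectedError hS hμhat hσhat (hq k) ω)
  rw [h.integral_toNat_map_covariate hS] at hbound
  rw [drift, meanField, add_sub_cancel, mul_sub, mul_comm α, sub_add_sub_cancel]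
  exact hbound.trans (by gcongr; exact le_max_right _ _)

end IsIIDRegression

/-! ### Rates of estimation -/

/-- The rate `(log t) ^ a * t ^ (-s)`. -/
noncomputable def logRate (a s t : ℝ) : ℝ :=
  Real.log t ^ a * t ^ (-s)

section LogRate

variable {a s β : ℝ}

lemma one_le_natCast_add_one (k : ℕ) : (1 : ℝ) ≤ k + 1 :=
  le_add_of_nonneg_left k.cast_nonneg

lemma logRate_zero_left (s t : ℝ) : logRate 0 s t = t ^ (-s) := by
  rw [logRate, Real.rpow_zero, one_mul]

lemma logRate_nonneg {t : ℝ} (ht : 1 ≤ t) (a s : ℝ) : 0 ≤ logRate a s t :=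
  mul_nonneg (Real.rpow_nonneg (Real.log_nonneg ht) a)
    (Real.rpow_nonneg (zero_le_one.trans ht) _)

lemma logRate_natCast_nonneg (t : ℕ) (a s : ℝ) : 0 ≤ logRate a s t :=
  mul_nonneg (Real.rpow_nonneg (Real.log_natCast_nonneg t) a) (by positivity)

lemma log_rpow_le_of_le (ha : 0 ≤ a) {t u : ℝ} (ht : 1 ≤ t) (htu : t ≤ u) :
    Real.log t ^ a ≤ Real.log u ^ a :=
  Real.rpow_le_rpow (Real.log_nonneg ht) (Real.log_le_log (zero_lt_one.trans_le ht) htu) ha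

lemma logRate_le_of_half_le (ha : 0 ≤ a) (hs : 0 ≤ s) {k j : ℕ} (hj : k / 2 ≤ j) (hjk : j ≤ k) :
    logRate a s (j + 1) ≤ 2 ^ s * logRate a s (k + 1) := by
  have hpow : ((j : ℝ) + 1) ^ (-s) ≤ 2 ^ s * ((k : ℝ) + 1) ^ (-s) :=
    calc ((j : ℝ) + 1) ^ (-s) ≤ (((k : ℝ) + 1) / 2) ^ (-s) :=
          Real.rpow_le_rpow_of_nonpos (by positivity)
            (by linarith [natCast_add_one_le_two_mul hj]) (neg_nonpos.2 hs)
      _ = 2 ^ s * ((k : ℝ) + 1) ^ (-s) := by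
          rw [Real.div_rpow (by positivity) zero_le_two, Real.rpow_neg zero_le_two, div_inv_eq_mul,
            mul_comm]
  calc logRate a s (j + 1)
      ≤ Real.log ((k : ℝ) + 1) ^ a * (2 ^ s * ((k : ℝ) + 1) ^ (-s)) :=
        mul_le_mul (log_rpow_le_of_le ha (one_le_natCast_add_one j) (by gcongr)) hpow
          (by positivity) (Real.rpow_nonneg (Real.log_nonneg (one_le_natCast_add_one k)) a)
    _ = 2 ^ s * logRate a s (k + 1) := mul_left_comm _ _ _

lemma one_sub_div_mul_rpow_neg_le (hs : 0 ≤ s) {t : ℝ} (ht : 0 < t) :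
    (1 - s / t) * t ^ (-s) ≤ (t + 1) ^ (-s) := by
  have hbase : t + 1 ≤ t * Real.exp (1 / t) :=
    calc t + 1 = t * (1 / t + 1) := by rw [mul_add, mul_one_div_cancel ht.ne', mul_one, add_comm]
      _ ≤ t * Real.exp (1 / t) := by gcongr; exact Real.add_one_le_exp _
  calc (1 - s / t) * t ^ (-s) ≤ Real.exp (-(s / t)) * t ^ (-s) := by
        gcongr; exact Real.one_sub_le_exp_neg _
    _ = (t * Real.exp (1 / t)) ^ (-s) := by
        rw [Real.mul_rpow ht.le (Real.exp_pos _).le, ← Real.exp_mul, mul_comm, one_div_mul_eq_div,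
          neg_div]
    _ ≤ (t + 1) ^ (-s) :=
        Real.rpow_le_rpow_of_nonpos (by positivity) hbase (neg_nonpos.2 hs)

lemma eventually_mul_logRate_le_succ (hβ : β < 1) (ha : 0 ≤ a) (hs : 0 ≤ s) {b : ℝ} (hb : 0 < b) :
    ∀ᶠ k : ℕ in atTop, (1 - b * ((k : ℝ) + 1) ^ (-β)) * logRate a s (k + 1) ≤
      logRate a s ((k + 1 : ℕ) + 1) := by
  filter_upwards [eventually_mul_rpow_neg_le_one (sub_pos.2 hβ) (s / b)] with k hk
  push_cast
  have ht := one_le_natCast_add_one k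
  set t := (k : ℝ) + 1
  have ht₀ : 0 < t := zero_lt_one.trans_le ht
  have hsmall : s / t ≤ b * t ^ (-β) :=
    calc s / t = b * t ^ (-β) * (s / b * t ^ (-(1 - β))) := by
          rw [neg_sub, Real.rpow_sub ht₀, Real.rpow_neg ht₀.le, Real.rpow_one]
          field_simp
      _ ≤ b * t ^ (-β) := mul_le_of_le_one_right (by positivity) hk
  calc (1 - b * t ^ (-β)) * logRate a s t ≤ (1 - s / t) * logRate a s t :=
        mul_le_mul_of_nonneg_right (by linarith) (logRate_nonneg ht a s)
    _ = Real.log t ^ a * ((1 - s / t) * t ^ (-s)) := mul_left_comm _ _ _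
    _ ≤ Real.log t ^ a * (t + 1) ^ (-s) :=
        mul_le_mul_of_nonneg_left (one_sub_div_mul_rpow_neg_le hs ht₀)
          (Real.rpow_nonneg (Real.log_nonneg ht) a)
    _ ≤ logRate a s (t + 1) :=
        mul_le_mul_of_nonneg_right (log_rpow_le_of_le ha ht (by linarith)) (by positivity)

end LogRate

lemma sq_lintegral_le_lintegral_sq {Ω : Type*} [MeasurableSpace Ω] {P : Measure Ω}
    [IsProbabilityMeasure P] {g : Ω → ENNReal} (hg : AEMeasurable g P) :
    (∫⁻ ω, g ω ∂P) ^ 2 ≤ ∫⁻ ω, g ω ^ 2 ∂P := by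
  have hnorm := eLpNorm'_le_eLpNorm'_of_exponent_le zero_lt_one one_le_two P
    hg.aestronglyMeasurable
  simp only [eLpNorm', enorm_eq_self, ENNReal.rpow_one, div_one, ENNReal.rpow_two] at hnorm
  rwa [one_div, ENNReal.le_rpow_inv_iff two_pos, ENNReal.rpow_two] at hnorm

lemma sq_integral_le_integral_sq {Ω : Type*} [MeasurableSpace Ω] {P : Measure Ω}
    [IsProbabilityMeasure P] {g : Ω → ℝ} (hg : MemLp g 2 P) :
    (∫ ω, g ω ∂P) ^ 2 ≤ ∫ ω, g ω ^ 2 ∂P :=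
  sub_nonneg.1 ((variance_nonneg g P).trans_eq (variance_eq_sub hg))

lemma ofReal_abs_add_abs_sq_le (x y : ℝ) : ENNReal.ofReal (|x| + |y|) ^ 2 ≤
    2 * (ENNReal.ofReal (x ^ 2) + ENNReal.ofReal (y ^ 2)) := by
  rw [← ENNReal.ofReal_pow (by positivity), ← ENNReal.ofReal_add (sq_nonneg x) (sq_nonneg y),
    ← ENNReal.ofReal_ofNat 2, ← ENNReal.ofReal_mul zero_le_two, ← sq_abs x, ← sq_abs y]
  exact ENNReal.ofReal_le_ofReal add_sq_le

lemma measurable_uncurry_absError {Ω 𝒳 : Type*} [MeasurableSpace Ω] [MeasurableSpace 𝒳]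
    {m s : Ω → 𝒳 → ℝ} {μ σ : 𝒳 → ℝ} (hm : Measurable m.uncurry) (hs : Measurable s.uncurry)
    (hμ : Measurable μ) (hσ : Measurable σ) : Measurable
      (fun ω x => ENNReal.ofReal (|m ω x - μ x| + |s ω x - σ x|)).uncurry :=
  ((hm.sub (hμ.comp measurable_snd)).abs.add (hs.sub (hσ.comp measurable_snd)).abs).ennreal_ofReal

namespace IsIIDRegression

variable {Ω 𝒳 : Type*} [m₀ : MeasurableSpace Ω] [MeasurableSpace 𝒳] {P : Measure Ω} {n : ℕ}
  {D₀ : Fin n → Ω → 𝒳 × ℝ} {X : ℕ → Ω → 𝒳} {ξ Y : ℕ → Ω → ℝ} {μ σ : 𝒳 → ℝ}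
  {μhat σhat : ℕ → Ω → 𝒳 → ℝ}

lemma map_covariate (h : IsIIDRegression P D₀ X ξ Y μ σ) (k : ℕ) :
    P.map (X (k + 1)) = P.map (X 1) :=
  ((h.identDistrib k).comp measurable_fst).map_eq

lemma measurable_past_absError (h : IsIIDRegression P D₀ X ξ Y μ σ)
    (hμhat : IsPastMeasurable (past D₀ X Y) μhat) (hσhat : IsPastMeasurable (past D₀ X Y) σhat)
    (k : ℕ) : Measurable[(past D₀ X Y k).prod inferInstance] (fun ω x => ENNReal.ofReal
      (|μhat (k + 1) ω x - μ x| + |σhat (k + 1) ω x - σ x|)).uncurry :=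
  @measurable_uncurry_absError Ω 𝒳 (past D₀ X Y k) _ (μhat (k + 1)) (σhat (k + 1)) μ σ
    (hμhat (k + 1) (by lia)) (hσhat (k + 1) (by lia)) h.measurable_mean h.measurable_scale

variable [IsProbabilityMeasure P]

lemma indep_past_covariate (h : IsIIDRegression P D₀ X ξ Y μ σ) (k : ℕ) :
    Indep (past D₀ X Y k) (MeasurableSpace.comap (X (k + 1)) inferInstance) P :=
  indep_of_indep_of_le_right (h.indep_past k)
    (measurable_fst.comp (comap_measurable fun ω => (X (k + 1) ω, ξ (k + 1) ω))).comap_le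

theorem condLExp_absError (h : IsIIDRegression P D₀ X ξ Y μ σ)
    (hμhat : IsPastMeasurable (past D₀ X Y) μhat) (hσhat : IsPastMeasurable (past D₀ X Y) σhat)
    (k : ℕ) :
    condLExp (past D₀ X Y k) P (fun ω => ENNReal.ofReal
      (|μhat (k + 1) ω (X (k + 1) ω) - μ (X (k + 1) ω)| +
        |σhat (k + 1) ω (X (k + 1) ω) - σ (X (k + 1) ω)|)) =ᵐ[P]
      fun ω => estimationError (P.map (X 1)) μ σ (μhat (k + 1) ω) (σhat (k + 1) ω) := by
  simp_rw [estimationError, ← h.map_covariate k]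
  exact condLExp_comp_of_indep (h.past_le k) (h.measurable_X _ (by lia)) (h.indep_past_covariate k)
    (h.measurable_past_absError hμhat hσhat k)

theorem lintegral_sq_estimationError_le (h : IsIIDRegression P D₀ X ξ Y μ σ)
    (hμhat : IsPastMeasurable (past D₀ X Y) μhat) (hσhat : IsPastMeasurable (past D₀ X Y) σhat)
    (k : ℕ) :
    ∫⁻ ω, estimationError (P.map (X 1)) μ σ (μhat (k + 1) ω) (σhat (k + 1) ω) ^ 2 ∂P ≤
      2 * (∫⁻ ω, ENNReal.ofReal ((μhat (k + 1) ω (X (k + 1) ω) - μ (X (k + 1) ω)) ^ 2) ∂P +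
        ∫⁻ ω, ENNReal.ofReal ((σhat (k + 1) ω (X (k + 1) ω) - σ (X (k + 1) ω)) ^ 2) ∂P) := by
  have hX := h.measurable_X (k + 1) (by lia)
  have hmean : Measurable fun ω => μhat (k + 1) ω (X (k + 1) ω) :=
    measurable_comp_of_measurable_uncurry (h.past_le k) hX (hμhat (k + 1) (by lia))
  have hsq : Measurable fun ω =>
      ENNReal.ofReal ((μhat (k + 1) ω (X (k + 1) ω) - μ (X (k + 1) ω)) ^ 2) :=
    ((hmean.sub (h.measurable_mean.comp hX)).pow_const 2).ennreal_ofReal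
  have herr := h.measurable_past_absError hμhat hσhat k
  have := Measure.isProbabilityMeasure_map hX.aemeasurable (μ := P)
  simp_rw [estimationError, ← h.map_covariate k]
  refine (lintegral_mono fun ω => sq_lintegral_le_lintegral_sq
    (herr.comp measurable_prodMk_left).aemeasurable).trans ?_
  refine (lintegral_comp_of_indep (h.past_le k) hX (h.indep_past_covariate k)
    (herr.pow_const 2)).symm.trans_le ?_
  rw [← lintegral_add_left hsq, ← lintegral_const_mul' _ _ ENNReal.ofNat_ne_top]
  exact lintegral_mono fun ω => ofReal_abs_add_abs_sq_le _ _

variable {b : ℕ → Ω → ℝ} {C : ℝ}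

theorem exists_bias_tail (h : IsIIDRegression P D₀ X ξ Y μ σ)
    (hμhat : IsPastMeasurable (past D₀ X Y) μhat) (hσhat : IsPastMeasurable (past D₀ X Y) σhat)
    {ν₀ ν : ℝ} (hrate : RateInProbability P (past D₀ X Y) X μ σ μhat σhat ν₀ ν) (hC : 0 < C)
    (hb : ∀ k ω, ‖b k ω‖ₑ ≤ ENNReal.ofReal C *
      estimationError (P.map (X 1)) μ σ (μhat (k + 1) ω) (σhat (k + 1) ω)) :
    ∃ C' > 0, ∀ᶠ k : ℕ in atTop, P.real {ω | C' * logRate ν₀ ν (k + 1) < |b k ω|} ≤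
      1 / ((k : ℝ) + 1) ^ 3 := by
  obtain ⟨C₁, hC₁, hev⟩ := hrate
  refine ⟨C * C₁, by positivity, ?_⟩
  filter_upwards [(tendsto_add_atTop_nat 1).eventually hev] with k hk
  rw [Nat.add_sub_cancel] at hk
  push_cast at hk
  have hrate₀ := logRate_nonneg (one_le_natCast_add_one k) ν₀ ν
  rw [mul_assoc C₁] at hk
  have htail : P {ω | C * C₁ * logRate ν₀ ν (k + 1) < |b k ω|} ≤
      ENNReal.ofReal (3 / (Real.pi ^ 2 * ((k : ℝ) + 1) ^ 3)) := by
    refine le_trans (measure_mono_ae ?_) hk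
    filter_upwards [h.condLExp_absError hμhat hσhat k] with ω hω hlarge
    refine Set.mem_ofPred.2 (le_of_le_of_eq (le_of_not_gt fun hsmall => ?_) hω.symm)
    have hbω := (hb k ω).trans (mul_le_mul_right hsmall.le _)
    rw [← ENNReal.ofReal_mul hC.le, Real.enorm_eq_ofReal_abs, ← logRate, ← mul_assoc,
      ENNReal.ofReal_le_ofReal_iff (mul_nonneg (by positivity) hrate₀)] at hbω
    exact not_lt_of_ge hbω hlarge
  refine ENNReal.toReal_le_of_le_ofReal (by positivity)
    (htail.trans (ENNReal.ofReal_le_ofReal ?_))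
  rw [div_le_div_iff₀ (by positivity) (by positivity), one_mul]
  gcongr
  nlinarith [Real.pi_gt_three]

theorem exists_integral_bias_sq_le (h : IsIIDRegression P D₀ X ξ Y μ σ)
    (hμhat : IsPastMeasurable (past D₀ X Y) μhat) (hσhat : IsPastMeasurable (past D₀ X Y) σhat)
    {τ₀ τ : ℝ} (hrate : RateInMean P X μ σ μhat σhat τ₀ τ) (hC : 0 ≤ C)
    (hbm : ∀ k, Measurable (b k))
    (hb : ∀ k ω, ‖b k ω‖ₑ ≤ ENNReal.ofReal C *
      estimationError (P.map (X 1)) μ σ (μhat (k + 1) ω) (σhat (k + 1) ω)) :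
    ∃ C' ≥ 0, ∀ᶠ k : ℕ in atTop,
      ∫ ω, b k ω ^ 2 ∂P ≤ C' * logRate (2 * τ₀) (2 * τ) (k + 1) := by
  obtain ⟨C₁, hC₁, hev⟩ := hrate
  refine ⟨C ^ 2 * (2 * C₁), by positivity, ?_⟩
  filter_upwards [(tendsto_add_atTop_nat 1).eventually hev] with k hk
  push_cast at hk
  rw [integral_eq_lintegral_of_nonneg_ae (.of_forall fun ω => sq_nonneg _)
    ((hbm k).pow_const 2).aestronglyMeasurable]
  refine ENNReal.toReal_le_of_le_ofReal
    (mul_nonneg (by positivity) (logRate_nonneg (one_le_natCast_add_one k) _ _)) ?_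
  calc ∫⁻ ω, ENNReal.ofReal (b k ω ^ 2) ∂P
      ≤ ∫⁻ ω, ENNReal.ofReal C ^ 2 *
          estimationError (P.map (X 1)) μ σ (μhat (k + 1) ω) (σhat (k + 1) ω) ^ 2 ∂P := by
        refine lintegral_mono fun ω => ?_
        rw [← mul_pow, ← sq_abs, ENNReal.ofReal_pow (abs_nonneg _), ← Real.enorm_eq_ofReal_abs]
        exact pow_le_pow_left' (hb k ω) 2
    _ ≤ ENNReal.ofReal C ^ 2 * (2 * ENNReal.ofReal (C₁ * logRate (2 * τ₀) (2 * τ) (k + 1))) := by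
        rw [lintegral_const_mul' _ _ (by finiteness), logRate, ← mul_assoc C₁]
        gcongr
        exact (h.lintegral_sq_estimationError_le hμhat hσhat k).trans (by gcongr)
    _ = ENNReal.ofReal (C ^ 2 * (2 * C₁) * logRate (2 * τ₀) (2 * τ) (k + 1)) := by
        rw [← ENNReal.ofReal_pow hC, ← ENNReal.ofReal_ofNat 2, ← ENNReal.ofReal_mul zero_le_two,
          ← ENNReal.ofReal_mul (sq_nonneg C), ← mul_assoc, ← mul_assoc, mul_assoc (C ^ 2)]

end IsIIDRegression

/-! ### Rates of OnlineSCI -/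

lemma eventually_atTop_of_succ {p : ℕ → Prop} (h : ∀ᶠ k in atTop, p (k + 1)) :
    ∀ᶠ t in atTop, p t := by
  rwa [← map_add_atTop_eq_nat 1, eventually_map]

lemma exists_eventually_forall_ge {p : ℕ → ℝ → Prop} {H : Prop}
    (h : H → ∃ C > 0, ∀ᶠ t in atTop, p t C) (hmono : ∀ t C C', C ≤ C' → p t C → p t C') :
    ∃ C > 0, ∀ᶠ t in atTop, ∀ C' ≥ C, H → p t C' := by
  by_cases hH : H
  · obtain ⟨C, hC, hev⟩ := h hH
    exact ⟨C, hC, hev.mono fun t ht C' hC' _ => hmono t C C' hC' ht⟩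
  · exact ⟨1, one_pos, .of_forall fun _ _ _ hH' => absurd hH' hH⟩

/-- The instantaneous error rate `IER_t`. -/
noncomputable def errorRate {Ω 𝒳 : Type*} [MeasurableSpace Ω] [MeasurableSpace 𝒳] (P : Measure Ω)
    {n : ℕ} (D₀ : Fin n → Ω → 𝒳 × ℝ) (X : ℕ → Ω → 𝒳) (Y : ℕ → Ω → ℝ) (S : 𝒳 → Bool)
    (μhat σhat : ℕ → Ω → 𝒳 → ℝ) (q : ℕ → Ω → ℝ) (t : ℕ) : Ω → ℝ :=
  instErrorRate P (past D₀ X Y (t - 1)) (fun ω => S (X t ω))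
    (fun ω => covErr (Y t ω) (predictionSet X μhat σhat q t ω))

namespace IsIIDRegression

variable {Ω 𝒳 : Type*} [MeasurableSpace Ω] [MeasurableSpace 𝒳] {P : Measure Ω}
  [IsProbabilityMeasure P] {n : ℕ} {D₀ : Fin n → Ω → 𝒳 × ℝ} {X : ℕ → Ω → 𝒳} {ξ Y : ℕ → Ω → ℝ}
  {μ σ : 𝒳 → ℝ} {f : ℝ → ℝ} {S : 𝒳 → Bool} {μhat σhat : ℕ → Ω → 𝒳 → ℝ} {q : ℕ → Ω → ℝ}
  {α β c q₁ ν₀ ν τ₀ τ : ℝ}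

theorem exists_error_rate_in_probability (h : IsIIDRegression P D₀ X ξ Y μ σ)
    (hnoise : IsSymmetricNoise (P.map (ξ 1)) f) (hσ : BddAbove (Set.range fun x => 1 / σ x))
    (hq : IsOnlineSCI α β c q₁ S X Y μhat σhat q)
    (hS : Measurable S) (hr : 0 < P.real {ω | S (X 1 ω) = true})
    (hμhat : IsPastMeasurable (past D₀ X Y) μhat) (hσhat : IsPastMeasurable (past D₀ X Y) σhat)
    (hα : α ∈ Set.Ioo (0 : ℝ) 1) (hβ : β ∈ Set.Ioo (0 : ℝ) 1) (hc : 0 < c)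
    (hν₀ : 0 ≤ ν₀) (hν : 0 ≤ ν)
    (hrate : RateInProbability P (past D₀ X Y) X μ σ μhat σhat ν₀ ν) :
    ∃ C > 0, ∀ᶠ t : ℕ in atTop, 1 - 1 / (t : ℝ) ≤ P.real {ω |
      |errorRate P D₀ X Y S μhat σhat q t ω - α| +
        |q t ω - targetThreshold (P.map (ξ 1)) α| ≤
      C * (√(Real.log t * (t : ℝ) ^ (-β)) + logRate ν₀ ν t)} := by
  have hqm := hq.measurable_past_threshold hS hμhat hσhat
  obtain ⟨B, κ, K, hRM⟩ := h.exists_isRobbinsMonro hnoise hq hS hr hμhat hσhat hα hβ hc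
  obtain ⟨C₁, hC₁, hbias⟩ := h.exists_enorm_bias_le hnoise hσ hqm hS hμhat hσhat α
  obtain ⟨C₂, hC₂, htail⟩ := h.exists_bias_tail hμhat hσhat hrate hC₁ hbias
  have hrate₀ := fun k : ℕ => logRate_nonneg (one_le_natCast_add_one k) ν₀ ν
  obtain ⟨C, hC, hev⟩ := hRM.exists_error_rate_in_probability hr
    (fun k => h.instErrorRate_sub hS hr hμhat hσhat (hqm k)) (by positivity) zero_le_one
    (v := fun k => C₂ * logRate ν₀ ν (k + 1)) (fun k => mul_nonneg hC₂.le (hrate₀ k))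
    (Cv := 2 ^ ν) (by positivity)
    (.of_forall fun k j hj hjk =>
      (mul_le_mul_of_nonneg_left (logRate_le_of_half_le hν₀ hν hj hjk) hC₂.le).trans_eq
        (mul_left_comm _ _ _))
    (h.eventually_stepSize_tail hS hβ.1.le hc.le hr) htail
  refine ⟨C * max 1 C₂, by positivity, eventually_atTop_of_succ (hev.mono fun k hk => ?_)⟩
  push_cast
  have hrate₀ := hrate₀ k
  have hsqrt := Real.sqrt_nonneg (Real.log ((k : ℝ) + 1) * ((k : ℝ) + 1) ^ (-β))
  refine hk.trans (measureReal_mono (Set.ofPred_subset_ofPred.2 fun ω hω => hω.trans ?_))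
  rw [mul_assoc, mul_add (max 1 C₂)]
  gcongr
  · exact le_mul_of_one_le_left hsqrt (le_max_left _ _)
  · exact le_max_right _ _

theorem exists_error_rate_in_mean (h : IsIIDRegression P D₀ X ξ Y μ σ)
    (hnoise : IsSymmetricNoise (P.map (ξ 1)) f) (hσ : BddAbove (Set.range fun x => 1 / σ x))
    (hq : IsOnlineSCI α β c q₁ S X Y μhat σhat q)
    (hS : Measurable S) (hr : 0 < P.real {ω | S (X 1 ω) = true})
    (hμhat : IsPastMeasurable (past D₀ X Y) μhat) (hσhat : IsPastMeasurable (past D₀ X Y) σhat)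
    (hα : α ∈ Set.Ioo (0 : ℝ) 1) (hβ : β ∈ Set.Ioo (0 : ℝ) 1) (hc : 0 < c)
    (hτ₀ : 0 ≤ τ₀) (hτ : 0 ≤ τ) (hrate : RateInMean P X μ σ μhat σhat τ₀ τ) :
    ∃ C > 0, ∀ᶠ t : ℕ in atTop,
      MemLp (fun ω => errorRate P D₀ X Y S μhat σhat q t ω - α) 2 P ∧
      MemLp (fun ω => q t ω - targetThreshold (P.map (ξ 1)) α) 2 P ∧
      ∫ ω, (errorRate P D₀ X Y S μhat σhat q t ω - α) ^ 2 ∂P +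
          ∫ ω, (q t ω - targetThreshold (P.map (ξ 1)) α) ^ 2 ∂P ≤
        C * ((t : ℝ) ^ (-β) + logRate (2 * τ₀) (2 * τ) t) := by
  have hqm := hq.measurable_past_threshold hS hμhat hσhat
  obtain ⟨B, κ, K, hRM⟩ := h.exists_isRobbinsMonro hnoise hq hS hr hμhat hσhat hα hβ hc
  obtain ⟨C₁, hC₁, hbias⟩ := h.exists_enorm_bias_le hnoise hσ hqm hS hμhat hσhat α
  obtain ⟨C₂, -, hmean⟩ :=
    h.exists_integral_bias_sq_le hμhat hσhat hrate hC₁.le hRM.measurable_bias hbias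
  have hrate₀ := fun k : ℕ => logRate_nonneg (one_le_natCast_add_one k) (2 * τ₀) (2 * τ)
  obtain ⟨C, hC, hev⟩ := hRM.exists_error_rate_in_mean
    (fun k => h.instErrorRate_sub hS hr hμhat hσhat (hqm k)) (by positivity)
    (C := max 1 C₂) (by positivity)
    (v := fun k => logRate 0 β (k + 1) + logRate (2 * τ₀) (2 * τ) (k + 1))
    (fun b hb => by
      filter_upwards [eventually_mul_logRate_le_succ hβ.2 le_rfl hβ.1.le hb,
        eventually_mul_logRate_le_succ hβ.2 (by positivity : 0 ≤ 2 * τ₀)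
          (by positivity : 0 ≤ 2 * τ) hb] with k hk₁ hk₂
      rw [mul_add]
      exact add_le_add hk₁ hk₂)
    (.of_forall fun k => by
      rw [logRate_zero_left]
      exact le_add_of_nonneg_right (hrate₀ k))
    ((h.eventually_stepSize_tail hS hβ.1.le hc.le hr).mono fun k hk =>
      hk.trans (by gcongr; exact le_max_left _ _))
    (hmean.mono fun k hk => hk.trans (mul_le_mul (le_max_right _ _)
      (le_add_of_nonneg_left (logRate_nonneg (one_le_natCast_add_one k) _ _)) (hrate₀ k)
      (by positivity)))
  refine ⟨C, hC, eventually_atTop_of_succ (hev.mono fun k hk => ?_)⟩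
  rw [logRate_zero_left] at hk
  push_cast
  exact hk

end IsIIDRegression

/-! ### Comparison of rates -/

lemma sqrt_log_mul_rpow_neg_le_rho {β : ℝ} (hβ : β ∈ Set.Icc (0 : ℝ) 1) {t : ℕ} (ht : 1 ≤ t) :
    √(Real.log t * (t : ℝ) ^ (-β)) ≤ rho β t := by
  have ht₁ : (1 : ℝ) ≤ t := by exact_mod_cast ht
  have hlog := Real.log_nonneg ht₁
  have hle : ∀ s, -β / 2 ≤ s →
      √(Real.log t * (t : ℝ) ^ (-β)) ≤ Real.log t ^ (1 / 2 : ℝ) * (t : ℝ) ^ s := fun s hs => by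
    rw [Real.sqrt_mul hlog, Real.sqrt_eq_rpow, Real.sqrt_eq_rpow, ← Real.rpow_mul t.cast_nonneg,
      mul_one_div]
    gcongr
  rw [rho]
  split_ifs
  · exact hle _ (by linarith [hβ.1])
  · exact (hle _ (by linarith [hβ.2])).trans (le_add_of_nonneg_right (by positivity))

lemma eventually_rpow_neg_add_logRate_le {β τ₀ τ : ℝ} (hβ : β < 1) (hτ₀ : 0 ≤ τ₀)
    (hτ : τ ∈ Set.Icc (0 : ℝ) 1) :
    ∀ᶠ t : ℕ in atTop, (t : ℝ) ^ (-β) + logRate (2 * τ₀) (2 * τ) t ≤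
      2 * (Real.log t ^ τ₀ * (t : ℝ) ^ (1 - τ - β)) := by
  filter_upwards [tendsto_natCast_atTop_atTop.eventually (eventually_ge_atTop (Real.exp 1)),
    tendsto_natCast_atTop_atTop.eventually ((isLittleO_log_rpow_rpow_atTop τ₀
      (by linarith [hτ.1] : 0 < 1 - β + τ)).eventuallyLE)] with t ht hlog_le
  have ht₀ : (0 : ℝ) < t := (Real.exp_pos 1).trans_le ht
  have hlog : 1 ≤ Real.log t := (Real.le_log_iff_exp_le ht₀).2 ht
  have ht₁ : (1 : ℝ) ≤ t := (Real.one_le_exp zero_le_one).trans ht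
  have hbias : logRate (2 * τ₀) (2 * τ) t ≤ Real.log t ^ τ₀ * (t : ℝ) ^ (1 - τ - β) := by
    rw [Real.norm_of_nonneg (by positivity), Real.norm_of_nonneg (by positivity)] at hlog_le
    calc logRate (2 * τ₀) (2 * τ) t
        = Real.log t ^ τ₀ * (Real.log t ^ τ₀ * (t : ℝ) ^ (-(2 * τ))) := by
          rw [logRate, two_mul τ₀, Real.rpow_add (by linarith), mul_assoc]
      _ ≤ Real.log t ^ τ₀ * ((t : ℝ) ^ (1 - β + τ) * (t : ℝ) ^ (-(2 * τ))) := by gcongr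
      _ = Real.log t ^ τ₀ * (t : ℝ) ^ (1 - τ - β) := by
          rw [← Real.rpow_add ht₀]; ring_nf
  have hstep : (t : ℝ) ^ (-β) ≤ Real.log t ^ τ₀ * (t : ℝ) ^ (1 - τ - β) :=
    (Real.rpow_le_rpow_of_exponent_le ht₁ (by linarith [hτ.2])).trans
      (le_mul_of_one_le_left (by positivity) (Real.one_le_rpow hlog hτ₀))
  linarith

lemma integrable_and_sq_integral_abs_mul_indicator_le {Ω : Type*} [MeasurableSpace Ω]
    {P : Measure Ω} [IsProbabilityMeasure P] {g : Ω → ℝ} (hg : MemLp g 2 P) {A : Set Ω}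
    (hA : NullMeasurableSet A P) :
    Integrable (fun ω => |g ω| * A.indicator 1 ω) P ∧
      (∫ ω, |g ω| * A.indicator 1 ω ∂P) ^ 2 ≤ ∫ ω, g ω ^ 2 ∂P := by
  have hmul : (fun ω => |g ω| * A.indicator 1 ω) = A.indicator fun ω => |g ω| := by
    ext ω
    by_cases hω : ω ∈ A <;> simp [hω]
  have habs := (hg.integrable one_le_two).abs
  rw [hmul]
  refine ⟨habs.indicator₀ hA, ?_⟩
  calc (∫ ω, A.indicator (fun ω => |g ω|) ω ∂P) ^ 2 ≤ (∫ ω, |g ω| ∂P) ^ 2 :=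
        pow_le_pow_left₀
          (integral_nonneg fun ω => Set.indicator_nonneg (fun _ _ => abs_nonneg _) ω)
          (integral_mono (habs.indicator₀ hA) habs
            (Set.indicator_le_self' fun _ _ => abs_nonneg _)) 2
    _ ≤ ∫ ω, |g ω| ^ 2 ∂P := sq_integral_le_integral_sq hg.abs
    _ = ∫ ω, g ω ^ 2 ∂P := by simp_rw [sq_abs]

lemma IsRegularNoise.isSymmetricNoise {Ω 𝒳 : Type*} [MeasurableSpace Ω] {P : Measure Ω}
    {ξ₁ : Ω → ℝ} {f : ℝ → ℝ} {σ : 𝒳 → ℝ} (h : IsRegularNoise P ξ₁ f σ) :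
    IsSymmetricNoise (P.map ξ₁) f :=
  { h with }

end OnlineSCI

theorem mainTheorem5_general {Ω 𝒳 : Type*} [MeasurableSpace Ω] [MeasurableSpace 𝒳]
    (P : Measure Ω) [IsProbabilityMeasure P]
    {n : ℕ} (D₀ : Fin n → Ω → 𝒳 × ℝ) (X : ℕ → Ω → 𝒳) (ξ Y : ℕ → Ω → ℝ)
    (μ σ : 𝒳 → ℝ) (f : ℝ → ℝ)
    (hmodel : OnlineSCI.IsIIDRegression P D₀ X ξ Y μ σ)
    (hnoise : OnlineSCI.IsSymmetricNoise (P.map (ξ 1)) f)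
    (hσ : BddAbove (Set.range fun x => 1 / σ x))
    (μhat σhat : ℕ → Ω → 𝒳 → ℝ)
    (hμhat : OnlineSCI.IsPastMeasurable (OnlineSCI.past D₀ X Y) μhat)
    (hσhat : OnlineSCI.IsPastMeasurable (OnlineSCI.past D₀ X Y) σhat)
    (S : 𝒳 → Bool) (hS : Measurable S) (hr : 0 < P {ω | S (X 1 ω) = true})
    (α β c q₁ ν₀ ν τ₀ τ : ℝ) (hα : α ∈ Set.Ioo (0 : ℝ) 1) (hβ : β ∈ Set.Ioo (0 : ℝ) 1)
    (hc : 0 < c) (hν₀ : 0 ≤ ν₀) (hν : 0 ≤ ν) (hτ₀ : 0 ≤ τ₀) (hτ : 0 ≤ τ)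
    (q : ℕ → Ω → ℝ) (hq : OnlineSCI.IsOnlineSCI α β c q₁ S X Y μhat σhat q)
    (IER : ℕ → Ω → ℝ) (hIER : IER = OnlineSCI.errorRate P D₀ X Y S μhat σhat q)
    (q₀ : ℝ) (hq₀ : q₀ = OnlineSCI.targetThreshold (P.map (ξ 1)) α) :
    ∃ C₀ > 0, ∀ᶠ t : ℕ in atTop,
      (OnlineSCI.RateInProbability P (OnlineSCI.past D₀ X Y) X μ σ μhat σhat ν₀ ν →
        1 - 1 / (t : ℝ) ≤ P.real {ω | |IER t ω - α| + |q t ω - q₀| ≤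
          C₀ * (√(Real.log t * (t : ℝ) ^ (-β)) + OnlineSCI.logRate ν₀ ν t)}) ∧
      (OnlineSCI.RateInMean P X μ σ μhat σhat τ₀ τ →
        MemLp (fun ω => IER t ω - α) 2 P ∧ MemLp (fun ω => q t ω - q₀) 2 P ∧
        ∫ ω, (IER t ω - α) ^ 2 ∂P + ∫ ω, (q t ω - q₀) ^ 2 ∂P ≤
          C₀ * ((t : ℝ) ^ (-β) + OnlineSCI.logRate (2 * τ₀) (2 * τ) t)) := by
  subst hIER hq₀
  have hr' := ENNReal.toReal_pos hr.ne' (measure_ne_top _ _)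
  obtain ⟨C₁, hC₁, h₁⟩ := OnlineSCI.exists_eventually_forall_ge
    (hmodel.exists_error_rate_in_probability hnoise hσ hq hS hr' hμhat hσhat hα hβ hc hν₀ hν)
    fun t C C' hCC' hp => hp.trans (measureReal_mono (Set.ofPred_subset_ofPred.2 fun ω hω =>
      hω.trans (mul_le_mul_of_nonneg_right hCC'
        (add_nonneg (Real.sqrt_nonneg _) (OnlineSCI.logRate_natCast_nonneg t ν₀ ν)))))
  obtain ⟨C₂, -, h₂⟩ := OnlineSCI.exists_eventually_forall_ge
    (hmodel.exists_error_rate_in_mean hnoise hσ hq hS hr' hμhat hσhat hα hβ hc hτ₀ hτ)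
    fun t C C' hCC' hp => ⟨hp.1, hp.2.1, hp.2.2.trans (mul_le_mul_of_nonneg_right hCC'
      (add_nonneg (by positivity) (OnlineSCI.logRate_natCast_nonneg t (2 * τ₀) (2 * τ))))⟩
  exact ⟨max C₁ C₂, lt_max_of_lt_left hC₁, (h₁.and h₂).mono fun t ht =>
    ⟨ht.1 _ (le_max_left _ _), ht.2 _ (le_max_right _ _)⟩⟩

theorem mainTheorem5 {Ω 𝒳 : Type*} [MeasurableSpace Ω] [MeasurableSpace 𝒳]
    (P : Measure Ω) [IsProbabilityMeasure P]
    -- data: holdout sample, covariates, noise, responses; the regression model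
    {n : ℕ} (D₀ : Fin n → Ω → 𝒳 × ℝ) (X : ℕ → Ω → 𝒳) (ξ Y : ℕ → Ω → ℝ)
    (μ σ : 𝒳 → ℝ) (f : ℝ → ℝ)
    (hmodel : OnlineSCI.IsIIDRegression P D₀ X ξ Y μ σ)
    (hnoise : OnlineSCI.IsRegularNoise P (ξ 1) f σ)
    -- past information and estimators
    (ℱ : ℕ → MeasurableSpace Ω) (hℱ : ℱ = OnlineSCI.past D₀ X Y)
    (μhat σhat : ℕ → Ω → 𝒳 → ℝ)
    (hμhat : OnlineSCI.IsPastMeasurable ℱ μhat) (hσhat : OnlineSCI.IsPastMeasurable ℱ σhat)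
    -- time-constant selection rule depending on the covariate only
    (S : 𝒳 → Bool) (hS : Measurable S) (hr : 0 < P {ω | S (X 1 ω) = true})
    -- parameters
    (α β c q₁ ν₀ ν τ₀ τ : ℝ) (hα : α ∈ Set.Ioo (0 : ℝ) 1) (hβ : β ∈ Set.Ioo (0 : ℝ) 1)
    (hc : 0 < c) (hq₁ : q₁ ∈ Set.Icc (0 : ℝ) 1)
    (hν₀ : 0 < ν₀) (hν : ν ∈ Set.Ioc (0 : ℝ) (1 / 2))
    (hτ₀ : 0 < τ₀) (hτ : τ ∈ Set.Ioc (0 : ℝ) (1 / 2))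
    -- the OnlineSCI threshold sequence, its instantaneous error rate and the target threshold
    (q : ℕ → Ω → ℝ)
    (hq : q = fun t ω => OnlineSCI.sciThreshold α (fun j => c * (j : ℝ) ^ (-β)) q₁
      (fun _ x _ => S x) (fun k x z => OnlineSCI.predInterval (μhat k ω x) (σhat k ω x) z)
      (fun k => X k ω) (fun k => Y k ω) t)
    (IER : ℕ → Ω → ℝ)
    (hIER : IER = fun t => OnlineSCI.instErrorRate P (ℱ (t - 1)) (fun ω => S (X t ω))
      (fun ω => OnlineSCI.covErr (Y t ω)
        (OnlineSCI.predInterval (μhat t ω (X t ω)) (σhat t ω (X t ω)) (q t ω))))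
    (q₀ : ℝ) (hq₀ : q₀ = OnlineSCI.targetThreshold (P.map (ξ 1)) α) :
    ∃ (T₀ : ℕ) (C₀ : ℝ), 1 ≤ T₀ ∧ 0 < C₀ ∧ ∀ t : ℕ, T₀ ≤ t →
      (1 / 2 < β → OnlineSCI.RateInProbability P ℱ X μ σ μhat σhat ν₀ ν →
        1 - 1 / (t : ℝ) ≤ P.real {ω | |IER t ω - α| + |q t ω - q₀| ≤
          C₀ * (OnlineSCI.rho β t + Real.log t ^ ν₀ * (t : ℝ) ^ (-ν))}) ∧
      (1 - τ < β → OnlineSCI.RateInMean P X μ σ μhat σhat τ₀ τ →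
        Integrable (fun ω => |IER t ω - α| * {ω | q t ω ∈ Set.Icc (0 : ℝ) 1}.indicator 1 ω) P ∧
        Integrable (fun ω => (q t ω - q₀) ^ 2) P ∧
        (∫ ω, |IER t ω - α| * {ω | q t ω ∈ Set.Icc (0 : ℝ) 1}.indicator 1 ω ∂P) ^ 2 +
            ∫ ω, (q t ω - q₀) ^ 2 ∂P
          ≤ C₀ * Real.log t ^ τ₀ * (t : ℝ) ^ (1 - τ - β)) := by
  subst hq hIER hq₀ hℱ
  obtain ⟨C, hC, hev⟩ := mainTheorem5_general P D₀ X ξ Y μ σ f hmodel hnoise.isSymmetricNoise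
    hnoise.bounded_inv_scale μhat σhat hμhat hσhat S hS hr α β c q₁ ν₀ ν τ₀ τ hα hβ hc hν₀.le
    hν.1.le hτ₀.le hτ.1.le _ OnlineSCI.isOnlineSCI_sciThreshold _ rfl _ rfl
  obtain ⟨T, hT⟩ := eventually_atTop.1 (hev.and
    (OnlineSCI.eventually_rpow_neg_add_logRate_le hβ.2 hτ₀.le ⟨hτ.1.le, by linarith [hτ.2]⟩))
  refine ⟨max 1 T, 2 * C, le_max_left _ _, by positivity, fun t ht => ?_⟩
  obtain ⟨⟨hprob, hmean⟩, hrate⟩ := hT t (le_of_max_le_right ht)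
  have hrho := OnlineSCI.sqrt_log_mul_rpow_neg_le_rho (Set.Ioo_subset_Icc_self hβ)
    (le_of_max_le_left ht)
  refine ⟨fun _ hest => (hprob hest).trans (measureReal_mono
    (Set.ofPred_subset_ofPred.2 fun ω hω => hω.trans ?_)), fun _ hest => ?_⟩
  · have hlogRate := OnlineSCI.logRate_natCast_nonneg t ν₀ ν
    exact mul_le_mul (by linarith) (add_le_add_left hrho _) (by positivity) (by positivity)
  · obtain ⟨hIER, hq, hle⟩ := hmean hest
    obtain ⟨hint, hsq⟩ := OnlineSCI.integrable_and_sq_integral_abs_mul_indicator_le hIER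
      ((by simpa using hq.aemeasurable.add_const (OnlineSCI.targetThreshold (P.map (ξ 1)) α) :
        AEMeasurable _ P).nullMeasurable measurableSet_Icc)
    refine ⟨hint, hq.integrable_sq, ?_⟩
    calc _ ≤ _ := (add_le_add_left hsq _).trans hle
      _ ≤ C * (2 * (Real.log t ^ τ₀ * (t : ℝ) ^ (1 - τ - β))) := by gcongr
      _ = 2 * C * Real.log t ^ τ₀ * (t : ℝ) ^ (1 - τ - β) := by ring
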